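/- **Theorem 8.1.** The system $\mathbf{CL17}$ is decidable: the algorithm DECISION described below halts on every closed cirquent $E$, accepting it if $\mathbf{CL17}\vdash E$ and rejecting it if $\mathbf{CL17}\not\vdash E$. Every recursive call that it makes on an input $E$ is made on a cirquent of smaller rank than $E$. In particular, the set of closed cirquents provable in $\mathbf{CL17}$ is computable. *Language.* Terms are variables and constants $0,1,2,\dots$. Atoms are $p(t_1,\dots,t_n)$ with $p$ one of infinitely many $n$-ary predicate letters ($n\ge 0$) and $t_i$ terms. There are four disjoint infinite sets of clusters, one for each of the choice operators $\sqcap,\sqcup$ (binary) and $\forall^{\sqcap},\exists^{\sqcup}$ (quantifiers; written $\sqcap^{c}x$, $\sqcup^{c}x$ below). Cirquents are built from $\top$, $\bot$, atoms and negated atoms by $A\wedge B$, $A\vee B$, $A\sqcap^{c}B$, $A\sqcup^{c}B$, $\sqcap^{c}x\,A$, $\sqcup^{c}x\,A$, where $c$ is a cluster of the respective kind. As usual, cirquents that differ only in the names of bound variables are identified, and substitution does not capture variables: $A(t)$ is the result of replacing the free occurrences of $x$ in $A(x)$ by $t$, bound variables being renamed where necessary. A cirquent is closed if it has no free variable occurrences.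 $X[A]$ denotes a cirquent with a fixed occurrence of a subcirquent $A$ (possibly in the scope of quantifiers of $X$). An occurrence is a surface occurrence if it is not in the scope of a choice operator. *Calculus.* The only axiom of $\mathbf{CL17}$ is $\top$. The rules, premises $\leadsto$ conclusion, are: - $X[B\vee A]\leadsto X[A\vee B]$; $X[B\wedge A]\leadsto X[A\wedge B]$; $X[A\vee(B\vee C)]\leadsto X[(A\vee B)\vee C]$; $X[A\wedge(B\wedge C)]\leadsto X[(A\wedge B)\wedge C]$; $X[A]\leadsto X[A\vee\bot]$; $X[A]\leadsto X[A\wedge\top]$; $X[\top]\leadsto X[A\vee\top]$; $X[\bot]\leadsto X[A\wedge\bot]$. - Choosing: $E'\leadsto E$, where $E'$ results from $E$ by replacing, for some cluster $c$, all subcirquents $A\sqcup^{c}B$ of $E$ by $A$, or all by $B$; or all subcirquents $\sqcup^{c}x\,A(x)$ by $A(a)$ for one constant $a$ (nested subcirquents with the same cluster being replaced as well). - Cleansing: $X[Y[A]\sqcap^{c}C]\leadsto X[Y[A\sqcap^{c}B]\sqcap^{c}C]$; $X[C\sqcap^{c}Y[B]]\leadsto X[C\sqcap^{c}Y[A\sqcap^{c}B]]$;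 $X[\sqcap^{c}x\,Y[A(x)]]\leadsto X[\sqcap^{c}x\,Y[\sqcap^{c}y\,A(y)]]$, where the substituted occurrences of $x$ in $A(x)$ are bound by the displayed $\sqcap^{c}x$. - Distribution: $X[(A\vee C)\wedge(B\vee C)]\leadsto X[(A\wedge B)\vee C]$; $X[(A\vee C)\sqcap^{c}(B\vee C)]\leadsto X[(A\sqcap^{c}B)\vee C]$; $X[\sqcap^{c}x(A\vee B)]\leadsto X[\sqcap^{c}x\,A\vee B]$, $x$ not free in $B$. - Trivialization: $X[\top]\leadsto X[\neg A\vee A]$, $A$ an atom. - Chotomy, with $c$ not occurring in the conclusion: $X[((A\wedge(C\sqcap^{b}D))\sqcap^{a}(B\wedge(C\sqcap^{b}D)))\sqcap^{c}(((A\sqcap^{a}B)\wedge C)\sqcap^{b}((A\sqcap^{a}B)\wedge D))]\leadsto X[(A\sqcap^{a}B)\wedge(C\sqcap^{b}D)]$; $X[\sqcap^{a}x(A\wedge\sqcap^{b}y\,B)\sqcap^{c}\sqcap^{b}y(\sqcap^{a}x\,A\wedge B)]\leadsto X[\sqcap^{a}x\,A\wedge\sqcap^{b}y\,B]$, $x$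 not free in $\sqcap^{b}y\,B$ and $y$ not free in $\sqcap^{a}x\,A$; $X[((A\wedge\sqcap^{b}x\,C)\sqcap^{a}(B\wedge\sqcap^{b}x\,C))\sqcap^{c}\sqcap^{b}x((A\sqcap^{a}B)\wedge C)]\leadsto X[(A\sqcap^{a}B)\wedge\sqcap^{b}x\,C]$, $x$ not free in $A\sqcap^{a}B$. - Splitting: $A,B\leadsto A\sqcap^{c}B$, where $c$ does not occur in $A,B$; $A(a)\leadsto\sqcap^{c}x\,A(x)$, where neither $c$ nor the constant $a$ occurs in $A(x)$. *Rank.* Literals (including $\top,\bot$) have rank $1$; $A\sqcup^{c}B$ and $A\sqcap^{c}B$ have rank $\mathrm{Rank}(A)+\mathrm{Rank}(B)$; $\sqcup^{c}x\,A$ and $\sqcap^{c}x\,A$ have rank $\mathrm{Rank}(A)+1$; with $k=\mathrm{Rank}(A)+\mathrm{Rank}(B)$, $A\wedge B$ has rank $5^{k}$ and $A\vee B$ has as its rank the tower of $5$s of height $k$. *Purification.* Each of the following stages is repeated until it no longer modifies $E$, before the next one starts; the final value of $E$ is the purification of the initial one. Stages 1–6 modify surface occurrences. 1. $\bot\vee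 A$ or $A\vee\bot$ becomes $A$; then $\bot\wedge A$ or $A\wedge\bot$ becomes $\bot$. 2. $(A\wedge B)\vee C$ or $C\vee(A\wedge B)$ becomes $(A\vee C)\wedge(B\vee C)$. 3. $(A\sqcap^{c}B)\vee C$ or $C\vee(A\sqcap^{c}B)$ becomes $(A\vee C)\sqcap^{c}(B\vee C)$; then $\sqcap^{c}x\,A\vee B$ or $B\vee\sqcap^{c}x\,A$ becomes $\sqcap^{c}x(A\vee B)$. 4. $A_1\vee\dots\vee A_n$ such that some atom and its negation are among the $A_i$ becomes $\top$. 5. $\top\vee A$ or $A\vee\top$ becomes $\top$; then $\top\wedge A$ or $A\wedge\top$ becomes $A$. 6. With $c$ a cluster not occurring in $E$: the conclusion of each of the three forms of Chotomy in turn (in the third, also with its two conjuncts exchanged) becomes the premise. 7. If $E=A'\sqcap^{c}C'$: a subcirquent $A\sqcap^{c}B$ of $A'$ becomes $A$; a subcirquent $A\sqcap^{c}B$ of $C'$ becomes $B$. 8. If $E=\sqcap^{c}x\,Y[\sqcap^{c}y\,A(y)]$, it becomes $\sqcap^{c}x\,Y[A(x)]$ (as in Cleansing). *DECISION* on input $E$: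 compute the purification $F$ of $E$. Let $a_1,\dots,a_s$ be the constants occurring in $F$ and $a_{s+1}$ a constant not occurring in $F$. For a cirquent $B=A_1\vee\dots\vee A_n$ ($n\ge1$, no $A_i$ a disjunction), let $\mathcal D(F,B)$ consist of the following cirquents: for each $A_i$ of the form $C_0\sqcup^{c}C_1$, the two results of replacing in $F$ all subcirquents $X_0\sqcup^{c}X_1$ by $X_0$, respectively by $X_1$; for each $A_i$ of the form $\sqcup^{c}x\,C(x)$, the $s+1$ results of replacing in $F$ all subcirquents $\sqcup^{c}y\,X(y)$ by $X(a_j)$, $1\le j\le s+1$. - If $F=\top$, accept. If $F$ is $\bot$, an atom or a negated atom, reject. - If $F=A\sqcap^{c}B$, call DECISION on $A$ and on $B$, and accept iff both calls accept. - If $F=\sqcap^{c}x\,A(x)$, call DECISION on $A(a)$ with $a$ a constant not occurring in $F$, and answer as this call does. - If $F$ is $\sqcup$-rooted (by a connective or a quantifier) or a disjunction, call DECISION on the elements of $\mathcal D(F,F)$, and accept iff some call accepts. - If $F=B_1\wedge\dots\wedge B_m$ ($m\ge2$, no $B_i$ a conjunction), pick a conjunct $B_e$ that is not of the form $A\sqcap^{c}B$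 or $\sqcap^{c}x\,A$, call DECISION on the elements of $\mathcal D(F,B_e)$, and accept iff some call accepts (so reject if there are none). Where this description leaves something open, DECISION makes a fixed choice: the first suitable occurrence or conjunct (from the outside in and from left to right), and the number following the largest one in use as a new cluster or constant. -/

import Mathlib

/-! ### Syntax

Variables are represented by de Bruijn indices: `Term.var i`, occurring under `d` quantifiers, is
bound by the `i`-th enclosing quantifier (counted from the inside) if `i < d`, and is the free
variable number `i - d` otherwise.  So the elements of `Cirquent` are exactly the cirquents up to
renaming of bound variables, and substitution never captures a variable. -/

inductive Term : Type
  | var (i : ℕ)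
  | const (a : ℕ)
  deriving DecidableEq

/-- Cirquents.  A predicate letter of arity `n` is a number `p` together with `n`, the length of
the argument list.  The four sets of clusters are four copies of `ℕ`, kept apart by the
constructors `chand`, `chor`, `chall`, `chex`, which are the choice conjunction, choice
disjunction, choice universal and choice existential quantifier. -/
inductive Cirquent : Type
  | top
  | bot
  | atom (p : ℕ) (ts : List Term)
  | natom (p : ℕ) (ts : List Term)
  | pand (A B : Cirquent)
  | por (A B : Cirquent)
  | chand (c : ℕ) (A B : Cirquent)
  | chor (c : ℕ) (A B : Cirquent)
  | chall (c : ℕ) (A : Cirquent)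
  | chex (c : ℕ) (A : Cirquent)
  deriving DecidableEq

namespace Term

/-- Renumbers the variables of a term when a new quantifier is put around it, outside the `k`
innermost ones. -/
def lift (k : ℕ) : Term → Term
  | var i => if i < k then var i else var (i + 1)
  | const a => const a

/-- Replaces variable `k` by `t` and removes the quantifier that bound it. -/
def subst (k : ℕ) (t : Term) : Term → Term
  | var i => if i < k then var i else if i = k then t else var (i - 1)
  | const a => const a

def ClosedAt (k : ℕ) : Term → Prop
  | var i => i < k
  | const _ => True

def consts : Term → List ℕ
  | var _ => []
  | const a => [a]

def equivSum : Term ≃ ℕ ⊕ ℕ where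
  toFun
    | var i => Sum.inl i
    | const a => Sum.inr a
  invFun
    | Sum.inl i => var i
    | Sum.inr a => const a
  left_inv t := by cases t <;> rfl
  right_inv s := by cases s <;> rfl

instance : Denumerable Term := Denumerable.ofEquiv (ℕ ⊕ ℕ) equivSum

end Term

namespace Cirquent

/-! ### Free variables, substitution, occurrences -/

def lift (k : ℕ) : Cirquent → Cirquent
  | top => top
  | bot => bot
  | atom p ts => atom p (ts.map (Term.lift k))
  | natom p ts => natom p (ts.map (Term.lift k))
  | pand A B => pand (lift k A) (lift k B)
  | por A B => por (lift k A) (lift k B)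
  | chand c A B => chand c (lift k A) (lift k B)
  | chor c A B => chor c (lift k A) (lift k B)
  | chall c A => chall c (lift (k + 1) A)
  | chex c A => chex c (lift (k + 1) A)

/-- `B` as it reads inside a new quantifier whose variable has no free occurrence in `B`. -/
def weaken (B : Cirquent) : Cirquent := lift 0 B

def subst (k : ℕ) (t : Term) : Cirquent → Cirquent
  | top => top
  | bot => bot
  | atom p ts => atom p (ts.map (Term.subst k t))
  | natom p ts => natom p (ts.map (Term.subst k t))
  | pand A B => pand (subst k t A) (subst k t B)
  | por A B => por (subst k t A) (subst k t B)
  | chand c A B => chand c (subst k t A) (subst k t B)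
  | chor c A B => chor c (subst k t A) (subst k t B)
  | chall c A => chall c (subst (k + 1) (t.lift 0) A)
  | chex c A => chex c (subst (k + 1) (t.lift 0) A)

/-- If `A` is the body `A(x)` of a quantified cirquent, `A.inst t` is `A(t)`. -/
def inst (A : Cirquent) (t : Term) : Cirquent := subst 0 t A

def ClosedAt : ℕ → Cirquent → Prop
  | _, top => True
  | _, bot => True
  | k, atom _ ts => ∀ t ∈ ts, t.ClosedAt k
  | k, natom _ ts => ∀ t ∈ ts, t.ClosedAt k
  | k, pand A B => ClosedAt k A ∧ ClosedAt k B
  | k, por A B => ClosedAt k A ∧ ClosedAt k B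
  | k, chand _ A B => ClosedAt k A ∧ ClosedAt k B
  | k, chor _ A B => ClosedAt k A ∧ ClosedAt k B
  | k, chall _ A => ClosedAt (k + 1) A
  | k, chex _ A => ClosedAt (k + 1) A

/-- A cirquent is closed if it has no free occurrences of variables. -/
def Closed (A : Cirquent) : Prop := ClosedAt 0 A

/-- The constants occurring in a cirquent (possibly with repetitions). -/
def consts : Cirquent → List ℕ
  | top => []
  | bot => []
  | atom _ ts => ts.flatMap Term.consts
  | natom _ ts => ts.flatMap Term.consts
  | pand A B => consts A ++ consts B
  | por A B => consts A ++ consts B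
  | chand _ A B => consts A ++ consts B
  | chor _ A B => consts A ++ consts B
  | chall _ A => consts A
  | chex _ A => consts A

/-- The clusters of the occurrences of the choice conjunction. -/
def chandClusters : Cirquent → List ℕ
  | top => []
  | bot => []
  | atom _ _ => []
  | natom _ _ => []
  | pand A B => chandClusters A ++ chandClusters B
  | por A B => chandClusters A ++ chandClusters B
  | chand c A B => c :: (chandClusters A ++ chandClusters B)
  | chor _ A B => chandClusters A ++ chandClusters B
  | chall _ A => chandClusters A
  | chex _ A => chandClusters A

/-- The clusters of the occurrences of the choice universal quantifier. -/
def challClusters : Cirquent → List ℕ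
  | top => []
  | bot => []
  | atom _ _ => []
  | natom _ _ => []
  | pand A B => challClusters A ++ challClusters B
  | por A B => challClusters A ++ challClusters B
  | chand _ A B => challClusters A ++ challClusters B
  | chor _ A B => challClusters A ++ challClusters B
  | chall c A => c :: challClusters A
  | chex _ A => challClusters A

/-- The result of replacing all subcirquents `X₀ ⊔^c X₁` by `X₀` (if `right` is `false`) or by
`X₁` (if `right` is `true`), nested ones included. -/
def chooseOr (c : ℕ) (right : Bool) : Cirquent → Cirquent
  | top => top
  | bot => bot
  | atom p ts => atom p ts
  | natom p ts => natom p ts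
  | pand A B => pand (chooseOr c right A) (chooseOr c right B)
  | por A B => por (chooseOr c right A) (chooseOr c right B)
  | chand d A B => chand d (chooseOr c right A) (chooseOr c right B)
  | chor d A B =>
      if d = c then (if right then chooseOr c right B else chooseOr c right A)
      else chor d (chooseOr c right A) (chooseOr c right B)
  | chall d A => chall d (chooseOr c right A)
  | chex d A => chex d (chooseOr c right A)

/-- The result of replacing all subcirquents `⊔^c y X(y)` by `X(a)`, nested ones included. -/
def chooseEx (c a : ℕ) : Cirquent → Cirquent
  | top => top
  | bot => bot
  | atom p ts => atom p ts
  | natom p ts => natom p ts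
  | pand A B => pand (chooseEx c a A) (chooseEx c a B)
  | por A B => por (chooseEx c a A) (chooseEx c a B)
  | chand d A B => chand d (chooseEx c a A) (chooseEx c a B)
  | chor d A B => chor d (chooseEx c a A) (chooseEx c a B)
  | chall d A => chall d (chooseEx c a A)
  | chex d A =>
      if d = c then (chooseEx c a A).inst (Term.const a) else chex d (chooseEx c a A)

/-! ### The calculus CL17 -/

/-- Cirquents with one hole in the place of a subcirquent. -/
inductive Ctx : Type
  | hole
  | pandL (X : Ctx) (B : Cirquent)
  | pandR (A : Cirquent) (X : Ctx)
  | porL (X : Ctx) (B : Cirquent)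
  | porR (A : Cirquent) (X : Ctx)
  | chandL (c : ℕ) (X : Ctx) (B : Cirquent)
  | chandR (c : ℕ) (A : Cirquent) (X : Ctx)
  | chorL (c : ℕ) (X : Ctx) (B : Cirquent)
  | chorR (c : ℕ) (A : Cirquent) (X : Ctx)
  | chall (c : ℕ) (X : Ctx)
  | chex (c : ℕ) (X : Ctx)

/-- `X.fill E` is `X[E]`. -/
def Ctx.fill : Ctx → Cirquent → Cirquent
  | .hole, E => E
  | .pandL X B, E => Cirquent.pand (X.fill E) B
  | .pandR A X, E => Cirquent.pand A (X.fill E)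
  | .porL X B, E => Cirquent.por (X.fill E) B
  | .porR A X, E => Cirquent.por A (X.fill E)
  | .chandL c X B, E => Cirquent.chand c (X.fill E) B
  | .chandR c A X, E => Cirquent.chand c A (X.fill E)
  | .chorL c X B, E => Cirquent.chor c (X.fill E) B
  | .chorR c A X, E => Cirquent.chor c A (X.fill E)
  | .chall c X, E => Cirquent.chall c (X.fill E)
  | .chex c X, E => Cirquent.chex c (X.fill E)

/-- The number of quantifiers in whose scope the hole is. -/
def Ctx.depth : Ctx → ℕ
  | .hole => 0
  | .pandL X _ => X.depth
  | .pandR _ X => X.depth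
  | .porL X _ => X.depth
  | .porR _ X => X.depth
  | .chandL _ X _ => X.depth
  | .chandR _ _ X => X.depth
  | .chorL _ X _ => X.depth
  | .chorR _ _ X => X.depth
  | .chall _ X => X.depth + 1
  | .chex _ X => X.depth + 1

/-- Provability in CL17. -/
inductive Provable : Cirquent → Prop
  | ax : Provable top
  | por_comm (X : Ctx) (A B : Cirquent) :
      Provable (X.fill (por B A)) → Provable (X.fill (por A B))
  | pand_comm (X : Ctx) (A B : Cirquent) :
      Provable (X.fill (pand B A)) → Provable (X.fill (pand A B))
  | por_assoc (X : Ctx) (A B C : Cirquent) :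
      Provable (X.fill (por A (por B C))) → Provable (X.fill (por (por A B) C))
  | pand_assoc (X : Ctx) (A B C : Cirquent) :
      Provable (X.fill (pand A (pand B C))) → Provable (X.fill (pand (pand A B) C))
  | por_identity (X : Ctx) (A : Cirquent) :
      Provable (X.fill A) → Provable (X.fill (por A bot))
  | pand_identity (X : Ctx) (A : Cirquent) :
      Provable (X.fill A) → Provable (X.fill (pand A top))
  | por_domination (X : Ctx) (A : Cirquent) :
      Provable (X.fill top) → Provable (X.fill (por A top))
  | pand_domination (X : Ctx) (A : Cirquent) :
      Provable (X.fill bot) → Provable (X.fill (pand A bot))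
  | left_chor_choosing (c : ℕ) (E : Cirquent) :
      Provable (chooseOr c false E) → Provable E
  | right_chor_choosing (c : ℕ) (E : Cirquent) :
      Provable (chooseOr c true E) → Provable E
  | chexists_choosing (c a : ℕ) (E : Cirquent) :
      Provable (chooseEx c a E) → Provable E
  | left_chand_cleansing (X Y : Ctx) (c : ℕ) (A B C : Cirquent) :
      Provable (X.fill (chand c (Y.fill A) C)) →
      Provable (X.fill (chand c (Y.fill (chand c A B)) C))
  | right_chand_cleansing (X Y : Ctx) (c : ℕ) (A B C : Cirquent) :
      Provable (X.fill (chand c C (Y.fill B))) →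
      Provable (X.fill (chand c C (Y.fill (chand c A B))))
  /-- The variable of the outer quantifier has index `Y.depth` at the place of the hole of `Y`. -/
  | chall_cleansing (X Y : Ctx) (c : ℕ) (A : Cirquent) :
      Provable (X.fill (chall c (Y.fill (A.inst (Term.var Y.depth))))) →
      Provable (X.fill (chall c (Y.fill (chall c A))))
  | pand_distribution (X : Ctx) (A B C : Cirquent) :
      Provable (X.fill (pand (por A C) (por B C))) → Provable (X.fill (por (pand A B) C))
  | chand_distribution (X : Ctx) (c : ℕ) (A B C : Cirquent) :
      Provable (X.fill (chand c (por A C) (por B C))) → Provable (X.fill (por (chand c A B) C))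
  | chall_distribution (X : Ctx) (c : ℕ) (A B : Cirquent) :
      Provable (X.fill (chall c (por A B.weaken))) → Provable (X.fill (por (chall c A) B))
  | trivialization (X : Ctx) (p : ℕ) (ts : List Term) :
      Provable (X.fill top) → Provable (X.fill (por (natom p ts) (atom p ts)))
  | chandchotomy (X : Ctx) (a b c : ℕ) (A B C D : Cirquent) :
      c ∉ (X.fill (pand (chand a A B) (chand b C D))).chandClusters →
      Provable (X.fill (chand c
        (chand a (pand A (chand b C D)) (pand B (chand b C D)))
        (chand b (pand (chand a A B) C) (pand (chand a A B) D)))) →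
      Provable (X.fill (pand (chand a A B) (chand b C D)))
  | challchotomy (X : Ctx) (a b c : ℕ) (A B : Cirquent) :
      c ∉ (X.fill (pand (chall a A) (chall b B))).chandClusters →
      Provable (X.fill (chand c
        (chall a (pand A (chall b B).weaken))
        (chall b (pand (chall a A).weaken B)))) →
      Provable (X.fill (pand (chall a A) (chall b B)))
  | chandallchotomy (X : Ctx) (a b c : ℕ) (A B C : Cirquent) :
      c ∉ (X.fill (pand (chand a A B) (chall b C))).chandClusters →
      Provable (X.fill (chand c
        (chand a (pand A (chall b C)) (pand B (chall b C)))
        (chall b (pand (chand a A B).weaken C)))) →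
      Provable (X.fill (pand (chand a A B) (chall b C)))
  | chand_splitting (c : ℕ) (A B : Cirquent) :
      c ∉ A.chandClusters → c ∉ B.chandClusters →
      Provable A → Provable B → Provable (chand c A B)
  | chall_splitting (c a : ℕ) (A : Cirquent) :
      c ∉ A.challClusters → a ∉ A.consts →
      Provable (A.inst (Term.const a)) → Provable (chall c A)

/-! ### Rank -/

/-- `tower n` is the tower of `5`s of height `n`. -/
def tower : ℕ → ℕ
  | 0 => 1
  | n + 1 => 5 ^ tower n

def rank : Cirquent → ℕ
  | top => 1
  | bot => 1
  | atom _ _ => 1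
  | natom _ _ => 1
  | pand A B => 5 ^ (rank A + rank B)
  | por A B => tower (rank A + rank B)
  | chand _ A B => rank A + rank B
  | chor _ A B => rank A + rank B
  | chall _ A => rank A + 1
  | chex _ A => rank A + 1

/-! ### Purification -/

/-- Applies `r` to the first surface occurrence (one not in the scope of a choice operator) of a
subcirquent to which `r` applies; `none` if there is none. -/
def onSurface (r : Cirquent → Option Cirquent) : Cirquent → Option Cirquent
  | pand A B =>
      r (pand A B) <|> (onSurface r A).map (fun A' => pand A' B) <|>
        (onSurface r B).map (fun B' => pand A B')
  | por A B =>
      r (por A B) <|> (onSurface r A).map (fun A' => por A' B) <|>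
        (onSurface r B).map (fun B' => por A B')
  | E => r E

/-- Applies `r` to the first occurrence (anywhere) of a subcirquent to which `r` applies; `none` if
there is none.  The first argument of `r` is `d` plus the number of quantifiers in whose scope the
occurrence is. -/
def anywhere (r : ℕ → Cirquent → Option Cirquent) : ℕ → Cirquent → Option Cirquent
  | d, top => r d top
  | d, bot => r d bot
  | d, atom p ts => r d (atom p ts)
  | d, natom p ts => r d (natom p ts)
  | d, pand A B =>
      r d (pand A B) <|> (anywhere r d A).map (fun A' => pand A' B) <|>
        (anywhere r d B).map (fun B' => pand A B')
  | d, por A B =>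
      r d (por A B) <|> (anywhere r d A).map (fun A' => por A' B) <|>
        (anywhere r d B).map (fun B' => por A B')
  | d, chand c A B =>
      r d (chand c A B) <|> (anywhere r d A).map (fun A' => chand c A' B) <|>
        (anywhere r d B).map (fun B' => chand c A B')
  | d, chor c A B =>
      r d (chor c A B) <|> (anywhere r d A).map (fun A' => chor c A' B) <|>
        (anywhere r d B).map (fun B' => chor c A B')
  | d, chall c A => r d (chall c A) <|> (anywhere r (d + 1) A).map (fun A' => chall c A')
  | d, chex c A => r d (chex c A) <|> (anywhere r (d + 1) A).map (fun A' => chex c A')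

/-- "If `E` has a surface occurrence of the form treated by `r`, change it." -/
def modify (r : Cirquent → Option Cirquent) (E : Cirquent) : Cirquent := (onSurface r E).getD E

def orBot : Cirquent → Option Cirquent
  | por bot A => some A
  | por A bot => some A
  | _ => none

def andBot : Cirquent → Option Cirquent
  | pand bot _ => some bot
  | pand _ bot => some bot
  | _ => none

def stage1 (E : Cirquent) : Cirquent := modify andBot (modify orBot E)

def orAnd : Cirquent → Option Cirquent
  | por (pand A B) C => some (pand (por A C) (por B C))
  | por C (pand A B) => some (pand (por A C) (por B C))
  | _ => none

def stage2 (E : Cirquent) : Cirquent := modify orAnd E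

def orChand : Cirquent → Option Cirquent
  | por (chand c A B) C => some (chand c (por A C) (por B C))
  | por C (chand c A B) => some (chand c (por A C) (por B C))
  | _ => none

def orChall : Cirquent → Option Cirquent
  | por (chall c A) B => some (chall c (por A B.weaken))
  | por B (chall c A) => some (chall c (por A B.weaken))
  | _ => none

def stage3 (E : Cirquent) : Cirquent := modify orChall (modify orChand E)

/-- The `A₁, …, Aₙ` of `A₁ ∨ ⋯ ∨ Aₙ`, where no `Aᵢ` is a disjunction. -/
def disjuncts : Cirquent → List Cirquent
  | por A B => disjuncts A ++ disjuncts B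
  | E => [E]

/-- The `A₁, …, Aₙ` of `A₁ ∧ ⋯ ∧ Aₙ`, where no `Aᵢ` is a conjunction. -/
def conjuncts : Cirquent → List Cirquent
  | pand A B => conjuncts A ++ conjuncts B
  | E => [E]

/-- `E` is an atom whose negation is in `l`. -/
def isOpposed (l : List Cirquent) : Cirquent → Bool
  | atom p ts => decide (natom p ts ∈ l)
  | _ => false

def orTrivial : Cirquent → Option Cirquent
  | por A B =>
      if (disjuncts (por A B)).any (isOpposed (disjuncts (por A B))) then some top else none
  | _ => none

def stage4 (E : Cirquent) : Cirquent := modify orTrivial E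

def orTop : Cirquent → Option Cirquent
  | por top _ => some top
  | por _ top => some top
  | _ => none

def andTop : Cirquent → Option Cirquent
  | pand top A => some A
  | pand A top => some A
  | _ => none

def stage5 (E : Cirquent) : Cirquent := modify andTop (modify orTop E)

def freshOf (l : List ℕ) : ℕ := l.foldr max 0 + 1

/-- A choice conjunction cluster that does not occur in `E`. -/
def freshCluster (E : Cirquent) : ℕ := freshOf E.chandClusters

/-- A constant that does not occur in `E`. -/
def freshConst (E : Cirquent) : ℕ := freshOf E.consts

def andChandChand (c : ℕ) : Cirquent → Option Cirquent
  | pand (chand a A B) (chand b C D) => some (chand c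
      (chand a (pand A (chand b C D)) (pand B (chand b C D)))
      (chand b (pand (chand a A B) C) (pand (chand a A B) D)))
  | _ => none

def andChallChall (c : ℕ) : Cirquent → Option Cirquent
  | pand (chall a A) (chall b B) => some (chand c
      (chall a (pand A (chall b B).weaken))
      (chall b (pand (chall a A).weaken B)))
  | _ => none

def andChandChall (c : ℕ) : Cirquent → Option Cirquent
  | pand (chand a A B) (chall b C) => some (chand c
      (chand a (pand A (chall b C)) (pand B (chall b C)))
      (chall b (pand (chand a A B).weaken C)))
  | pand (chall b C) (chand a A B) => some (chand c
      (chand a (pand A (chall b C)) (pand B (chall b C)))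
      (chall b (pand (chand a A B).weaken C)))
  | _ => none

def stage6a (E : Cirquent) : Cirquent := modify (andChandChand (freshCluster E)) E
def stage6b (E : Cirquent) : Cirquent := modify (andChallChall (freshCluster E)) E
def stage6c (E : Cirquent) : Cirquent := modify (andChandChall (freshCluster E)) E
def stage6 (E : Cirquent) : Cirquent := stage6c (stage6b (stage6a E))

def pickLeft (c _d : ℕ) : Cirquent → Option Cirquent
  | chand c' A _ => if c' = c then some A else none
  | _ => none

def pickRight (c _d : ℕ) : Cirquent → Option Cirquent
  | chand c' _ B => if c' = c then some B else none
  | _ => none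

def stage7 : Cirquent → Cirquent
  | chand c A B => chand c ((anywhere (pickLeft c) 0 A).getD A) ((anywhere (pickRight c) 0 B).getD B)
  | E => E

/-- Inside `d` quantifiers in the scope of an outer quantifier, the variable of the latter has
index `d`. -/
def identify (c d : ℕ) : Cirquent → Option Cirquent
  | chall c' A => if c' = c then some (A.inst (Term.var d)) else none
  | _ => none

def stage8 : Cirquent → Cirquent
  | chall c A => chall c ((anywhere (identify c) 0 A).getD A)
  | E => E

/-- Iterates `stage` until it no longer modifies `E`; `none` if `n` rounds do not suffice. -/
def loop (stage : Cirquent → Cirquent) : ℕ → Cirquent → Option Cirquent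
  | 0, _ => none
  | n + 1, E => if stage E = E then some E else loop stage n (stage E)

/-- The procedure Purification; `none` if one of its loops needs more than `n` rounds. -/
def purify (n : ℕ) (E : Cirquent) : Option Cirquent := do
  let E₁ ← loop stage1 n E
  let E₂ ← loop stage2 n E₁
  let E₃ ← loop stage3 n E₂
  let E₄ ← loop stage4 n E₃
  let E₅ ← loop stage5 n E₄
  let E₆ ← loop stage6 n E₅
  let E₇ ← loop stage7 n E₆
  loop stage8 n E₇

/-! ### The algorithm DECISION -/

/-- The ways to choose in the disjuncts of `B`, applied to the whole of `F`: both sides for a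
choice disjunction; all constants of `F` and one fresh constant for a choice existential
quantifier. -/
def choices (F B : Cirquent) : List Cirquent :=
  B.disjuncts.flatMap fun A =>
    match A with
    | chor c _ _ => [chooseOr c false F, chooseOr c true F]
    | chex c _ => (F.consts ++ [freshConst F]).map fun a => chooseEx c a F
    | _ => []

/-- Neither a choice conjunction nor a choice universal quantification. -/
def notChandChallRooted : Cirquent → Bool
  | chand _ _ _ => false
  | chall _ _ => false
  | _ => true

/-- The cirquents on which DECISION calls itself when the purification of its input is `F`. -/
def calls : Cirquent → List Cirquent
  | chand _ A B => [A, B]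
  | chall c A => [A.inst (Term.const (freshConst (chall c A)))]
  | pand A B =>
      match (conjuncts (pand A B)).find? notChandChallRooted with
      | some C => choices (pand A B) C
      | none => []
  | F => choices F F

/-- Accepts or rejects, given the results of the recursive calls: `⊤`, `⊓` and the universal
quantifier require all calls to accept (for `⊤` there are none), any other form at least one. -/
def combine : Cirquent → List Bool → Bool
  | top, l => l.all id
  | chand _ _ _, l => l.all id
  | chall _ _, l => l.all id
  | _, l => l.any id

/-- DECISION with recursion depth and purification loops bounded by `n`; `none` if the bound is
exceeded. -/
def run : ℕ → Cirquent → Option Bool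
  | 0, _ => none
  | n + 1, E => do
      let F ← purify n E
      let l ← (calls F).mapM (run n)
      return combine F l

/-- The algorithm DECISION: undefined if it does not halt; `true` means that it accepts, `false`
that it rejects. -/
def decision (E : Cirquent) : Part Bool := Nat.rfindOpt fun n => run n E

/-! ### Gödel numbering -/

def toNat : Cirquent → ℕ
  | top => 0
  | bot => 1
  | atom p ts => 8 * Nat.pair p (Encodable.encode ts) + 2
  | natom p ts => 8 * Nat.pair p (Encodable.encode ts) + 3
  | pand A B => 8 * Nat.pair (toNat A) (toNat B) + 4
  | por A B => 8 * Nat.pair (toNat A) (toNat B) + 5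
  | chand c A B => 8 * Nat.pair c (Nat.pair (toNat A) (toNat B)) + 6
  | chor c A B => 8 * Nat.pair c (Nat.pair (toNat A) (toNat B)) + 7
  | chall c A => 8 * Nat.pair c (toNat A) + 8
  | chex c A => 8 * Nat.pair c (toNat A) + 9

def ofNat : ℕ → Cirquent
  | 0 => top
  | 1 => bot
  | n + 2 =>
    have h1 : (n / 8).unpair.1 < n + 2 := by
      have := Nat.unpair_left_le (n / 8)
      omega
    have h2 : (n / 8).unpair.2 < n + 2 := by
      have := Nat.unpair_right_le (n / 8)
      omega
    have h3 : (n / 8).unpair.2.unpair.1 < n + 2 := by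
      have := Nat.unpair_left_le (n / 8).unpair.2
      omega
    have h4 : (n / 8).unpair.2.unpair.2 < n + 2 := by
      have := Nat.unpair_right_le (n / 8).unpair.2
      omega
    match n % 8 with
    | 0 => atom (n / 8).unpair.1 (Denumerable.ofNat (List Term) (n / 8).unpair.2)
    | 1 => natom (n / 8).unpair.1 (Denumerable.ofNat (List Term) (n / 8).unpair.2)
    | 2 => pand (ofNat (n / 8).unpair.1) (ofNat (n / 8).unpair.2)
    | 3 => por (ofNat (n / 8).unpair.1) (ofNat (n / 8).unpair.2)
    | 4 => chand (n / 8).unpair.1 (ofNat (n / 8).unpair.2.unpair.1) (ofNat (n / 8).unpair.2.unpair.2)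
    | 5 => chor (n / 8).unpair.1 (ofNat (n / 8).unpair.2.unpair.1) (ofNat (n / 8).unpair.2.unpair.2)
    | 6 => chall (n / 8).unpair.1 (ofNat (n / 8).unpair.2)
    | _ => chex (n / 8).unpair.1 (ofNat (n / 8).unpair.2)
  termination_by n => n
  decreasing_by all_goals assumption

theorem ofNat_toNat (E : Cirquent) : ofNat (toNat E) = E := by
  induction E with
  | top => simp [toNat, ofNat]
  | bot => simp [toNat, ofNat]
  | atom p ts =>
    have h2 : (8 * Nat.pair p (Encodable.encode ts)) / 8 = Nat.pair p (Encodable.encode ts) := by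
      omega
    rw [toNat, ofNat]
    simp [h2]
  | natom p ts =>
    have h1 : (8 * Nat.pair p (Encodable.encode ts) + 1) % 8 = 1 := by omega
    have h2 : (8 * Nat.pair p (Encodable.encode ts) + 1) / 8 = Nat.pair p (Encodable.encode ts) := by
      omega
    rw [toNat, ofNat]
    simp [h1, h2]
  | pand A B ihA ihB =>
    have h1 : (8 * Nat.pair (toNat A) (toNat B) + 2) % 8 = 2 := by omega
    have h2 : (8 * Nat.pair (toNat A) (toNat B) + 2) / 8 = Nat.pair (toNat A) (toNat B) := by omega
    rw [toNat, ofNat]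
    simp [h1, h2, ihA, ihB]
  | por A B ihA ihB =>
    have h1 : (8 * Nat.pair (toNat A) (toNat B) + 3) % 8 = 3 := by omega
    have h2 : (8 * Nat.pair (toNat A) (toNat B) + 3) / 8 = Nat.pair (toNat A) (toNat B) := by omega
    rw [toNat, ofNat]
    simp [h1, h2, ihA, ihB]
  | chand c A B ihA ihB =>
    have h1 : (8 * Nat.pair c (Nat.pair (toNat A) (toNat B)) + 4) % 8 = 4 := by omega
    have h2 : (8 * Nat.pair c (Nat.pair (toNat A) (toNat B)) + 4) / 8 =
      Nat.pair c (Nat.pair (toNat A) (toNat B)) := by omega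
    rw [toNat, ofNat]
    simp [h1, h2, ihA, ihB]
  | chor c A B ihA ihB =>
    have h1 : (8 * Nat.pair c (Nat.pair (toNat A) (toNat B)) + 5) % 8 = 5 := by omega
    have h2 : (8 * Nat.pair c (Nat.pair (toNat A) (toNat B)) + 5) / 8 =
      Nat.pair c (Nat.pair (toNat A) (toNat B)) := by omega
    rw [toNat, ofNat]
    simp [h1, h2, ihA, ihB]
  | chall c A ih =>
    have h1 : (8 * Nat.pair c (toNat A) + 6) % 8 = 6 := by omega
    have h2 : (8 * Nat.pair c (toNat A) + 6) / 8 = Nat.pair c (toNat A) := by omega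
    rw [toNat, ofNat]
    simp [h1, h2, ih]
  | chex c A ih =>
    have h1 : (8 * Nat.pair c (toNat A) + 7) % 8 = 7 := by omega
    have h2 : (8 * Nat.pair c (toNat A) + 7) / 8 = Nat.pair c (toNat A) := by omega
    rw [toNat, ofNat]
    simp [h1, h2, ih]

theorem toNat_ofNat (n : ℕ) : toNat (ofNat n) = n := by
  induction n using Nat.strong_induction_on with
  | _ n ih =>
    match n, ih with
    | 0, _ => simp [ofNat, toNat]
    | 1, _ => simp [ofNat, toNat]
    | n + 2, ih =>
      have a1 := ih (n / 8).unpair.1 (by have := Nat.unpair_left_le (n / 8); omega)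
      have a2 := ih (n / 8).unpair.2 (by have := Nat.unpair_right_le (n / 8); omega)
      have a3 := ih (n / 8).unpair.2.unpair.1 (by
        have := Nat.unpair_left_le (n / 8).unpair.2
        have := Nat.unpair_right_le (n / 8)
        omega)
      have a4 := ih (n / 8).unpair.2.unpair.2 (by
        have := Nat.unpair_right_le (n / 8).unpair.2
        have := Nat.unpair_right_le (n / 8)
        omega)
      have hlt : n % 8 < 8 := Nat.mod_lt _ (by norm_num)
      have hdiv := Nat.div_add_mod n 8
      rw [ofNat]
      generalize n % 8 = r at *
      interval_cases r <;> simp [toNat, a1, a2, a3, a4] <;> omega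

def equivNat : Cirquent ≃ ℕ := ⟨toNat, ofNat, ofNat_toNat, toNat_ofNat⟩

instance : Denumerable Cirquent := Denumerable.mk' equivNat

end Cirquent

/-!
The proof goes through a game semantics. A cirquent is a game between a machine, which owns the
clusters of `⊔` and `∃`, and its environment, which owns those of `⊓` and `∀`; a move resolves a
whole cluster, by a side or by a constant (`Holds` says who wins a play). `Wins` says that the
machine has a winning strategy that does not depend on the interpretation of the predicate letters,
and a cirquent is `Valid` if the machine wins from the initial position.

Everything provable is valid (`Provable.valid`). For most rules, every play in which the machine
wins the premise is one in which it wins the conclusion. For Chotomy the machine imagines that the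
environment resolves the additional cluster when it first resolves one of the two clusters in
question (`Valid.of_chotomy`), and for the splitting of a choice universal quantifier a strategy for
a fresh constant is transferred to all other constants by renaming (`Wins.rename`).

Conversely, each modification made by Purification leads from a conclusion of rules to a premise,
keeps valid cirquents valid, and lowers the rank (`Reduces`). So the loops terminate, and the
purified cirquent has the normal form `IsPure` (`isPure_of_purify`): a disjunction, and some
conjunct of a conjunction, consists of literals without opposite pairs and of `⊔`- or `∃`-rooted
cirquents. As all its literals are false under a suitable interpretation, a winning machine has to
choose in one of the other disjuncts; that choice is one of those that DECISION tries, up to an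
exchange of unused constants, and it leaves a valid cirquent (`exists_valid_call`). By induction on
the recursion depth, acceptance thus implies provability, and validity implies acceptance
(`run_spec`); the rank bounds the depth (`exists_run_eq_some`).

Finally, structural recursion on cirquents preserves primitive recursiveness (`primrec_rec`), and so
`run`, the algorithm with a bound on its depth and its loops, is primitive recursive
(`primrec_run`).
-/

/-! ### Plays and their outcome -/

/-- The value of a term when `ρ i` is the value of the free variable number `i`; a constant is its
own value. -/
def Term.value (ρ : ℕ → ℕ) : Term → ℕ
  | var i => ρ i
  | const a => a

namespace Cirquent

/-- The choices that one of the two players has made so far.  The clusters of the choice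
connective of that player are the keys `Sum.inl c`, where a choice of `0` means the left component
and any other number the right one; the clusters of the choice quantifier are the keys `Sum.inr c`,
where the choice is a constant. -/
abbrev Moves := ℕ ⊕ ℕ → Option ℕ

/-- The valuation under a new quantifier whose variable has the value `a`. -/
def push (a : ℕ) (ρ : ℕ → ℕ) : ℕ → ℕ
  | 0 => a
  | i + 1 => ρ i

/-- The machine wins the play of a cirquent in which the environment has made the choices `e` and
the machine the choices `m`, under the interpretation `I` of the predicate letters.  The
environment owns the clusters of `⊓` and `∀`, the machine those of `⊔` and `∃`; a choice operator
whose cluster has not been resolved is lost by its owner. -/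
def Holds (I : ℕ → List ℕ → Prop) (e m : Moves) : Cirquent → (ℕ → ℕ) → Prop
  | top, _ => True
  | bot, _ => False
  | atom p ts, ρ => I p (ts.map (Term.value ρ))
  | natom p ts, ρ => ¬ I p (ts.map (Term.value ρ))
  | pand A B, ρ => Holds I e m A ρ ∧ Holds I e m B ρ
  | por A B, ρ => Holds I e m A ρ ∨ Holds I e m B ρ
  | chand c A B, ρ => (e (Sum.inl c) = some 0 → Holds I e m A ρ) ∧
      ∀ v, e (Sum.inl c) = some (v + 1) → Holds I e m B ρ
  | chor c A B, ρ => (m (Sum.inl c) = some 0 ∧ Holds I e m A ρ) ∨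
      ∃ v, m (Sum.inl c) = some (v + 1) ∧ Holds I e m B ρ
  | chall c A, ρ => ∀ a, e (Sum.inr c) = some a → Holds I e m A (push a ρ)
  | chex c A, ρ => ∃ a, m (Sum.inr c) = some a ∧ Holds I e m A (push a ρ)

theorem holds_lift {I : ℕ → List ℕ → Prop} {e m : Moves} (A : Cirquent) (k : ℕ) (ρ : ℕ → ℕ) :
    Holds I e m (lift k A) ρ ↔ Holds I e m A (fun i => if i < k then ρ i else ρ (i + 1)) := by
  have hts : ∀ (ts : List Term) (k : ℕ) (ρ : ℕ → ℕ), (ts.map (Term.lift k)).map (Term.value ρ) =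
      ts.map (Term.value (fun i => if i < k then ρ i else ρ (i + 1))) := by
    intro ts k ρ
    rw [List.map_map]
    refine List.map_congr_left fun t _ => ?_
    cases t <;> simp only [Function.comp, Term.lift, Term.value]
    split_ifs <;> rfl
  have hp : ∀ (k a : ℕ) (ρ : ℕ → ℕ),
      (fun i => if i < k + 1 then push a ρ i else push a ρ (i + 1)) =
        push a (fun i => if i < k then ρ i else ρ (i + 1)) := by
    intro k a ρ
    funext i
    cases i <;> simp [push]
  induction A generalizing k ρ with
  | top | bot => rfl
  | atom p ts | natom p ts => simp only [lift, Holds, hts]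
  | pand A B ihA ihB | por A B ihA ihB => simp only [lift, Holds, ihA, ihB]
  | chand c A B ihA ihB | chor c A B ihA ihB => simp only [lift, Holds, ihA, ihB]
  | chall c A ih | chex c A ih => simp only [lift, Holds, ih, hp]

theorem holds_weaken {I : ℕ → List ℕ → Prop} {e m : Moves} (B : Cirquent) (a : ℕ) (ρ : ℕ → ℕ) :
    Holds I e m B.weaken (push a ρ) ↔ Holds I e m B ρ := by
  rw [weaken, holds_lift]
  rfl

theorem value_lift_push (t : Term) (a : ℕ) (ρ : ℕ → ℕ) :
    (t.lift 0).value (push a ρ) = t.value ρ := by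
  cases t <;> simp [Term.lift, Term.value, push]

theorem holds_subst {I : ℕ → List ℕ → Prop} {e m : Moves} (A : Cirquent) (k : ℕ) (t : Term)
    (ρ : ℕ → ℕ) : Holds I e m (subst k t A) ρ ↔
      Holds I e m A (fun i => if i < k then ρ i else if i = k then t.value ρ else ρ (i - 1)) := by
  have hts : ∀ (ts : List Term) (k : ℕ) (t : Term) (ρ : ℕ → ℕ),
      (ts.map (Term.subst k t)).map (Term.value ρ) = ts.map (Term.value
        (fun i => if i < k then ρ i else if i = k then t.value ρ else ρ (i - 1))) := by
    intro ts k t ρ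
    rw [List.map_map]
    refine List.map_congr_left fun s _ => ?_
    cases s <;> simp only [Function.comp, Term.subst, Term.value]
    split_ifs <;> rfl
  have hp : ∀ (k : ℕ) (t : Term) (a : ℕ) (ρ : ℕ → ℕ),
      (fun i => if i < k + 1 then push a ρ i else if i = k + 1 then (t.lift 0).value (push a ρ)
        else push a ρ (i - 1)) =
        push a (fun i => if i < k then ρ i else if i = k then t.value ρ else ρ (i - 1)) := by
    intro k t a ρ
    funext i
    rcases i with _ | i
    · simp [push]
    · simp only [Nat.add_lt_add_iff_right, Nat.add_right_cancel_iff, value_lift_push, push,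
        Nat.add_sub_cancel]
      rcases i with _ | i
      · split_ifs <;> first | rfl | omega
      · simp
  induction A generalizing k t ρ with
  | top | bot => rfl
  | atom p ts | natom p ts => simp only [subst, Holds, hts]
  | pand A B ihA ihB | por A B ihA ihB => simp only [subst, Holds, ihA, ihB]
  | chand c A B ihA ihB | chor c A B ihA ihB => simp only [subst, Holds, ihA, ihB]
  | chall c A ih | chex c A ih => simp only [subst, Holds, ih, hp]

theorem holds_inst {I : ℕ → List ℕ → Prop} {e m : Moves} (A : Cirquent) (t : Term) (ρ : ℕ → ℕ) :
    Holds I e m (A.inst t) ρ ↔ Holds I e m A (push (t.value ρ) ρ) := by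
  rw [inst, holds_subst]
  have : (fun i => if i < 0 then ρ i else if i = 0 then t.value ρ else ρ (i - 1)) =
      push (t.value ρ) ρ := by
    funext i
    cases i <;> simp [push]
  rw [this]

/-! ### Winning strategies -/

/-- `m'` contains all the choices of `m`. -/
def Extends (m' m : Moves) : Prop := ∀ k v, m k = some v → m' k = some v

theorem Extends.refl (m : Moves) : Extends m m := fun _ _ h => h

theorem Extends.trans {m₁ m₂ m₃ : Moves} (h : Extends m₁ m₂) (h' : Extends m₂ m₃) :
    Extends m₁ m₃ := fun k v hv => h k v (h' k v hv)

/-- The machine wins `E` (with the values `ρ` of the free variables) from the position `(e, m)`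
by a strategy that does not depend on the interpretation of the predicate letters.  Positions in
which the machine is safe form an invariant `P`: in each of them the machine can make some further
choices, after which it wins if no more choices follow, and after which every single choice of the
environment leads to such a position again.  This is the greatest such invariant, so nothing needs
to be said about the length of plays. -/
def Wins (E : Cirquent) (ρ : ℕ → ℕ) (e m : Moves) : Prop :=
  ∃ P : Moves → Moves → Prop, P e m ∧ ∀ e m, P e m → ∃ m', Extends m' m ∧
    (∀ I, Holds I e m' E ρ) ∧ ∀ k v, e k = none → P (Function.update e k (some v)) m'

/-- The position in which no choice has been made. -/
def noMoves : Moves := fun _ => none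

/-- `E` is valid if the machine wins it from the initial position. -/
def Valid (E : Cirquent) : Prop := ∀ ρ, Wins E ρ noMoves noMoves

theorem Wins.of_extends {E : Cirquent} {ρ : ℕ → ℕ} {e m m' : Moves} (h : Wins E ρ e m')
    (hm : Extends m' m) : Wins E ρ e m := by
  obtain ⟨P, hP, hs⟩ := h
  refine ⟨fun e m => ∃ m', Extends m' m ∧ P e m', ⟨m', hm, hP⟩, ?_⟩
  rintro e m ⟨m', hm, hP⟩
  obtain ⟨m'', h1, h2, h3⟩ := hs e m' hP
  exact ⟨m'', h1.trans hm, h2, fun k v hk => ⟨m'', Extends.refl _, h3 k v hk⟩⟩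

theorem Wins.step {E : Cirquent} {ρ : ℕ → ℕ} {e m : Moves} (h : Wins E ρ e m) :
    ∃ m', Extends m' m ∧ (∀ I, Holds I e m' E ρ) ∧ Wins E ρ e m' ∧
      ∀ k v, e k = none → Wins E ρ (Function.update e k (some v)) m' := by
  obtain ⟨P, hP, hs⟩ := h
  obtain ⟨m', h1, h2, h3⟩ := hs e m hP
  refine ⟨m', h1, h2, ⟨fun e₁ m₁ => P e₁ m₁ ∨ e₁ = e ∧ m₁ = m', Or.inr ⟨rfl, rfl⟩, ?_⟩,
    fun k v hk => ⟨P, h3 k v hk, hs⟩⟩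
  rintro e₁ m₁ (h | ⟨rfl, rfl⟩)
  · obtain ⟨m'', h1, h2, h3⟩ := hs _ _ h
    exact ⟨m'', h1, h2, fun k v hk => Or.inl (h3 k v hk)⟩
  · exact ⟨m₁, Extends.refl _, h2, fun k v hk => Or.inl (h3 k v hk)⟩

/-- The environment may move first: the machine can postpone its own choices. -/
theorem Wins.env {E : Cirquent} {ρ : ℕ → ℕ} {e m : Moves} (h : Wins E ρ e m) {k : ℕ ⊕ ℕ}
    (hk : e k = none) (v : ℕ) : Wins E ρ (Function.update e k (some v)) m := by
  obtain ⟨m', h1, _, _, h4⟩ := h.step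
  exact (h4 k v hk).of_extends h1

theorem Wins.mono {E E' : Cirquent} {ρ ρ' : ℕ → ℕ}
    (hE : ∀ I e m, Holds I e m E ρ → Holds I e m E' ρ') {e m : Moves} (h : Wins E ρ e m) :
    Wins E' ρ' e m := by
  obtain ⟨P, hP, hs⟩ := h
  refine ⟨P, hP, fun e m he => ?_⟩
  obtain ⟨m', h1, h2, h3⟩ := hs e m he
  exact ⟨m', h1, fun I => hE I e m' (h2 I), h3⟩

theorem Valid.mono {E E' : Cirquent}
    (hE : ∀ I e m ρ, Holds I e m E ρ → Holds I e m E' ρ) (h : Valid E) : Valid E' :=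
  fun ρ => (h ρ).mono fun I e m => hE I e m ρ

theorem holds_chooseOr {I : ℕ → List ℕ → Prop} {e m : Moves} {c v : ℕ}
    (E : Cirquent) (ρ : ℕ → ℕ) :
    Holds I e m (chooseOr c (decide (v ≠ 0)) E) ρ ↔
      Holds I e (Function.update m (Sum.inl c) (some v)) E ρ := by
  induction E generalizing ρ with
  | top | bot | atom p ts | natom p ts => rfl
  | pand A B ihA ihB | por A B ihA ihB | chand d A B ihA ihB =>
    simp only [chooseOr, Holds, ihA, ihB]
  | chor d A B ihA ihB =>
    by_cases hd : d = c
    · subst hd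
      rcases v with _ | v <;> simp [chooseOr, Holds] <;> first | exact ihA ρ | exact ihB ρ
    · have hne : (Sum.inl d : ℕ ⊕ ℕ) ≠ Sum.inl c := fun h => hd (Sum.inl.inj h)
      simp only [chooseOr, hd, if_false, Holds, Function.update_of_ne hne, ihA, ihB]
  | chall d A ih => simp only [chooseOr, Holds, ih]
  | chex d A ih =>
    simp only [chooseOr, Holds, ih, Function.update_of_ne (Sum.inr_ne_inl (a := c) (b := d))]

theorem holds_chooseEx {I : ℕ → List ℕ → Prop} {e m : Moves} {c a : ℕ}
    (E : Cirquent) (ρ : ℕ → ℕ) :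
    Holds I e m (chooseEx c a E) ρ ↔
      Holds I e (Function.update m (Sum.inr c) (some a)) E ρ := by
  induction E generalizing ρ with
  | top | bot | atom p ts | natom p ts => rfl
  | pand A B ihA ihB | por A B ihA ihB | chand d A B ihA ihB =>
    simp only [chooseEx, Holds, ihA, ihB]
  | chor d A B ihA ihB => simp [chooseEx, Holds, ihA, ihB]
  | chall d A ih => simp only [chooseEx, Holds, ih]
  | chex d A ih =>
    by_cases hd : d = c
    · subst hd
      simp [chooseEx, Holds, holds_inst, ih, Term.value]
    · simp [chooseEx, Holds, ih, hd]

/-- If making one choice at the beginning turns `E` into `E'`, a strategy for `E'` gives one for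
`E`. -/
theorem Wins.of_choose {E E' : Cirquent} {k : ℕ ⊕ ℕ} {v : ℕ} {ρ : ℕ → ℕ}
    (hE : ∀ I e m, Holds I e m E' ρ ↔ Holds I e (Function.update m k (some v)) E ρ)
    {e m : Moves} (hm : m k = none) (h : Wins E' ρ e m) : Wins E ρ e m := by
  obtain ⟨P, hP, hs⟩ := h
  refine Wins.of_extends (m' := Function.update m k (some v))
    ⟨fun e m => ∃ m', P e m' ∧ m = Function.update m' k (some v), ⟨m, hP, rfl⟩, ?_⟩ ?_
  · rintro e _ ⟨m, hP, rfl⟩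
    obtain ⟨m', h1, h2, h3⟩ := hs _ _ hP
    refine ⟨Function.update m' k (some v), fun j w hj => ?_, fun I => (hE I e m').1 (h2 I),
      fun j w hj => ⟨m', h3 j w hj, rfl⟩⟩
    by_cases hjk : j = k
    · subst hjk
      simpa using hj
    · simp only [Function.update_of_ne hjk] at hj ⊢
      exact h1 _ _ hj
  · intro j w hj
    have hjk : j ≠ k := by
      rintro rfl
      rw [hm] at hj
      cases hj
    rw [Function.update_of_ne hjk, hj]

/-- Conversely, once the choice has been made in `E`, a strategy for `E` is one for `E'`. -/
theorem Wins.choose {E E' : Cirquent} {k : ℕ ⊕ ℕ} {v : ℕ} {ρ : ℕ → ℕ}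
    (hE : ∀ I e m, Holds I e m E' ρ ↔ Holds I e (Function.update m k (some v)) E ρ)
    {e m : Moves} (hm : m k = some v) (h : Wins E ρ e m) : Wins E' ρ e m := by
  obtain ⟨P, hP, hs⟩ := h
  refine ⟨fun e m => P e m ∧ m k = some v, ⟨hP, hm⟩, ?_⟩
  rintro e m ⟨hP, hm⟩
  obtain ⟨m', h1, h2, h3⟩ := hs _ _ hP
  have hm' : m' k = some v := h1 _ _ hm
  refine ⟨m', h1, fun I => (hE I e m').2 ?_, fun j w hj => ⟨h3 j w hj, hm'⟩⟩
  rw [← hm', Function.update_eq_self]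
  exact h2 I

/-! ### Renaming of constants -/

/-- The choices `e` with the chosen constants renamed by `h`. -/
def Moves.rename (h : ℕ → ℕ) (e : Moves) : Moves
  | Sum.inl c => e (Sum.inl c)
  | Sum.inr c => (e (Sum.inr c)).map h

theorem Moves.rename_update_inl (h : ℕ → ℕ) (e : Moves) (c v : ℕ) :
    Moves.rename h (Function.update e (Sum.inl c) (some v)) =
      Function.update (Moves.rename h e) (Sum.inl c) (some v) := by
  funext j
  rcases j with j | j <;> simp [Moves.rename, Function.update_apply]

theorem Moves.rename_update_inr (h : ℕ → ℕ) (e : Moves) (c v : ℕ) :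
    Moves.rename h (Function.update e (Sum.inr c) (some v)) =
      Function.update (Moves.rename h e) (Sum.inr c) (some (h v)) := by
  funext j
  rcases j with j | j
  · simp [Moves.rename]
  · by_cases hj : j = c <;> simp [Moves.rename, hj]

theorem holds_rename {I : ℕ → List ℕ → Prop} {e m : Moves} {h : ℕ → ℕ} (E : Cirquent) (ρ : ℕ → ℕ)
    (hE : ∀ a ∈ E.consts, h a = a) :
    Holds I (Moves.rename h e) (Moves.rename h m) E (h ∘ ρ) ↔
      Holds (fun p l => I p (l.map h)) e m E ρ := by
  have hts : ∀ (ts : List Term) (ρ : ℕ → ℕ), (∀ a ∈ ts.flatMap Term.consts, h a = a) →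
      ts.map (Term.value (h ∘ ρ)) = (ts.map (Term.value ρ)).map h := by
    intro ts ρ hts
    rw [List.map_map]
    refine List.map_congr_left fun t ht => ?_
    cases t with
    | var i => rfl
    | const a =>
      exact (hts a (List.mem_flatMap.2 ⟨_, ht, by simp [Term.consts]⟩)).symm
  have hp : ∀ (a : ℕ) (ρ : ℕ → ℕ), push (h a) (h ∘ ρ) = h ∘ push a ρ := by
    intro a ρ
    funext i
    cases i <;> rfl
  induction E generalizing ρ with
  | top | bot => rfl
  | atom p ts | natom p ts => simp only [Holds, hts ts ρ hE]
  | pand A B ihA ihB | por A B ihA ihB =>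
    simp only [consts, List.mem_append] at hE
    simp only [Holds, ihA ρ fun a ha => hE a (Or.inl ha), ihB ρ fun a ha => hE a (Or.inr ha)]
  | chand c A B ihA ihB | chor c A B ihA ihB =>
    simp only [consts, List.mem_append] at hE
    simp only [Holds, ihA ρ fun a ha => hE a (Or.inl ha), ihB ρ fun a ha => hE a (Or.inr ha),
      Moves.rename]
  | chall c A ih | chex c A ih => simp [Holds, Moves.rename, hp, ih _ hE]

/-- A strategy survives a renaming of constants that fixes those of the cirquent.  Every move of
the environment in the renamed play has to come from some move in the original one, so `h` must be
surjective; it need not be injective. -/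
theorem Wins.rename {E : Cirquent} {ρ : ℕ → ℕ} {e m : Moves} {h : ℕ → ℕ}
    (hh : Function.Surjective h) (hE : ∀ a ∈ E.consts, h a = a) (hw : Wins E ρ e m) :
    Wins E (h ∘ ρ) (Moves.rename h e) (Moves.rename h m) := by
  obtain ⟨P, hP, hs⟩ := hw
  refine ⟨fun e' m' => ∃ e m, P e m ∧ e' = Moves.rename h e ∧ m' = Moves.rename h m,
    ⟨e, m, hP, rfl, rfl⟩, ?_⟩
  rintro _ _ ⟨e, m, hP, rfl, rfl⟩
  obtain ⟨m', h1, h2, h3⟩ := hs _ _ hP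
  refine ⟨Moves.rename h m', ?_, fun I => (holds_rename E ρ hE).2 (h2 _), ?_⟩
  · rintro (k | k) v hv
    · exact h1 _ _ hv
    · simp only [Moves.rename, Option.map_eq_some_iff] at hv ⊢
      obtain ⟨a, ha, rfl⟩ := hv
      exact ⟨a, h1 _ _ ha, rfl⟩
  · rintro (k | k) v hk
    · exact ⟨_, m', h3 (Sum.inl k) v hk, (Moves.rename_update_inl h e k v).symm, rfl⟩
    · obtain ⟨a, rfl⟩ := hh v
      simp only [Moves.rename, Option.map_eq_none_iff] at hk
      exact ⟨_, m', h3 (Sum.inr k) a hk, (Moves.rename_update_inr h e k a).symm, rfl⟩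

theorem Moves.rename_noMoves (h : ℕ → ℕ) : Moves.rename h noMoves = noMoves := by
  funext k
  rcases k with k | k <;> rfl

/-! ### Soundness of the calculus -/

/-- Monotonicity in the hole of a context.  The variable with index `i` outside the context has
index `X.depth + i` in the hole. -/
theorem holds_fill_mono {I : ℕ → List ℕ → Prop} {e m : Moves} {A B : Cirquent} (X : Ctx)
    (ρ : ℕ → ℕ) (hole : ∀ ρ' : ℕ → ℕ, (∀ i, ρ' (X.depth + i) = ρ i) →
      Holds I e m A ρ' → Holds I e m B ρ') :
    Holds I e m (X.fill A) ρ → Holds I e m (X.fill B) ρ := by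
  induction X generalizing ρ with
  | hole => exact hole ρ fun i => by simp [Ctx.depth]
  | pandL X C ih => exact And.imp_left (ih ρ hole)
  | pandR C X ih => exact And.imp_right (ih ρ hole)
  | porL X C ih => exact Or.imp_left (ih ρ hole)
  | porR C X ih => exact Or.imp_right (ih ρ hole)
  | chandL d X C ih => exact And.imp_left fun h h0 => ih ρ hole (h h0)
  | chandR d C X ih => exact And.imp_right fun h v h0 => ih ρ hole (h v h0)
  | chorL d X C ih => exact Or.imp_left (And.imp_right (ih ρ hole))
  | chorR d C X ih => exact Or.imp_right (Exists.imp fun v => And.imp_right (ih ρ hole))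
  | chall d X ih =>
    refine fun h a ha => ih (push a ρ) (fun ρ' hρ' => hole ρ' fun i => ?_) (h a ha)
    rw [Ctx.depth, Nat.add_assoc, Nat.add_comm 1, hρ']
    rfl
  | chex d X ih =>
    refine Exists.imp fun a => And.imp_right
      (ih (push a ρ) (fun ρ' hρ' => hole ρ' fun i => ?_))
    rw [Ctx.depth, Nat.add_assoc, Nat.add_comm 1, hρ']
    rfl

theorem holds_congr_env {I : ℕ → List ℕ → Prop} {e e' m : Moves} (E : Cirquent) (ρ : ℕ → ℕ)
    (hca : ∀ c ∈ E.chandClusters, e (Sum.inl c) = e' (Sum.inl c))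
    (hal : ∀ c ∈ E.challClusters, e (Sum.inr c) = e' (Sum.inr c)) :
    Holds I e m E ρ ↔ Holds I e' m E ρ := by
  induction E generalizing ρ with
  | top | bot | atom p ts | natom p ts => rfl
  | pand A B ihA ihB | por A B ihA ihB | chor d A B ihA ihB =>
    simp only [chandClusters, challClusters, List.mem_append] at hca hal
    simp only [Holds, ihA ρ (fun c hc => hca c (Or.inl hc)) fun c hc => hal c (Or.inl hc),
      ihB ρ (fun c hc => hca c (Or.inr hc)) fun c hc => hal c (Or.inr hc)]
  | chand d A B ihA ihB =>
    simp only [chandClusters, challClusters, List.mem_append, List.mem_cons] at hca hal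
    simp only [Holds, hca d (Or.inl rfl),
      ihA ρ (fun c hc => hca c (Or.inr (Or.inl hc))) fun c hc => hal c (Or.inl hc),
      ihB ρ (fun c hc => hca c (Or.inr (Or.inr hc))) fun c hc => hal c (Or.inr hc)]
  | chall d A ih =>
    simp only [challClusters, List.mem_cons] at hal
    simp only [Holds, hal d (Or.inl rfl), ih _ hca fun c hc => hal c (Or.inr hc)]
  | chex d A ih => simp only [Holds, ih _ hca hal]

theorem Valid.fill_mono {A B : Cirquent} (X : Ctx)
    (hole : ∀ I e m ρ, Holds I e m A ρ → Holds I e m B ρ) (h : Valid (X.fill A)) :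
    Valid (X.fill B) :=
  h.mono fun I e m ρ => holds_fill_mono X ρ fun ρ' _ => hole I e m ρ'

/-- `x` is a choice between the two components of a Chotomy that a play in which the clusters `k₁`
and `k₂` have been treated as in `e` can be supplied with: the first component once `k₁` has been
resolved, the second one once `k₂` has, none as long as both are unresolved. -/
def Compatible (e : Moves) (k₁ k₂ : ℕ ⊕ ℕ) : Option ℕ → Prop
  | none => e k₁ = none ∧ e k₂ = none
  | some 0 => e k₁ ≠ none
  | some (_ + 1) => e k₂ ≠ none

/-- In the strategy for the conclusion of a Chotomy, the machine imagines a play of the premise, in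
which the environment resolves the additional cluster `c` just before the first time that it
resolves one of `k₁` and `k₂` in the actual play. -/
theorem Valid.of_chotomy {E E' : Cirquent} {c : ℕ} {k₁ k₂ : ℕ ⊕ ℕ} (h₁ : k₁ ≠ Sum.inl c)
    (h₂ : k₂ ≠ Sum.inl c)
    (hE : ∀ I e m x ρ, Compatible e k₁ k₂ x →
      Holds I (Function.update e (Sum.inl c) x) m E' ρ → Holds I e m E ρ)
    (h : Valid E') : Valid E := by
  intro ρ
  refine ⟨fun e m => ∃ x, Compatible e k₁ k₂ x ∧ Wins E' ρ (Function.update e (Sum.inl c) x) m,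
    ⟨none, ⟨rfl, rfl⟩, ?_⟩, ?_⟩
  · have : Function.update noMoves (Sum.inl c) none = noMoves := Function.update_eq_self _ _
    rw [this]
    exact h ρ
  rintro e m ⟨x, hx, hw⟩
  obtain ⟨m', hm', hh, hw', henv⟩ := hw.step
  refine ⟨m', hm', fun I => hE I e m' x ρ hx (hh I), fun k v hk => ?_⟩
  by_cases hkc : k = Sum.inl c
  · -- the cluster `c` is irrelevant in the actual play
    subst hkc
    refine ⟨x, ?_, by rwa [Function.update_idem]⟩
    rcases x with _ | _ | x <;>
      simpa only [Compatible, Function.update_of_ne h₁, Function.update_of_ne h₂] using hx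
  · have hcomm : ∀ y, Function.update (Function.update e k (some v)) (Sum.inl c) y =
        Function.update (Function.update e (Sum.inl c) y) k (some v) :=
      fun y => Function.update_comm hkc _ _ _
    have hupd : ∀ y, (Function.update e (Sum.inl c) y) k = none := fun y => by
      rw [Function.update_of_ne hkc, hk]
    have hne : ∀ j, e j ≠ none → Function.update e k (some v) j ≠ none := by
      intro j hj
      by_cases hjk : j = k
      · simp [hjk]
      · rwa [Function.update_of_ne hjk]
    rcases x with _ | _ | x
    · have hres : ∀ y, Wins E' ρ (Function.update (Function.update e k (some v)) (Sum.inl c)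
          (some y)) m' := by
        intro y
        have := hw'.env (k := Sum.inl c) (by simp) y
        rw [Function.update_idem] at this
        rw [hcomm]
        exact this.env (hupd _) v
      by_cases hk₁ : k = k₁
      · exact ⟨some 0, by simp [Compatible, hk₁], hres 0⟩
      · by_cases hk₂ : k = k₂
        · exact ⟨some 1, by simp [Compatible, hk₂], hres 1⟩
        · refine ⟨none, ?_, ?_⟩
          · simpa only [Compatible, Function.update_of_ne (Ne.symm hk₁),
              Function.update_of_ne (Ne.symm hk₂)] using hx
          · rw [hcomm]
            exact henv k v (hupd _)
    · exact ⟨some 0, hne _ hx, by rw [hcomm]; exact henv k v (hupd _)⟩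
    · exact ⟨some (x + 1), hne k₂ hx, by rw [hcomm]; exact henv k v (hupd _)⟩

theorem Valid.of_fill_chotomy {A A' : Cirquent} (X : Ctx) {c : ℕ} {k₁ k₂ : ℕ ⊕ ℕ}
    (hc : c ∉ (X.fill A).chandClusters) (h₁ : k₁ ≠ Sum.inl c) (h₂ : k₂ ≠ Sum.inl c)
    (hA : ∀ I e m x ρ, Compatible e k₁ k₂ x → Holds I (Function.update e (Sum.inl c) x) m A' ρ →
      Holds I (Function.update e (Sum.inl c) x) m A ρ)
    (h : Valid (X.fill A')) : Valid (X.fill A) := by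
  refine Valid.of_chotomy h₁ h₂ (fun I e m x ρ hx hh => ?_) h
  refine (holds_congr_env _ ρ (fun d hd => ?_) fun d _ => ?_).1
    (holds_fill_mono X ρ (fun ρ' _ => hA I e m x ρ' hx) hh)
  · rw [Function.update_of_ne]
    exact fun h => hc (Sum.inl.inj h ▸ hd)
  · exact Function.update_of_ne Sum.inr_ne_inl _ _

theorem mem_chandClusters_fill (X : Ctx) {A : Cirquent} {c : ℕ} (h : c ∈ A.chandClusters) :
    c ∈ (X.fill A).chandClusters := by
  induction X <;> simp_all [Ctx.fill, chandClusters]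

theorem Valid.chand {c : ℕ} {A B : Cirquent} (hA : Valid A) (hB : Valid B) :
    Valid (chand c A B) := by
  intro ρ
  refine ⟨fun e m => (e (Sum.inl c) = none → Wins A ρ e m ∧ Wins B ρ e m) ∧
    (e (Sum.inl c) = some 0 → Wins A ρ e m) ∧
    ∀ v, e (Sum.inl c) = some (v + 1) → Wins B ρ e m,
    ⟨fun _ => ⟨hA ρ, hB ρ⟩, fun h => (Option.some_ne_none _ h.symm).elim,
      fun v h => (Option.some_ne_none _ h.symm).elim⟩, ?_⟩
  rintro e m ⟨hn, h0, h1⟩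
  have hkeep : ∀ (k : ℕ ⊕ ℕ) (v w : ℕ), e k = none → e (Sum.inl c) = some w →
      Function.update e k (some v) (Sum.inl c) = some w := by
    intro k v w hk hw
    rwa [Function.update_of_ne]
    rintro rfl
    rw [hk] at hw
    cases hw
  rcases hc : e (Sum.inl c) with _ | _ | w
  · refine ⟨m, Extends.refl _, fun I => by simp [Holds, hc], fun k v hk => ?_⟩
    have hw := hn hc
    exact ⟨fun _ => ⟨hw.1.env hk v, hw.2.env hk v⟩, fun _ => hw.1.env hk v,
      fun _ _ => hw.2.env hk v⟩
  · obtain ⟨m', g1, g2, g3, g4⟩ := (h0 hc).step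
    refine ⟨m', g1, fun I => by simpa [Holds, hc] using g2 I, fun k v hk => ?_⟩
    beta_reduce
    rw [hkeep k v 0 hk hc]
    exact ⟨fun h => (Option.some_ne_none _ h).elim, fun _ => g4 k v hk, fun v h => by simp at h⟩
  · obtain ⟨m', g1, g2, g3, g4⟩ := (h1 w hc).step
    refine ⟨m', g1, fun I => by simpa [Holds, hc] using g2 I, fun k v hk => ?_⟩
    beta_reduce
    rw [hkeep k v _ hk hc]
    exact ⟨fun h => (Option.some_ne_none _ h).elim, fun h => by simp at h, fun _ _ => g4 k v hk⟩

theorem mem_le_foldr_max {l : List ℕ} {a : ℕ} (h : a ∈ l) : a ≤ l.foldr max 0 := by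
  induction l with
  | nil => simp at h
  | cons b l ih =>
    rcases List.mem_cons.1 h with rfl | h
    · simp
    · exact (ih h).trans (by simp)

/-- A strategy for `A(a)` with a fresh constant `a` works for every other constant `b` in its
place: rename `a` to `b`, and the larger unused constants surjectively. -/
theorem Valid.inst_any {A : Cirquent} {a : ℕ} (ha : a ∉ A.consts)
    (h : Valid (A.inst (Term.const a))) (b : ℕ) (ρ : ℕ → ℕ) :
    Wins A (push b ρ) noMoves noMoves := by
  obtain ⟨N, hN⟩ : ∃ N, ∀ d ∈ a :: A.consts, d < N :=
    ⟨(a :: A.consts).foldr max 0 + 1, fun d hd => Nat.lt_succ_of_le (mem_le_foldr_max hd)⟩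
  let f : ℕ → ℕ := fun d => if d < N then (if d = a then b else d) else d - N
  have hf : ∀ d, f (d + N) = d := fun d => by simp [f]
  have hw : Wins A (push a fun i => ρ i + N) noMoves noMoves :=
    (h fun i => ρ i + N).mono fun I e m => (holds_inst A _ _).1
  have hfix : ∀ d ∈ A.consts, f d = d := by
    intro d hd
    have h1 : d < N := hN d (List.mem_cons_of_mem _ hd)
    have h2 : d ≠ a := fun h => ha (h ▸ hd)
    simp [f, h1, h2]
  have := hw.rename (h := f) (fun d => ⟨d + N, hf d⟩) hfix
  rw [Moves.rename_noMoves] at this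
  convert this using 1
  funext i
  rcases i with _ | i
  · have : a < N := hN a List.mem_cons_self
    simp [push, f, this]
  · simp [push, hf]

theorem Valid.chall {c a : ℕ} {A : Cirquent} (ha : a ∉ A.consts)
    (h : Valid (A.inst (Term.const a))) : Valid (chall c A) := by
  intro ρ
  have h := h.inst_any ha (ρ := ρ)
  refine ⟨fun e m => (e (Sum.inr c) = none → ∀ b, Wins A (push b ρ) e m) ∧
    ∀ b, e (Sum.inr c) = some b → Wins A (push b ρ) e m,
    ⟨fun _ => h, fun v h => (Option.some_ne_none _ h.symm).elim⟩, ?_⟩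
  rintro e m ⟨hn, h1⟩
  rcases hc : e (Sum.inr c) with _ | w
  · refine ⟨m, Extends.refl _, fun I => by simp [Holds, hc], fun k v hk => ?_⟩
    have hw := hn hc
    exact ⟨fun _ b => (hw b).env hk v, fun b _ => (hw b).env hk v⟩
  · obtain ⟨m', g1, g2, g3, g4⟩ := (h1 w hc).step
    refine ⟨m', g1, fun I => by simpa [Holds, hc] using g2 I, fun k v hk => ?_⟩
    have : Function.update e k (some v) (Sum.inr c) = some w := by
      rwa [Function.update_of_ne]
      rintro rfl
      rw [hk] at hc
      cases hc
    beta_reduce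
    rw [this]
    refine ⟨fun h => (Option.some_ne_none _ h).elim, fun b hb => ?_⟩
    obtain rfl : w = b := by simpa using hb
    exact g4 k v hk

/-- Everything provable is valid. -/
theorem Provable.valid {E : Cirquent} (h : Provable E) : Valid E := by
  induction h with
  | ax => exact fun ρ => ⟨fun _ _ => True, trivial, fun e m _ =>
      ⟨m, Extends.refl _, fun _ => trivial, fun _ _ _ => trivial⟩⟩
  | por_comm X A B _ ih | pand_comm X A B _ ih | por_assoc X A B C _ ih
  | pand_assoc X A B C _ ih | por_identity X A _ ih | pand_identity X A _ ih
  | por_domination X A _ ih | pand_domination X A _ ih | pand_distribution X A B C _ ih =>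
    refine ih.fill_mono X fun I e m ρ => ?_
    simp only [Holds]
    tauto
  | left_chor_choosing c E _ ih =>
    exact fun ρ => (ih ρ).of_choose (k := Sum.inl c) (v := 0)
      (fun I e m => holds_chooseOr (v := 0) E ρ) rfl
  | right_chor_choosing c E _ ih =>
    exact fun ρ => (ih ρ).of_choose (k := Sum.inl c) (v := 1)
      (fun I e m => holds_chooseOr (v := 1) E ρ) rfl
  | chexists_choosing c a E _ ih =>
    exact fun ρ => (ih ρ).of_choose (k := Sum.inr c) (v := a)
      (fun I e m => holds_chooseEx E ρ) rfl
  | left_chand_cleansing X Y c A B C _ ih =>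
    refine ih.fill_mono X fun I e m ρ => ?_
    simp only [Holds]
    refine And.imp_left fun h h0 => holds_fill_mono Y ρ (fun ρ' _ hA => ?_) (h h0)
    exact ⟨fun _ => hA, fun v hv => by simp [h0] at hv⟩
  | right_chand_cleansing X Y c A B C _ ih =>
    refine ih.fill_mono X fun I e m ρ => ?_
    simp only [Holds]
    refine And.imp_right fun h v h0 => holds_fill_mono Y ρ (fun ρ' _ hA => ?_) (h v h0)
    exact ⟨fun hv => by simp [h0] at hv, fun _ _ => hA⟩
  | chall_cleansing X Y c A _ ih =>
    refine ih.fill_mono X fun I e m ρ => ?_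
    simp only [Holds]
    refine fun h a ha => holds_fill_mono Y _ (fun ρ' hρ' hA b hb => ?_) (h a ha)
    obtain rfl : a = b := by simpa [ha] using hb
    have h0 : ρ' Y.depth = a := hρ' 0
    simpa [holds_inst, Term.value, h0] using hA
  | chand_distribution X c A B C _ ih =>
    refine ih.fill_mono X fun I e m ρ => ?_
    simp only [Holds]
    rintro ⟨h1, h2⟩
    by_cases hC : Holds I e m C ρ
    · exact Or.inr hC
    · exact Or.inl ⟨fun h => (h1 h).resolve_right hC, fun v h => (h2 v h).resolve_right hC⟩
  | chall_distribution X c A B _ ih =>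
    refine ih.fill_mono X fun I e m ρ => ?_
    simp only [Holds, holds_weaken]
    intro h
    by_cases hC : Holds I e m B ρ
    · exact Or.inr hC
    · exact Or.inl fun a ha => (h a ha).resolve_right hC
  | trivialization X p ts _ ih =>
    refine ih.fill_mono X fun I e m ρ _ => ?_
    simp only [Holds]
    tauto
  | chandchotomy X a b c A B C D hc _ ih =>
    have hc' : c ∉ (pand (Cirquent.chand a A B) (Cirquent.chand b C D)).chandClusters :=
      fun h => hc (mem_chandClusters_fill X h)
    simp only [chandClusters, List.mem_append, List.mem_cons, not_or] at hc'
    refine ih.of_fill_chotomy X hc (k₁ := Sum.inl a) (k₂ := Sum.inl b)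
      (by simpa using Ne.symm hc'.1.1) (by simpa using Ne.symm hc'.2.1)
      fun I e m x ρ hx => ?_
    have ha : a ≠ c := Ne.symm hc'.1.1
    have hb : b ≠ c := Ne.symm hc'.2.1
    rcases x with _ | _ | x <;> simp only [Compatible] at hx <;> simp [Holds, ha, hb, hx]
    · rcases hea : e (Sum.inl a) with _ | _ | w
      · exact (hx hea).elim
      all_goals simp_all
    · rcases hea : e (Sum.inl b) with _ | _ | w
      · exact (hx hea).elim
      all_goals simp_all
  | challchotomy X a b c A B hc _ ih =>
    refine ih.of_fill_chotomy X hc (k₁ := Sum.inr a) (k₂ := Sum.inr b)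
      (by simp) (by simp) fun I e m x ρ hx => ?_
    rcases x with _ | _ | x <;> simp only [Compatible] at hx <;>
      simp [Holds, hx, holds_weaken]
    · rcases hea : e (Sum.inr a) with _ | w
      · exact (hx hea).elim
      all_goals simp_all
    · rcases hea : e (Sum.inr b) with _ | w
      · exact (hx hea).elim
      all_goals simp_all
  | chandallchotomy X a b c A B C hc _ ih =>
    have hc' : c ∉ (pand (Cirquent.chand a A B) (Cirquent.chall b C)).chandClusters :=
      fun h => hc (mem_chandClusters_fill X h)
    simp only [chandClusters, List.mem_append, List.mem_cons, not_or] at hc'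
    have ha : a ≠ c := Ne.symm hc'.1.1
    refine ih.of_fill_chotomy X hc (k₁ := Sum.inl a) (k₂ := Sum.inr b)
      (by simpa using ha) (by simp) fun I e m x ρ hx => ?_
    rcases x with _ | _ | x <;> simp only [Compatible] at hx <;>
      simp [Holds, ha, hx, holds_weaken]
    · rcases hea : e (Sum.inl a) with _ | _ | w
      · exact (hx hea).elim
      all_goals simp_all
    · rcases hea : e (Sum.inr b) with _ | w
      · exact (hx hea).elim
      all_goals simp_all
  | chand_splitting c A B _ _ _ _ ihA ihB => exact ihA.chand ihB
  | chall_splitting c a A _ ha _ ih => exact Valid.chall ha ih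

/-! ### Rank -/

theorem rank_pos (E : Cirquent) : 0 < rank E := by
  induction E with
  | top | bot | atom p ts | natom p ts => exact Nat.one_pos
  | pand A B _ _ => exact Nat.pow_pos (by norm_num)
  | por A B _ _ =>
    rw [rank]
    cases rank A + rank B with
    | zero => exact Nat.one_pos
    | succ n => exact Nat.pow_pos (by norm_num)
  | chand c A B ihA ihB | chor c A B ihA ihB => exact Nat.add_pos_left ihA _
  | chall c A ih | chex c A ih => exact Nat.succ_pos _

theorem two_mul_tower_lt (n : ℕ) : 2 * tower n < tower (n + 1) := by
  have h : ∀ x : ℕ, 2 * x < 5 ^ x := by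
    intro x
    induction x with
    | zero => norm_num
    | succ x ih =>
      have : 1 ≤ 5 ^ x := Nat.one_le_pow _ _ (by norm_num)
      rw [pow_succ]
      omega
  exact h _

theorem tower_pos (n : ℕ) : 0 < tower n := by
  cases n with
  | zero => exact Nat.one_pos
  | succ n => exact Nat.pow_pos (by norm_num)

theorem tower_strictMono : StrictMono tower :=
  strictMono_nat_of_lt_succ fun n => by
    have := two_mul_tower_lt n
    omega

theorem lt_tower (n : ℕ) : n < tower n := by
  induction n with
  | zero => exact Nat.one_pos
  | succ n ih =>
    have := two_mul_tower_lt n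
    omega

theorem lt_five_pow (n : ℕ) : n < 5 ^ n := Nat.lt_pow_self (by norm_num)

theorem rank_lift (k : ℕ) (A : Cirquent) : rank (lift k A) = rank A := by
  induction A generalizing k <;> simp_all [lift, rank]

theorem rank_weaken (A : Cirquent) : rank A.weaken = rank A := rank_lift 0 A

theorem rank_subst (k : ℕ) (t : Term) (A : Cirquent) : rank (subst k t A) = rank A := by
  induction A generalizing k t <;> simp_all [subst, rank]

theorem rank_inst (A : Cirquent) (t : Term) : rank (A.inst t) = rank A := rank_subst 0 t A

theorem rank_fill_lt (X : Ctx) {A B : Cirquent} (h : rank B < rank A) :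
    rank (X.fill B) < rank (X.fill A) := by
  have h5 : ∀ {m n : ℕ}, m < n → 5 ^ m < 5 ^ n := fun h => Nat.pow_lt_pow_right (by norm_num) h
  induction X with
  | hole => exact h
  | pandL X C ih => exact h5 (by simpa using ih)
  | pandR C X ih => exact h5 (by simpa using ih)
  | porL X C ih => exact tower_strictMono (by simpa using ih)
  | porR C X ih => exact tower_strictMono (by simpa using ih)
  | chandL c X C ih | chandR c C X ih | chorL c X C ih | chorR c C X ih | chall c X ih
  | chex c X ih => simpa [Ctx.fill, rank] using ih

theorem rank_chooseOr_le (c : ℕ) (b : Bool) (E : Cirquent) : rank (chooseOr c b E) ≤ rank E := by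
  induction E with
  | top | bot | atom p ts | natom p ts => exact le_rfl
  | pand A B ihA ihB =>
    exact Nat.pow_le_pow_right (by norm_num) (add_le_add ihA ihB)
  | por A B ihA ihB => exact tower_strictMono.monotone (add_le_add ihA ihB)
  | chand d A B ihA ihB => exact add_le_add ihA ihB
  | chor d A B ihA ihB =>
    simp only [chooseOr]
    split_ifs <;> simp only [rank] <;> omega
  | chall d A ih | chex d A ih => exact Nat.succ_le_succ ih

theorem rank_chooseEx_le (c a : ℕ) (E : Cirquent) : rank (chooseEx c a E) ≤ rank E := by
  induction E with
  | top | bot | atom p ts | natom p ts => exact le_rfl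
  | pand A B ihA ihB =>
    exact Nat.pow_le_pow_right (by norm_num) (add_le_add ihA ihB)
  | por A B ihA ihB => exact tower_strictMono.monotone (add_le_add ihA ihB)
  | chand d A B ihA ihB | chor d A B ihA ihB => exact add_le_add ihA ihB
  | chall d A ih => exact Nat.succ_le_succ ih
  | chex d A ih =>
    simp only [chooseEx]
    split_ifs <;> simp only [rank, rank_inst] <;> omega

/-! ### Closedness -/

theorem Term.closedAt_lift {k : ℕ} (j : ℕ) {t : Term} (h : t.ClosedAt k) :
    (t.lift j).ClosedAt (k + 1) := by
  cases t with
  | var i =>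
    simp only [Term.lift, Term.ClosedAt] at h ⊢
    split_ifs
    · exact h.trans (Nat.lt_succ_self k)
    · exact Nat.succ_lt_succ h
  | const a => trivial

theorem closedAt_lift {k : ℕ} (j : ℕ) {A : Cirquent} (h : ClosedAt k A) :
    ClosedAt (k + 1) (lift j A) := by
  induction A generalizing k j with
  | top | bot => trivial
  | atom p ts | natom p ts =>
    simp only [lift, ClosedAt, List.mem_map] at h ⊢
    rintro _ ⟨t, ht, rfl⟩
    exact Term.closedAt_lift j (h t ht)
  | pand A B ihA ihB | por A B ihA ihB | chand c A B ihA ihB | chor c A B ihA ihB =>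
    exact ⟨ihA j h.1, ihB j h.2⟩
  | chall c A ih | chex c A ih => exact ih (j + 1) h

theorem Term.closedAt_subst {k j : ℕ} {s t : Term} (hj : j ≤ k) (ht : t.ClosedAt k)
    (h : s.ClosedAt (k + 1)) : (Term.subst j t s).ClosedAt k := by
  cases s with
  | var i =>
    simp only [Term.subst, Term.ClosedAt] at h ⊢
    split_ifs
    · simp only
      omega
    · exact ht
    · simp only
      omega
  | const a => trivial

theorem closedAt_subst {k j : ℕ} {t : Term} {A : Cirquent} (hj : j ≤ k) (ht : t.ClosedAt k)
    (h : ClosedAt (k + 1) A) : ClosedAt k (subst j t A) := by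
  induction A generalizing k j t with
  | top | bot => trivial
  | atom p ts | natom p ts =>
    simp only [subst, ClosedAt, List.mem_map] at h ⊢
    rintro _ ⟨s, hs, rfl⟩
    exact Term.closedAt_subst hj ht (h s hs)
  | pand A B ihA ihB | por A B ihA ihB | chand c A B ihA ihB | chor c A B ihA ihB =>
    exact ⟨ihA hj ht h.1, ihB hj ht h.2⟩
  | chall c A ih | chex c A ih =>
    exact ih (Nat.succ_le_succ hj) (Term.closedAt_lift 0 ht) h

theorem closedAt_weaken {k : ℕ} {A : Cirquent} (h : ClosedAt k A) : ClosedAt (k + 1) A.weaken :=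
  closedAt_lift 0 h

theorem closedAt_inst {k : ℕ} {t : Term} {A : Cirquent} (ht : t.ClosedAt k)
    (h : ClosedAt (k + 1) A) : ClosedAt k (A.inst t) :=
  closedAt_subst (Nat.zero_le k) ht h

theorem closedAt_fill {A B : Cirquent} (X : Ctx) {k : ℕ}
    (hAB : ClosedAt (k + X.depth) A → ClosedAt (k + X.depth) B) (h : ClosedAt k (X.fill A)) :
    ClosedAt k (X.fill B) := by
  induction X generalizing k with
  | hole => exact hAB h
  | pandL X C ih | porL X C ih | chandL c X C ih | chorL c X C ih => exact ⟨ih hAB h.1, h.2⟩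
  | pandR C X ih | porR C X ih | chandR c C X ih | chorR c C X ih => exact ⟨h.1, ih hAB h.2⟩
  | chall c X ih | chex c X ih =>
    refine ih ?_ h
    simpa only [Ctx.depth, Nat.add_assoc, Nat.add_comm 1] using hAB

theorem closedAt_chooseOr (c : ℕ) (b : Bool) {E : Cirquent} {k : ℕ} (h : ClosedAt k E) :
    ClosedAt k (chooseOr c b E) := by
  induction E generalizing k with
  | top | bot | atom p ts | natom p ts => exact h
  | pand A B ihA ihB | por A B ihA ihB | chand d A B ihA ihB => exact ⟨ihA h.1, ihB h.2⟩
  | chor d A B ihA ihB =>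
    simp only [chooseOr]
    split_ifs
    · exact ihB h.2
    · exact ihA h.1
    · exact ⟨ihA h.1, ihB h.2⟩
  | chall d A ih | chex d A ih => exact ih (k := k + 1) h

theorem closedAt_chooseEx (c a : ℕ) {E : Cirquent} {k : ℕ} (h : ClosedAt k E) :
    ClosedAt k (chooseEx c a E) := by
  induction E generalizing k with
  | top | bot | atom p ts | natom p ts => exact h
  | pand A B ihA ihB | por A B ihA ihB | chand d A B ihA ihB | chor d A B ihA ihB =>
    exact ⟨ihA h.1, ihB h.2⟩
  | chall d A ih => exact ih (k := k + 1) h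
  | chex d A ih =>
    simp only [chooseEx]
    split_ifs
    · exact closedAt_inst trivial (ih (k := k + 1) h)
    · exact ih (k := k + 1) h

/-! ### Reductions -/

theorem freshOf_notMem (l : List ℕ) : freshOf l ∉ l :=
  fun h => Nat.not_succ_le_self _ (mem_le_foldr_max h)

/-- The properties of the modifications that Purification makes. -/
structure Reduces (E E' : Cirquent) : Prop where
  rank_lt : rank E' < rank E
  provable : Provable E' → Provable E
  valid : Valid E → Valid E'
  closed : Closed E → Closed E'

theorem Reduces.trans {E₁ E₂ E₃ : Cirquent} (h : Reduces E₁ E₂) (h' : Reduces E₂ E₃) :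
    Reduces E₁ E₃ :=
  ⟨h'.rank_lt.trans h.rank_lt, fun hp => h.provable (h'.provable hp),
    fun hv => h'.valid (h.valid hv), fun hc => h'.closed (h.closed hc)⟩

theorem Reduces.irrefl (E : Cirquent) : ¬ Reduces E E := fun h => lt_irrefl _ h.rank_lt

theorem exists_ctx_of_onSurface {r : Cirquent → Option Cirquent} {E E' : Cirquent}
    (h : onSurface r E = some E') :
    ∃ X A A', E = Ctx.fill X A ∧ E' = Ctx.fill X A' ∧ r A = some A' := by
  have root : ∀ {E E'}, r E = some E' →
      ∃ X A A', E = Ctx.fill X A ∧ E' = Ctx.fill X A' ∧ r A = some A' :=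
    fun h => ⟨.hole, _, _, rfl, rfl, h⟩
  induction E generalizing E' with
  | pand A B ihA ihB =>
    simp only [onSurface, Option.orElse_eq_some, Option.map_eq_some_iff] at h
    rcases h with h | ⟨-, ⟨A', h, rfl⟩ | ⟨-, B', h, rfl⟩⟩
    · exact root h
    · obtain ⟨X, S, S', rfl, rfl, hr⟩ := ihA h
      exact ⟨.pandL X B, S, S', rfl, rfl, hr⟩
    · obtain ⟨X, S, S', rfl, rfl, hr⟩ := ihB h
      exact ⟨.pandR A X, S, S', rfl, rfl, hr⟩
  | por A B ihA ihB =>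
    simp only [onSurface, Option.orElse_eq_some, Option.map_eq_some_iff] at h
    rcases h with h | ⟨-, ⟨A', h, rfl⟩ | ⟨-, B', h, rfl⟩⟩
    · exact root h
    · obtain ⟨X, S, S', rfl, rfl, hr⟩ := ihA h
      exact ⟨.porL X B, S, S', rfl, rfl, hr⟩
    · obtain ⟨X, S, S', rfl, rfl, hr⟩ := ihB h
      exact ⟨.porR A X, S, S', rfl, rfl, hr⟩
  | _ => exact root h

theorem exists_ctx_of_anywhere {r : ℕ → Cirquent → Option Cirquent} {d : ℕ} {E E' : Cirquent}
    (h : anywhere r d E = some E') :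
    ∃ X A A', E = Ctx.fill X A ∧ E' = Ctx.fill X A' ∧ r (d + X.depth) A = some A' := by
  have root : ∀ {d E E'}, r d E = some E' →
      ∃ X A A', E = Ctx.fill X A ∧ E' = Ctx.fill X A' ∧ r (d + X.depth) A = some A' :=
    fun h => ⟨.hole, _, _, rfl, rfl, h⟩
  induction E generalizing d E' with
  | top | bot | atom p ts | natom p ts => exact root h
  | pand A B ihA ihB =>
    simp only [anywhere, Option.orElse_eq_some, Option.map_eq_some_iff] at h
    rcases h with h | ⟨-, ⟨A', h, rfl⟩ | ⟨-, B', h, rfl⟩⟩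
    · exact root h
    · obtain ⟨X, S, S', rfl, rfl, hr⟩ := ihA h
      exact ⟨.pandL X B, S, S', rfl, rfl, hr⟩
    · obtain ⟨X, S, S', rfl, rfl, hr⟩ := ihB h
      exact ⟨.pandR A X, S, S', rfl, rfl, hr⟩
  | por A B ihA ihB =>
    simp only [anywhere, Option.orElse_eq_some, Option.map_eq_some_iff] at h
    rcases h with h | ⟨-, ⟨A', h, rfl⟩ | ⟨-, B', h, rfl⟩⟩
    · exact root h
    · obtain ⟨X, S, S', rfl, rfl, hr⟩ := ihA h
      exact ⟨.porL X B, S, S', rfl, rfl, hr⟩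
    · obtain ⟨X, S, S', rfl, rfl, hr⟩ := ihB h
      exact ⟨.porR A X, S, S', rfl, rfl, hr⟩
  | chand c A B ihA ihB =>
    simp only [anywhere, Option.orElse_eq_some, Option.map_eq_some_iff] at h
    rcases h with h | ⟨-, ⟨A', h, rfl⟩ | ⟨-, B', h, rfl⟩⟩
    · exact root h
    · obtain ⟨X, S, S', rfl, rfl, hr⟩ := ihA h
      exact ⟨.chandL c X B, S, S', rfl, rfl, hr⟩
    · obtain ⟨X, S, S', rfl, rfl, hr⟩ := ihB h
      exact ⟨.chandR c A X, S, S', rfl, rfl, hr⟩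
  | chor c A B ihA ihB =>
    simp only [anywhere, Option.orElse_eq_some, Option.map_eq_some_iff] at h
    rcases h with h | ⟨-, ⟨A', h, rfl⟩ | ⟨-, B', h, rfl⟩⟩
    · exact root h
    · obtain ⟨X, S, S', rfl, rfl, hr⟩ := ihA h
      exact ⟨.chorL c X B, S, S', rfl, rfl, hr⟩
    · obtain ⟨X, S, S', rfl, rfl, hr⟩ := ihB h
      exact ⟨.chorR c A X, S, S', rfl, rfl, hr⟩
  | chall c A ih =>
    simp only [anywhere, Option.orElse_eq_some, Option.map_eq_some_iff] at h
    rcases h with h | ⟨-, A', h, rfl⟩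
    · exact root h
    · obtain ⟨X, S, S', rfl, rfl, h⟩ := ih h
      exact ⟨.chall c X, S, S', rfl, rfl, by rwa [Ctx.depth, Nat.add_comm X.depth, ← Nat.add_assoc]⟩
  | chex c A ih =>
    simp only [anywhere, Option.orElse_eq_some, Option.map_eq_some_iff] at h
    rcases h with h | ⟨-, A', h, rfl⟩
    · exact root h
    · obtain ⟨X, S, S', rfl, rfl, h⟩ := ih h
      exact ⟨.chex c X, S, S', rfl, rfl, by rwa [Ctx.depth, Nat.add_comm X.depth, ← Nat.add_assoc]⟩

/-- The context-independent part of what makes the modification of `A` to `A'` a reduction. -/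
structure LocallyReduces (A A' : Cirquent) : Prop where
  rank_lt : rank A' < rank A
  holds : ∀ I e m ρ, Holds I e m A ρ → Holds I e m A' ρ
  closed : ∀ k, ClosedAt k A → ClosedAt k A'

/-- The normal form `onSurface r E = none` is carried along for the analysis of purified cirquents.
Provability is the part of a reduction that may depend on the context, because Chotomy requires a
cluster that is fresh in all of `E`. -/
theorem modify_reduces {r : Cirquent → Option Cirquent} {E : Cirquent}
    (hr : ∀ A A', r A = some A' → LocallyReduces A A')
    (hp : ∀ X A A', E = Ctx.fill X A → r A = some A' →
      Provable (Ctx.fill X A') → Provable (Ctx.fill X A)) :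
    (onSurface r E = none ∧ modify r E = E) ∨ Reduces E (modify r E) := by
  rcases h : onSurface r E with _ | E'
  · exact Or.inl ⟨rfl, by rw [modify, h, Option.getD_none]⟩
  · refine Or.inr ?_
    rw [modify, h, Option.getD_some]
    obtain ⟨X, A, A', rfl, rfl, hA⟩ := exists_ctx_of_onSurface h
    have := hr A A' hA
    exact ⟨rank_fill_lt X this.rank_lt, hp X A A' rfl hA, Valid.fill_mono X this.holds,
      closedAt_fill X (this.closed _)⟩

theorem reduces_comp {f g : Cirquent → Cirquent} {p q : Cirquent → Prop} {E : Cirquent}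
    (hf : (p E ∧ f E = E) ∨ Reduces E (f E))
    (hg : (q (f E) ∧ g (f E) = f E) ∨ Reduces (f E) (g (f E))) :
    ((p E ∧ q E) ∧ g (f E) = E) ∨ Reduces E (g (f E)) := by
  rcases hf with ⟨hpE, hf⟩ | hf <;> rcases hg with ⟨hq, hg⟩ | hg
  · rw [hf] at hg hq
    exact Or.inl ⟨⟨hpE, hq⟩, by rw [hf, hg]⟩
  · rw [hf] at hg ⊢
    exact Or.inr hg
  · rw [hg]
    exact Or.inr hf
  · exact Or.inr (hf.trans hg)

/-! ### Stages 1 to 6 of Purification -/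

theorem orBot_locallyReduces {A A' : Cirquent} (h : orBot A = some A') : LocallyReduces A A' := by
  unfold orBot at h
  split at h <;> simp only [Option.some.injEq, reduceCtorEq] at h <;> subst h
  · exact ⟨(Nat.lt_add_of_pos_left Nat.one_pos).trans (lt_tower _),
      fun I e m ρ => by simp [Holds], fun k h => h.2⟩
  · exact ⟨(Nat.lt_succ_self _).trans (lt_tower _), fun I e m ρ => by simp [Holds],
      fun k h => h.1⟩

theorem orBot_provable {A A' : Cirquent} (h : orBot A = some A') (X : Ctx)
    (hp : Provable (X.fill A')) : Provable (X.fill A) := by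
  unfold orBot at h
  split at h <;> simp only [Option.some.injEq, reduceCtorEq] at h <;> subst h
  · exact .por_comm _ _ _ (.por_identity _ _ hp)
  · exact .por_identity _ _ hp

theorem andBot_locallyReduces {A A' : Cirquent} (h : andBot A = some A') : LocallyReduces A A' := by
  unfold andBot at h
  split at h <;> simp only [Option.some.injEq, reduceCtorEq] at h <;> subst h
  · exact ⟨(Nat.lt_add_of_pos_right (rank_pos _)).trans (lt_five_pow _),
      fun I e m ρ => by simp [Holds], fun k h => h.1⟩
  · exact ⟨(Nat.lt_add_of_pos_left (rank_pos _)).trans (lt_five_pow _),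
      fun I e m ρ => by simp [Holds], fun k h => h.2⟩

theorem andBot_provable {A A' : Cirquent} (h : andBot A = some A') (X : Ctx)
    (hp : Provable (X.fill A')) : Provable (X.fill A) := by
  unfold andBot at h
  split at h <;> simp only [Option.some.injEq, reduceCtorEq] at h <;> subst h
  · exact .pand_comm _ _ _ (.pand_domination _ _ hp)
  · exact .pand_domination _ _ hp

theorem stage1_reduces (E : Cirquent) :
    ((onSurface orBot E = none ∧ onSurface andBot E = none) ∧ stage1 E = E) ∨
      Reduces E (stage1 E) :=
  reduces_comp (p := fun E => onSurface orBot E = none) (q := fun E => onSurface andBot E = none)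
    (modify_reduces (fun _ _ => orBot_locallyReduces) fun X _ _ _ h => orBot_provable h X)
    (modify_reduces (fun _ _ => andBot_locallyReduces) fun X _ _ _ h => andBot_provable h X)

/-- The rank of a conjunction of disjunctions with a common disjunct; this is what makes the rank of
a disjunction a tower. -/
theorem rank_orAnd_lt {a b c : ℕ} (ha : 0 < a) (hb : 0 < b) :
    5 ^ (tower (a + c) + tower (b + c)) < tower (5 ^ (a + b) + c) := by
  obtain ⟨n, hn⟩ : ∃ n, a + b + c = n + 1 := ⟨a + b + c - 1, by omega⟩
  have h1 : tower (a + c) ≤ tower n := tower_strictMono.monotone (by omega)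
  have h2 : tower (b + c) ≤ tower n := tower_strictMono.monotone (by omega)
  have h3 := two_mul_tower_lt n
  have h4 := lt_five_pow (a + b)
  calc 5 ^ (tower (a + c) + tower (b + c)) < 5 ^ tower (n + 1) :=
        Nat.pow_lt_pow_right (by norm_num) (by omega)
    _ = tower (n + 1 + 1) := rfl
    _ ≤ tower (5 ^ (a + b) + c) := tower_strictMono.monotone (by omega)

theorem orAnd_locallyReduces {A A' : Cirquent} (h : orAnd A = some A') : LocallyReduces A A' := by
  unfold orAnd at h
  split at h <;> simp only [Option.some.injEq, reduceCtorEq] at h <;> subst h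
  · refine ⟨rank_orAnd_lt (rank_pos _) (rank_pos _), fun I e m ρ => ?_, fun k => ?_⟩
    · simp only [Holds]
      tauto
    · simp only [ClosedAt]
      tauto
  · refine ⟨?_, fun I e m ρ => ?_, fun k => ?_⟩
    · simp only [rank]
      rw [Nat.add_comm (rank _) (5 ^ _)]
      exact rank_orAnd_lt (rank_pos _) (rank_pos _)
    · simp only [Holds]
      tauto
    · simp only [ClosedAt]
      tauto

theorem orAnd_provable {A A' : Cirquent} (h : orAnd A = some A') (X : Ctx)
    (hp : Provable (X.fill A')) : Provable (X.fill A) := by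
  unfold orAnd at h
  split at h <;> simp only [Option.some.injEq, reduceCtorEq] at h <;> subst h
  · exact .pand_distribution _ _ _ _ hp
  · exact .por_comm _ _ _ (.pand_distribution _ _ _ _ hp)

theorem stage2_reduces (E : Cirquent) :
    (onSurface orAnd E = none ∧ stage2 E = E) ∨ Reduces E (stage2 E) :=
  modify_reduces (fun _ _ => orAnd_locallyReduces) fun X _ _ _ h => orAnd_provable h X

theorem rank_orChand_lt {a b c : ℕ} (ha : 0 < a) (hb : 0 < b) :
    tower (a + c) + tower (b + c) < tower (a + b + c) := by
  obtain ⟨n, hn⟩ : ∃ n, a + b + c = n + 1 := ⟨a + b + c - 1, by omega⟩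
  have h1 : tower (a + c) ≤ tower n := tower_strictMono.monotone (by omega)
  have h2 : tower (b + c) ≤ tower n := tower_strictMono.monotone (by omega)
  have h3 := two_mul_tower_lt n
  rw [hn]
  omega

theorem holds_orChand {I : ℕ → List ℕ → Prop} {e m : Moves} {ρ : ℕ → ℕ} {c : ℕ}
    {A B C : Cirquent} (h : Holds I e m (chand c A B) ρ ∨ Holds I e m C ρ) :
    Holds I e m (chand c (por A C) (por B C)) ρ := by
  rcases h with h | h
  · exact ⟨fun h0 => Or.inl (h.1 h0), fun v hv => Or.inl (h.2 v hv)⟩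
  · exact ⟨fun _ => Or.inr h, fun _ _ => Or.inr h⟩

theorem orChand_locallyReduces {A A' : Cirquent} (h : orChand A = some A') :
    LocallyReduces A A' := by
  unfold orChand at h
  split at h <;> simp only [Option.some.injEq, reduceCtorEq] at h <;> subst h
  · refine ⟨rank_orChand_lt (rank_pos _) (rank_pos _), fun I e m ρ => holds_orChand,
      fun k => ?_⟩
    simp only [ClosedAt]
    tauto
  · refine ⟨?_, fun I e m ρ h => holds_orChand h.symm, fun k => ?_⟩
    · simp only [rank]
      rw [Nat.add_comm (rank _) (rank _ + rank _)]
      exact rank_orChand_lt (rank_pos _) (rank_pos _)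
    · simp only [ClosedAt]
      tauto

theorem orChand_provable {A A' : Cirquent} (h : orChand A = some A') (X : Ctx)
    (hp : Provable (X.fill A')) : Provable (X.fill A) := by
  unfold orChand at h
  split at h <;> simp only [Option.some.injEq, reduceCtorEq] at h <;> subst h
  · exact .chand_distribution _ _ _ _ _ hp
  · exact .por_comm _ _ _ (.chand_distribution _ _ _ _ _ hp)

theorem holds_orChall {I : ℕ → List ℕ → Prop} {e m : Moves} {ρ : ℕ → ℕ} {c : ℕ}
    {A B : Cirquent} (h : Holds I e m (chall c A) ρ ∨ Holds I e m B ρ) :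
    Holds I e m (chall c (por A B.weaken)) ρ := by
  rcases h with h | h
  · exact fun a ha => Or.inl (h a ha)
  · exact fun a _ => Or.inr ((holds_weaken _ _ _).2 h)

theorem rank_orChall_lt (a b : ℕ) : tower (a + b) + 1 < tower (a + 1 + b) := by
  have h1 := two_mul_tower_lt (a + b)
  have h2 := tower_pos (a + b)
  rw [Nat.add_right_comm]
  omega

theorem orChall_locallyReduces {A A' : Cirquent} (h : orChall A = some A') :
    LocallyReduces A A' := by
  unfold orChall at h
  split at h <;> simp only [Option.some.injEq, reduceCtorEq] at h <;> subst h
  · refine ⟨?_, fun I e m ρ => holds_orChall, fun k h => ⟨h.1, closedAt_weaken h.2⟩⟩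
    simp only [rank, rank_weaken]
    exact rank_orChall_lt _ _
  · refine ⟨?_, fun I e m ρ h => holds_orChall h.symm, fun k h => ⟨h.2, closedAt_weaken h.1⟩⟩
    simp only [rank, rank_weaken]
    rw [Nat.add_comm (rank _) (rank _ + 1)]
    exact rank_orChall_lt _ _

theorem orChall_provable {A A' : Cirquent} (h : orChall A = some A') (X : Ctx)
    (hp : Provable (X.fill A')) : Provable (X.fill A) := by
  unfold orChall at h
  split at h <;> simp only [Option.some.injEq, reduceCtorEq] at h <;> subst h
  · exact .chall_distribution _ _ _ _ hp
  · exact .por_comm _ _ _ (.chall_distribution _ _ _ _ hp)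

theorem stage3_reduces (E : Cirquent) :
    ((onSurface orChand E = none ∧ onSurface orChall E = none) ∧ stage3 E = E) ∨
      Reduces E (stage3 E) :=
  reduces_comp (p := fun E => onSurface orChand E = none)
    (q := fun E => onSurface orChall E = none)
    (modify_reduces (fun _ _ => orChand_locallyReduces) fun X _ _ _ h => orChand_provable h X)
    (modify_reduces (fun _ _ => orChall_locallyReduces) fun X _ _ _ h => orChall_provable h X)

/-- `A` can be derived from `⊤` in every context. -/
def Trivializes (A : Cirquent) : Prop := ∀ X : Ctx, Provable (X.fill top) → Provable (X.fill A)

/-- `X.comp Y` is the context `X[Y]`. -/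
def Ctx.comp : Ctx → Ctx → Ctx
  | .hole, Y => Y
  | .pandL X B, Y => .pandL (X.comp Y) B
  | .pandR A X, Y => .pandR A (X.comp Y)
  | .porL X B, Y => .porL (X.comp Y) B
  | .porR A X, Y => .porR A (X.comp Y)
  | .chandL c X B, Y => .chandL c (X.comp Y) B
  | .chandR c A X, Y => .chandR c A (X.comp Y)
  | .chorL c X B, Y => .chorL c (X.comp Y) B
  | .chorR c A X, Y => .chorR c A (X.comp Y)
  | .chall c X, Y => .chall c (X.comp Y)
  | .chex c X, Y => .chex c (X.comp Y)

theorem Ctx.fill_comp (X Y : Ctx) (E : Cirquent) : (X.comp Y).fill E = X.fill (Y.fill E) := by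
  induction X <;> simp_all [Ctx.comp, Ctx.fill]

theorem Trivializes.comm {A B : Cirquent} (h : Trivializes (por A B)) : Trivializes (por B A) :=
  fun X hX => .por_comm X B A (h X hX)

theorem Trivializes.por_left {A : Cirquent} (h : Trivializes A) (B : Cirquent) :
    Trivializes (por A B) := fun X hX => by
  have := h (X.comp (.porL .hole B))
  rw [Ctx.fill_comp, Ctx.fill_comp] at this
  exact this (.por_comm X _ _ (.por_domination X B hX))

theorem Trivializes.por_right {B : Cirquent} (h : Trivializes B) (A : Cirquent) :
    Trivializes (por A B) := (h.por_left A).comm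

theorem Trivializes.assoc {A B C : Cirquent} (h : Trivializes (por A (por B C))) :
    Trivializes (por (por A B) C) := fun X hX => .por_assoc X A B C (h X hX)

/-- A disjunct can be brought to the front by commutativity and associativity. -/
theorem Trivializes.por_of_mem_disjuncts {D E Z : Cirquent} (hD : D ∈ disjuncts E)
    (h : Trivializes (por D Z)) : Trivializes (por E Z) := by
  induction E generalizing Z with
  | por A B ihA ihB =>
    have hrot : ∀ B, Trivializes (por D (por Z B)) := by
      intro B X hX
      -- from `B ∨ (D ∨ Z)`, through `(B ∨ D) ∨ Z`, `Z ∨ (B ∨ D)`, `(Z ∨ B) ∨ D`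
      exact .por_comm X _ _ (.por_assoc X _ _ _ (.por_comm X _ _ (.por_assoc X _ _ _
        (h.por_right B X hX))))
    have hrot' : ∀ B, Trivializes (por D (por B Z)) := by
      intro B X hX
      have := Provable.por_comm (X.comp (.porR D .hole)) B Z
      rw [Ctx.fill_comp, Ctx.fill_comp] at this
      exact this (hrot B X hX)
    rcases List.mem_append.1 hD with hD | hD
    · exact (ihA hD (hrot' B)).assoc
    · intro X hX
      have := Provable.por_comm (X.comp (.porL .hole Z)) A B
      rw [Ctx.fill_comp, Ctx.fill_comp] at this
      exact this ((ihB hD (hrot' A)).assoc X hX)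
  | _ =>
    obtain rfl := List.mem_singleton.1 hD
    exact h

theorem trivializes_of_mem_disjuncts {E : Cirquent} {p : ℕ} {ts : List Term}
    (h : atom p ts ∈ disjuncts E) (h' : natom p ts ∈ disjuncts E) : Trivializes E := by
  have key : Trivializes (por (natom p ts) (atom p ts)) := fun X hX => .trivialization X p ts hX
  induction E with
  | por A B ihA ihB =>
    rcases List.mem_append.1 h with h | h <;> rcases List.mem_append.1 h' with h' | h'
    · exact (ihA h h').por_left B
    · exact ((key.por_of_mem_disjuncts h').comm.por_of_mem_disjuncts h)
    · exact ((key.por_of_mem_disjuncts h').comm.por_of_mem_disjuncts h).comm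
    · exact (ihB h h').por_right A
  | _ =>
    have h1 := List.mem_singleton.1 h
    have h2 := List.mem_singleton.1 h'
    rw [← h1] at h2
    cases h2

theorem isOpposed_eq_true {l : List Cirquent} {E : Cirquent} :
    isOpposed l E = true ↔ ∃ p ts, E = atom p ts ∧ natom p ts ∈ l := by
  cases E <;> simp [isOpposed]

theorem orTrivial_eq_some {A A' : Cirquent} (h : orTrivial A = some A') :
    A' = top ∧ ∃ B C, A = por B C ∧
      ∃ p ts, atom p ts ∈ disjuncts A ∧ natom p ts ∈ disjuncts A := by
  unfold orTrivial at h
  split at h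
  · split_ifs at h with hany
    obtain rfl := Option.some.inj h
    obtain ⟨D, hD, ho⟩ := List.any_eq_true.1 hany
    obtain ⟨p, ts, rfl, hn⟩ := isOpposed_eq_true.1 ho
    exact ⟨rfl, _, _, rfl, p, ts, hD, hn⟩
  · cases h

theorem stage4_reduces (E : Cirquent) :
    (onSurface orTrivial E = none ∧ stage4 E = E) ∨ Reduces E (stage4 E) := by
  refine modify_reduces (fun A A' h => ?_) fun X A A' _ h hp => ?_
  · obtain ⟨rfl, B, C, rfl, -⟩ := orTrivial_eq_some h
    have := rank_pos B
    have := lt_tower (rank B + rank C)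
    exact ⟨by simp only [rank]; omega, fun _ _ _ _ _ => trivial, fun _ _ => trivial⟩
  · obtain ⟨rfl, B, C, -, p, ts, h1, h2⟩ := orTrivial_eq_some h
    exact trivializes_of_mem_disjuncts h1 h2 X hp

theorem orTop_locallyReduces {A A' : Cirquent} (h : orTop A = some A') : LocallyReduces A A' := by
  unfold orTop at h
  split at h <;> simp only [Option.some.injEq, reduceCtorEq] at h <;> subst h
  · exact ⟨(Nat.lt_add_of_pos_right (rank_pos _)).trans (lt_tower _),
      fun _ _ _ _ _ => trivial, fun _ _ => trivial⟩
  · exact ⟨(Nat.lt_add_of_pos_left (rank_pos _)).trans (lt_tower _),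
      fun _ _ _ _ _ => trivial, fun _ _ => trivial⟩

theorem orTop_provable {A A' : Cirquent} (h : orTop A = some A') (X : Ctx)
    (hp : Provable (X.fill A')) : Provable (X.fill A) := by
  unfold orTop at h
  split at h <;> simp only [Option.some.injEq, reduceCtorEq] at h <;> subst h
  · exact .por_comm _ _ _ (.por_domination _ _ hp)
  · exact .por_domination _ _ hp

theorem andTop_locallyReduces {A A' : Cirquent} (h : andTop A = some A') : LocallyReduces A A' := by
  unfold andTop at h
  split at h <;> simp only [Option.some.injEq, reduceCtorEq] at h <;> subst h
  · exact ⟨(Nat.lt_add_of_pos_left Nat.one_pos).trans (lt_five_pow _),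
      fun I e m ρ h => h.2, fun k h => h.2⟩
  · exact ⟨(Nat.lt_succ_self _).trans (lt_five_pow _), fun I e m ρ h => h.1,
      fun k h => h.1⟩

theorem andTop_provable {A A' : Cirquent} (h : andTop A = some A') (X : Ctx)
    (hp : Provable (X.fill A')) : Provable (X.fill A) := by
  unfold andTop at h
  split at h <;> simp only [Option.some.injEq, reduceCtorEq] at h <;> subst h
  · exact .pand_comm _ _ _ (.pand_identity _ _ hp)
  · exact .pand_identity _ _ hp

theorem stage5_reduces (E : Cirquent) :
    ((onSurface orTop E = none ∧ onSurface andTop E = none) ∧ stage5 E = E) ∨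
      Reduces E (stage5 E) :=
  reduces_comp (p := fun E => onSurface orTop E = none) (q := fun E => onSurface andTop E = none)
    (modify_reduces (fun _ _ => orTop_locallyReduces) fun X _ _ _ h => orTop_provable h X)
    (modify_reduces (fun _ _ => andTop_locallyReduces) fun X _ _ _ h => andTop_provable h X)

/-- Chotomy replaces one conjunction by up to four of smaller rank; this is why the base in the
rank of a conjunction exceeds `4`. -/
theorem four_mul_five_pow_lt {k k₁ k₂ k₃ k₄ : ℕ} (h₁ : k₁ < k) (h₂ : k₂ < k) (h₃ : k₃ < k)
    (h₄ : k₄ < k) : 5 ^ k₁ + 5 ^ k₂ + (5 ^ k₃ + 5 ^ k₄) < 5 ^ k := by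
  obtain ⟨n, rfl⟩ : ∃ n, k = n + 1 := ⟨k - 1, by omega⟩
  have h : ∀ {j : ℕ}, j < n + 1 → 5 ^ j ≤ 5 ^ n := fun h =>
    Nat.pow_le_pow_right (by norm_num) (Nat.le_of_lt_succ h)
  have := h h₁
  have := h h₂
  have := h h₃
  have := h h₄
  have := lt_five_pow n
  rw [pow_succ]
  omega

theorem andChandChand_locallyReduces {c : ℕ} {A A' : Cirquent}
    (h : andChandChand c A = some A') : LocallyReduces A A' := by
  unfold andChandChand at h
  split at h <;> simp only [Option.some.injEq, reduceCtorEq] at h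
  subst h
  rename_i a A B b C D
  have hA := rank_pos A
  have hB := rank_pos B
  have hC := rank_pos C
  have hD := rank_pos D
  refine ⟨four_mul_five_pow_lt ?_ ?_ ?_ ?_, fun I e m ρ => ?_, fun k => ?_⟩
  iterate 4
    simp only [rank]
    omega
  · simp only [Holds]
    tauto
  · simp only [ClosedAt]
    tauto

theorem andChallChall_locallyReduces {c : ℕ} {A A' : Cirquent}
    (h : andChallChall c A = some A') : LocallyReduces A A' := by
  unfold andChallChall at h
  split at h <;> simp only [Option.some.injEq, reduceCtorEq] at h
  subst h
  rename_i a A b B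
  have hA := rank_pos A
  refine ⟨?_, fun I e m ρ => ?_, fun k h => ?_⟩
  · have := four_mul_five_pow_lt (k := rank A + 1 + (rank B + 1)) (k₁ := rank A + (rank B + 1))
      (k₂ := rank A + 1 + rank B) (k₃ := 0) (k₄ := 0) (by omega) (by omega) (by omega) (by omega)
    simp only [rank, rank_weaken, pow_zero] at this ⊢
    omega
  · simp only [Holds, holds_weaken]
    exact fun h => ⟨fun _ x hx => ⟨h.1 x hx, h.2⟩, fun _ _ x hx => ⟨h.1, h.2 x hx⟩⟩
  · exact ⟨⟨h.1, closedAt_weaken h.2⟩, closedAt_weaken h.1, h.2⟩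

theorem andChandChall_cases {c : ℕ} {E E' : Cirquent} (h : andChandChall c E = some E') :
    ∃ a b A B C, (E = pand (chand a A B) (chall b C) ∨ E = pand (chall b C) (chand a A B)) ∧
      E' = chand c (chand a (pand A (chall b C)) (pand B (chall b C)))
        (chall b (pand (chand a A B).weaken C)) := by
  unfold andChandChall at h
  split at h <;> simp only [Option.some.injEq, reduceCtorEq] at h <;> subst h
  · exact ⟨_, _, _, _, _, Or.inl rfl, rfl⟩
  · exact ⟨_, _, _, _, _, Or.inr rfl, rfl⟩

theorem andChandChall_locallyReduces {c : ℕ} {A A' : Cirquent}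
    (h : andChandChall c A = some A') : LocallyReduces A A' := by
  obtain ⟨a, b, A, B, C, hE, rfl⟩ := andChandChall_cases h
  have hmain : LocallyReduces (pand (chand a A B) (chall b C))
      (chand c (chand a (pand A (chall b C)) (pand B (chall b C)))
        (chall b (pand (chand a A B).weaken C))) := by
    have hA := rank_pos A
    have hB := rank_pos B
    refine ⟨?_, fun I e m ρ => ?_, fun k h => ?_⟩
    · have := four_mul_five_pow_lt (k := rank A + rank B + (rank C + 1))
        (k₁ := rank A + (rank C + 1)) (k₂ := rank B + (rank C + 1))
        (k₃ := rank A + rank B + rank C) (k₄ := 0) (by omega) (by omega) (by omega) (by omega)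
      simp only [rank, rank_weaken, pow_zero] at this ⊢
      omega
    · simp only [Holds, holds_weaken]
      exact fun h => ⟨fun _ => ⟨fun hx => ⟨h.1.1 hx, h.2⟩, fun v hx => ⟨h.1.2 v hx, h.2⟩⟩,
        fun _ _ x hx => ⟨h.1, h.2 x hx⟩⟩
    · exact ⟨⟨⟨h.1.1, h.2⟩, h.1.2, h.2⟩, closedAt_weaken (A := chand a A B) h.1, h.2⟩
  rcases hE with rfl | rfl
  · exact hmain
  · refine ⟨?_, fun I e m ρ h => hmain.holds I e m ρ ⟨h.2, h.1⟩,
      fun k h => hmain.closed k ⟨h.2, h.1⟩⟩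
    have := hmain.rank_lt
    rw [rank, Nat.add_comm, ← rank] at this
    exact this

theorem mem_chandClusters_fill_congr (X : Ctx) {A B : Cirquent} {c : ℕ}
    (h : c ∈ A.chandClusters ↔ c ∈ B.chandClusters) :
    c ∈ (X.fill A).chandClusters ↔ c ∈ (X.fill B).chandClusters := by
  induction X <;> simp_all [Ctx.fill, chandClusters]

theorem stage6a_reduces (E : Cirquent) :
    (onSurface (andChandChand (freshCluster E)) E = none ∧ stage6a E = E) ∨
      Reduces E (stage6a E) := by
  refine modify_reduces (fun _ _ => andChandChand_locallyReduces) fun X A A' hE h hp => ?_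
  unfold andChandChand at h
  split at h <;> simp only [Option.some.injEq, reduceCtorEq] at h
  subst h
  exact .chandchotomy X _ _ _ _ _ _ _ (hE ▸ freshOf_notMem _) hp

theorem stage6b_reduces (E : Cirquent) :
    (onSurface (andChallChall (freshCluster E)) E = none ∧ stage6b E = E) ∨
      Reduces E (stage6b E) := by
  refine modify_reduces (fun _ _ => andChallChall_locallyReduces) fun X A A' hE h hp => ?_
  unfold andChallChall at h
  split at h <;> simp only [Option.some.injEq, reduceCtorEq] at h
  subst h
  exact .challchotomy X _ _ _ _ _ (hE ▸ freshOf_notMem _) hp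

theorem stage6c_reduces (E : Cirquent) :
    (onSurface (andChandChall (freshCluster E)) E = none ∧ stage6c E = E) ∨
      Reduces E (stage6c E) := by
  refine modify_reduces (fun _ _ => andChandChall_locallyReduces) fun X F F' hE h hp => ?_
  obtain ⟨a, b, A, B, C, hF, rfl⟩ := andChandChall_cases h
  have hfresh : freshCluster E ∉ (X.fill F).chandClusters := hE ▸ freshOf_notMem _
  rcases hF with rfl | rfl
  · exact .chandallchotomy X _ _ _ _ _ _ hfresh hp
  · refine .pand_comm X _ _ (.chandallchotomy X _ _ _ _ _ _ ?_ hp)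
    rwa [mem_chandClusters_fill_congr X (B := pand (chall b C) (chand a A B))]
    simp only [chandClusters, List.mem_append]
    exact or_comm

theorem stage6_reduces (E : Cirquent) :
    (((onSurface (andChandChand (freshCluster E)) E = none ∧
      onSurface (andChallChall (freshCluster E)) E = none) ∧
      onSurface (andChandChall (freshCluster E)) E = none) ∧ stage6 E = E) ∨
      Reduces E (stage6 E) :=
  reduces_comp (f := fun E => stage6b (stage6a E))
    (p := fun E => onSurface (andChandChand (freshCluster E)) E = none ∧
      onSurface (andChallChall (freshCluster E)) E = none)
    (q := fun E => onSurface (andChandChall (freshCluster E)) E = none)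
    (reduces_comp (p := fun E => onSurface (andChandChand (freshCluster E)) E = none)
      (q := fun E => onSurface (andChallChall (freshCluster E)) E = none)
      (stage6a_reduces E) (stage6b_reduces _)) (stage6c_reduces _)

/-! ### Stages 7 and 8 of Purification -/

theorem notMem_chandClusters_of_anywhere {r : ℕ → Cirquent → Option Cirquent} {c d : ℕ}
    {E : Cirquent} (hr : ∀ d A B, r d (chand c A B) ≠ none) (h : anywhere r d E = none) :
    c ∉ E.chandClusters := by
  induction E generalizing d with
  | top | bot | atom p ts | natom p ts => simp [chandClusters]
  | pand A B ihA ihB | por A B ihA ihB | chor a A B ihA ihB =>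
    simp only [anywhere, Option.orElse_eq_none, Option.map_eq_none_iff] at h
    simp only [chandClusters, List.mem_append, not_or]
    exact ⟨ihA h.2.1, ihB h.2.2⟩
  | chand a A B ihA ihB =>
    simp only [anywhere, Option.orElse_eq_none, Option.map_eq_none_iff] at h
    simp only [chandClusters, List.mem_append, List.mem_cons, not_or]
    refine ⟨?_, ihA h.2.1, ihB h.2.2⟩
    rintro rfl
    exact hr _ _ _ h.1
  | chall a A ih | chex a A ih =>
    simp only [anywhere, Option.orElse_eq_none, Option.map_eq_none_iff] at h
    exact ih h.2

theorem notMem_challClusters_of_anywhere {r : ℕ → Cirquent → Option Cirquent} {c d : ℕ}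
    {E : Cirquent} (hr : ∀ d A, r d (chall c A) ≠ none) (h : anywhere r d E = none) :
    c ∉ E.challClusters := by
  induction E generalizing d with
  | top | bot | atom p ts | natom p ts => simp [challClusters]
  | pand A B ihA ihB | por A B ihA ihB | chor a A B ihA ihB | chand a A B ihA ihB =>
    simp only [anywhere, Option.orElse_eq_none, Option.map_eq_none_iff] at h
    simp only [challClusters, List.mem_append, not_or]
    exact ⟨ihA h.2.1, ihB h.2.2⟩
  | chall a A ih =>
    simp only [anywhere, Option.orElse_eq_none, Option.map_eq_none_iff] at h
    simp only [challClusters, List.mem_cons, not_or]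
    refine ⟨?_, ih h.2⟩
    rintro rfl
    exact hr _ _ h.1
  | chex a A ih =>
    simp only [anywhere, Option.orElse_eq_none, Option.map_eq_none_iff] at h
    exact ih h.2

theorem pickLeft_reduces {c : ℕ} {A A' : Cirquent} (B : Cirquent)
    (h : anywhere (pickLeft c) 0 A = some A') : Reduces (chand c A B) (chand c A' B) := by
  obtain ⟨Y, S, S', rfl, rfl, hr⟩ := exists_ctx_of_anywhere h
  clear h
  unfold pickLeft at hr
  split at hr
  swap
  · cases hr
  rename_i a S₀ S₁
  split_ifs at hr with ha
  obtain rfl := Option.some.inj hr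
  subst ha
  refine ⟨rank_fill_lt (.chandL a Y B) (Nat.lt_add_of_pos_right (rank_pos S₁)),
    .left_chand_cleansing .hole Y a S₀ S₁ B, Valid.mono fun I e m ρ => And.imp_left ?_,
    closedAt_fill (.chandL a Y B) fun h => h.1⟩
  exact fun h h0 => holds_fill_mono Y ρ
    (fun ρ' _ (h : Holds I e m (chand a S₀ S₁) ρ') => h.1 h0) (h h0)

theorem pickRight_reduces {c : ℕ} {B B' : Cirquent} (A : Cirquent)
    (h : anywhere (pickRight c) 0 B = some B') : Reduces (chand c A B) (chand c A B') := by
  obtain ⟨Y, S, S', rfl, rfl, hr⟩ := exists_ctx_of_anywhere h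
  clear h
  unfold pickRight at hr
  split at hr
  swap
  · cases hr
  rename_i a S₀ S₁
  split_ifs at hr with ha
  obtain rfl := Option.some.inj hr
  subst ha
  refine ⟨rank_fill_lt (.chandR a A Y) (Nat.lt_add_of_pos_left (rank_pos S₀)),
    .right_chand_cleansing .hole Y a S₀ S₁ A, Valid.mono fun I e m ρ => And.imp_right ?_,
    closedAt_fill (.chandR a A Y) fun h => h.2⟩
  exact fun h v h1 => holds_fill_mono Y ρ
    (fun ρ' _ (h : Holds I e m (chand a S₀ S₁) ρ') => h.2 v h1) (h v h1)

theorem stage7_reduces (E : Cirquent) :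
    ((∀ c A B, E = chand c A B → c ∉ A.chandClusters ∧ c ∉ B.chandClusters) ∧ stage7 E = E) ∨
      Reduces E (stage7 E) := by
  cases E with
  | chand c A B =>
    simp only [stage7]
    rcases hA : anywhere (pickLeft c) 0 A with _ | A' <;>
      rcases hB : anywhere (pickRight c) 0 B with _ | B'
    · refine Or.inl ⟨?_, rfl⟩
      rintro c' A' B' h
      obtain ⟨rfl, rfl, rfl⟩ := Cirquent.chand.inj h
      exact ⟨notMem_chandClusters_of_anywhere (fun d A B => by simp [pickLeft]) hA,
        notMem_chandClusters_of_anywhere (fun d A B => by simp [pickRight]) hB⟩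
    · exact Or.inr (pickRight_reduces A hB)
    · exact Or.inr (pickLeft_reduces B hA)
    · exact Or.inr ((pickLeft_reduces B hA).trans (pickRight_reduces A' hB))
  | _ => exact Or.inl ⟨by simp, rfl⟩

theorem identify_reduces {c : ℕ} {A A' : Cirquent}
    (h : anywhere (identify c) 0 A = some A') : Reduces (chall c A) (chall c A') := by
  obtain ⟨Y, S, S', rfl, rfl, hr⟩ := exists_ctx_of_anywhere h
  clear h
  unfold identify at hr
  split at hr
  swap
  · cases hr
  rename_i a S₀
  split_ifs at hr with ha
  obtain rfl := Option.some.inj hr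
  subst ha
  rw [Nat.zero_add]
  refine ⟨rank_fill_lt (.chall a Y) ?_, .chall_cleansing .hole Y a S₀,
    fun hv => hv.mono fun I e m ρ h b hb => ?_, fun h => closedAt_fill (k := 1) Y ?_ h⟩
  · rw [rank_inst]
    exact Nat.lt_succ_self _
  · refine holds_fill_mono Y _ (fun ρ' hρ' h => ?_) (h b hb)
    have h0 : ρ' Y.depth = b := hρ' 0
    rw [holds_inst, Term.value, h0]
    exact h b hb
  · refine fun h => closedAt_inst ?_ h
    simp only [Term.ClosedAt]
    omega

theorem stage8_reduces (E : Cirquent) :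
    ((∀ c A, E = chall c A → c ∉ A.challClusters) ∧ stage8 E = E) ∨
      Reduces E (stage8 E) := by
  cases E with
  | chall c A =>
    simp only [stage8]
    rcases hA : anywhere (identify c) 0 A with _ | A'
    · refine Or.inl ⟨?_, rfl⟩
      rintro c' A' h
      obtain ⟨rfl, rfl⟩ := Cirquent.chall.inj h
      exact notMem_challClusters_of_anywhere (fun d A => by simp [identify]) hA
    · exact Or.inr (identify_reduces hA)
  | _ => exact Or.inl ⟨by simp, rfl⟩

/-! ### The loops of Purification -/

/-- The hypothesis says that `stage` reduces every cirquent that lacks the normal form `p`. -/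
theorem loop_spec {stage : Cirquent → Cirquent} {p : Cirquent → Prop}
    (hs : ∀ E, (p E ∧ stage E = E) ∨ Reduces E (stage E)) {n : ℕ} {E F : Cirquent}
    (h : loop stage n E = some F) : p F ∧ (F = E ∨ Reduces E F) := by
  induction n generalizing E with
  | zero => cases h
  | succ n ih =>
    rw [loop] at h
    rcases hs E with ⟨hp, hE⟩ | hE
    · rw [if_pos hE] at h
      obtain rfl := Option.some.inj h
      exact ⟨hp, Or.inl rfl⟩
    · rw [if_neg fun h => Reduces.irrefl E (by rwa [h] at hE)] at h
      obtain ⟨hp, hF⟩ := ih h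
      refine ⟨hp, Or.inr ?_⟩
      rcases hF with rfl | hF
      · exact hE
      · exact hE.trans hF

theorem loop_invariant {stage : Cirquent → Cirquent} {q : Cirquent → Prop}
    (hs : ∀ E, q E → q (stage E)) {n : ℕ} {E F : Cirquent} (h : loop stage n E = some F)
    (hE : q E) : q F := by
  induction n generalizing E with
  | zero => cases h
  | succ n ih =>
    rw [loop] at h
    split_ifs at h with hst
    · exact Option.some.inj h ▸ hE
    · exact ih h (hs E hE)

theorem exists_loop_eq_some {stage : Cirquent → Cirquent} {p : Cirquent → Prop}
    (hs : ∀ E, (p E ∧ stage E = E) ∨ Reduces E (stage E)) {n : ℕ} {E : Cirquent}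
    (h : rank E < n) : ∃ F, loop stage n E = some F ∧ rank F < n := by
  have hex : ∀ (n : ℕ) (E : Cirquent), rank E < n → ∃ F, loop stage n E = some F := by
    intro n
    induction n with
    | zero => exact fun E h => (Nat.not_lt_zero _ h).elim
    | succ n ih =>
      intro E h
      rw [loop]
      split_ifs with hst
      · exact ⟨E, rfl⟩
      · exact ih _ (((hs E).resolve_left fun h => hst h.2).rank_lt.trans_le (Nat.le_of_lt_succ h))
  obtain ⟨F, hF⟩ := hex n E h
  refine ⟨F, hF, ?_⟩
  rcases (loop_spec hs hF).2 with rfl | hr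
  · exact h
  · exact hr.rank_lt.trans h

theorem purify_eq_some {n : ℕ} {E F : Cirquent} : purify n E = some F ↔
    ∃ E₁, loop stage1 n E = some E₁ ∧ ∃ E₂, loop stage2 n E₁ = some E₂ ∧
      ∃ E₃, loop stage3 n E₂ = some E₃ ∧ ∃ E₄, loop stage4 n E₃ = some E₄ ∧
      ∃ E₅, loop stage5 n E₄ = some E₅ ∧ ∃ E₆, loop stage6 n E₅ = some E₆ ∧
      ∃ E₇, loop stage7 n E₆ = some E₇ ∧ loop stage8 n E₇ = some F := by
  simp [purify, Option.bind_eq_some_iff]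

theorem purify_reduces {n : ℕ} {E F : Cirquent} (h : purify n E = some F) :
    F = E ∨ Reduces E F := by
  have trans : ∀ {E F G : Cirquent}, (F = E ∨ Reduces E F) → (G = F ∨ Reduces F G) →
      (G = E ∨ Reduces E G) := by
    rintro E F G (rfl | h) (rfl | h')
    exacts [Or.inl rfl, Or.inr h', Or.inr h, Or.inr (h.trans h')]
  obtain ⟨E₁, h₁, E₂, h₂, E₃, h₃, E₄, h₄, E₅, h₅, E₆, h₆, E₇, h₇, h₈⟩ := purify_eq_some.1 h
  exact trans (loop_spec stage1_reduces h₁).2 <| trans (loop_spec stage2_reduces h₂).2 <|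
    trans (loop_spec stage3_reduces h₃).2 <| trans (loop_spec stage4_reduces h₄).2 <|
    trans (loop_spec stage5_reduces h₅).2 <| trans (loop_spec stage6_reduces h₆).2 <|
    trans (loop_spec stage7_reduces h₇).2 (loop_spec stage8_reduces h₈).2

theorem exists_purify_eq_some {n : ℕ} {E : Cirquent} (h : rank E < n) :
    ∃ F, purify n E = some F := by
  obtain ⟨E₁, h₁, h⟩ := exists_loop_eq_some stage1_reduces h
  obtain ⟨E₂, h₂, h⟩ := exists_loop_eq_some stage2_reduces h
  obtain ⟨E₃, h₃, h⟩ := exists_loop_eq_some stage3_reduces h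
  obtain ⟨E₄, h₄, h⟩ := exists_loop_eq_some stage4_reduces h
  obtain ⟨E₅, h₅, h⟩ := exists_loop_eq_some stage5_reduces h
  obtain ⟨E₆, h₆, h⟩ := exists_loop_eq_some stage6_reduces h
  obtain ⟨E₇, h₇, h⟩ := exists_loop_eq_some stage7_reduces h
  obtain ⟨F, h₈, -⟩ := exists_loop_eq_some stage8_reduces h
  exact ⟨F, purify_eq_some.2 ⟨E₁, h₁, E₂, h₂, E₃, h₃, E₄, h₄, E₅, h₅, E₆, h₆, E₇, h₇, h₈⟩⟩

/-! ### The form of purified cirquents -/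

theorem onSurface_pand_eq_none {r : Cirquent → Option Cirquent} {A B : Cirquent} :
    onSurface r (pand A B) = none ↔
      r (pand A B) = none ∧ onSurface r A = none ∧ onSurface r B = none := by
  simp only [onSurface, Option.orElse_eq_none, Option.map_eq_none_iff]

theorem onSurface_por_eq_none {r : Cirquent → Option Cirquent} {A B : Cirquent} :
    onSurface r (por A B) = none ↔
      r (por A B) = none ∧ onSurface r A = none ∧ onSurface r B = none := by
  simp only [onSurface, Option.orElse_eq_none, Option.map_eq_none_iff]

theorem onSurface_pand_eq_some {r : Cirquent → Option Cirquent} {A B E : Cirquent}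
    (h : onSurface r (pand A B) = some E) : r (pand A B) = some E ∨
      (∃ A', onSurface r A = some A' ∧ E = pand A' B) ∨
        ∃ B', onSurface r B = some B' ∧ E = pand A B' := by
  simp only [onSurface, Option.orElse_eq_some, Option.map_eq_some_iff] at h
  rcases h with h | ⟨-, ⟨A', h, rfl⟩ | ⟨-, B', h, rfl⟩⟩
  exacts [Or.inl h, Or.inr (Or.inl ⟨A', h, rfl⟩), Or.inr (Or.inr ⟨B', h, rfl⟩)]

theorem onSurface_por_eq_some {r : Cirquent → Option Cirquent} {A B E : Cirquent}
    (h : onSurface r (por A B) = some E) : r (por A B) = some E ∨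
      (∃ A', onSurface r A = some A' ∧ E = por A' B) ∨
        ∃ B', onSurface r B = some B' ∧ E = por A B' := by
  simp only [onSurface, Option.orElse_eq_some, Option.map_eq_some_iff] at h
  rcases h with h | ⟨-, ⟨A', h, rfl⟩ | ⟨-, B', h, rfl⟩⟩
  exacts [Or.inl h, Or.inr (Or.inl ⟨A', h, rfl⟩), Or.inr (Or.inr ⟨B', h, rfl⟩)]

/-- No surface conjunction has an immediate component in `bA`, and no surface disjunction has one
in `bO`. -/
def ChildFree (bA bO : Cirquent → Prop) : Cirquent → Prop
  | pand A B => (¬ bA A ∧ ¬ bA B) ∧ ChildFree bA bO A ∧ ChildFree bA bO B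
  | por A B => (¬ bO A ∧ ¬ bO B) ∧ ChildFree bA bO A ∧ ChildFree bA bO B
  | _ => True

/-- Whether a cirquent belongs to `b` depends on the operator at its root only, at least for
conjunctions and disjunctions. -/
def RootOnly (b : Cirquent → Prop) : Prop :=
  (∀ A B A' B', b (pand A B) → b (pand A' B')) ∧ ∀ A B A' B', b (por A B) → b (por A' B')

theorem ChildFree.modify {bA bO : Cirquent → Prop} {r : Cirquent → Option Cirquent}
    (hA : RootOnly bA) (hO : RootOnly bO)
    (hr : ∀ A A', r A = some A' → ChildFree bA bO A →
      ChildFree bA bO A' ∧ (¬ bA A → ¬ bA A') ∧ (¬ bO A → ¬ bO A'))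
    {E : Cirquent} (h : ChildFree bA bO E) : ChildFree bA bO (modify r E) := by
  have key : ∀ E E', onSurface r E = some E' → ChildFree bA bO E →
      ChildFree bA bO E' ∧ (¬ bA E → ¬ bA E') ∧ (¬ bO E → ¬ bO E') := by
    intro E
    induction E with
    | pand A B ihA ihB =>
      intro E' hE' h
      rcases onSurface_pand_eq_some hE' with hE' | ⟨A', hA', rfl⟩ | ⟨B', hB', rfl⟩
      · exact hr _ _ hE' h
      · obtain ⟨h1, h2, h3⟩ := ihA _ hA' h.2.1
        exact ⟨⟨⟨h2 h.1.1, h.1.2⟩, h1, h.2.2⟩, mt (hA.1 _ _ _ _), mt (hO.1 _ _ _ _)⟩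
      · obtain ⟨h1, h2, h3⟩ := ihB _ hB' h.2.2
        exact ⟨⟨⟨h.1.1, h2 h.1.2⟩, h.2.1, h1⟩, mt (hA.1 _ _ _ _), mt (hO.1 _ _ _ _)⟩
    | por A B ihA ihB =>
      intro E' hE' h
      rcases onSurface_por_eq_some hE' with hE' | ⟨A', hA', rfl⟩ | ⟨B', hB', rfl⟩
      · exact hr _ _ hE' h
      · obtain ⟨h1, h2, h3⟩ := ihA _ hA' h.2.1
        exact ⟨⟨⟨h3 h.1.1, h.1.2⟩, h1, h.2.2⟩, mt (hA.2 _ _ _ _), mt (hO.2 _ _ _ _)⟩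
      · obtain ⟨h1, h2, h3⟩ := ihB _ hB' h.2.2
        exact ⟨⟨⟨h.1.1, h3 h.1.2⟩, h.2.1, h1⟩, mt (hA.2 _ _ _ _), mt (hO.2 _ _ _ _)⟩
    | _ => exact fun E' hE' h => hr _ _ hE' h
  rw [Cirquent.modify]
  rcases hE : onSurface r E with _ | E'
  · exact h
  · exact (key E E' hE h).1

/-- Every modification of the stages 3 to 6 other than the deletion of a conjunct `⊤` results in a
cirquent of one of these forms. -/
def Collapsed (E : Cirquent) : Prop :=
  E = top ∨ (∃ c A B, E = chand c A B) ∨ ∃ c A, E = chall c A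

theorem Collapsed.childFree {bA bO : Cirquent → Prop} {E : Cirquent} (h : Collapsed E) :
    ChildFree bA bO E := by
  rcases h with rfl | ⟨c, A, B, rfl⟩ | ⟨c, A, rfl⟩ <;> trivial

theorem orChand_collapsed {A A' : Cirquent} (h : orChand A = some A') : Collapsed A' := by
  unfold orChand at h
  split at h <;> simp only [Option.some.injEq, reduceCtorEq] at h <;> subst h <;>
    exact Or.inr (Or.inl ⟨_, _, _, rfl⟩)

theorem orChall_collapsed {A A' : Cirquent} (h : orChall A = some A') : Collapsed A' := by
  unfold orChall at h
  split at h <;> simp only [Option.some.injEq, reduceCtorEq] at h <;> subst h <;>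
    exact Or.inr (Or.inr ⟨_, _, rfl⟩)

theorem orTrivial_eq_top {A A' : Cirquent} (h : orTrivial A = some A') : A' = top :=
  (orTrivial_eq_some h).1

theorem orTop_eq_top {A A' : Cirquent} (h : orTop A = some A') : A' = top := by
  unfold orTop at h
  split at h <;> simp only [Option.some.injEq, reduceCtorEq] at h <;> exact h.symm

theorem andTop_eq_some {A A' : Cirquent} (h : andTop A = some A') :
    A = pand top A' ∨ A = pand A' top := by
  unfold andTop at h
  split at h <;> simp only [Option.some.injEq, reduceCtorEq] at h <;> subst h
  exacts [Or.inl rfl, Or.inr rfl]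

/-- The modifications of stage 6 turn a conjunction into a choice conjunction. -/
def IsChotomy (r : Cirquent → Option Cirquent) : Prop :=
  ∀ A A', r A = some A' → (∃ B C, A = pand B C) ∧ ∃ c B C, A' = chand c B C

theorem isChotomy_andChandChand (c : ℕ) : IsChotomy (andChandChand c) := by
  intro A A' h
  unfold andChandChand at h
  split at h <;> simp only [Option.some.injEq, reduceCtorEq] at h
  exact ⟨⟨_, _, rfl⟩, _, _, _, h.symm⟩

theorem isChotomy_andChallChall (c : ℕ) : IsChotomy (andChallChall c) := by
  intro A A' h
  unfold andChallChall at h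
  split at h <;> simp only [Option.some.injEq, reduceCtorEq] at h
  exact ⟨⟨_, _, rfl⟩, _, _, _, h.symm⟩

theorem isChotomy_andChandChall (c : ℕ) : IsChotomy (andChandChall c) := by
  intro A A' h
  obtain ⟨a, b, A, B, C, hE, rfl⟩ := andChandChall_cases h
  rcases hE with rfl | rfl <;> exact ⟨⟨_, _, rfl⟩, _, _, _, rfl⟩

theorem stage6_invariant {q : Cirquent → Prop}
    (hq : ∀ r E, IsChotomy r → q E → q (modify r E)) {E : Cirquent} (h : q E) : q (stage6 E) :=
  hq _ _ (isChotomy_andChandChall _) <| hq _ _ (isChotomy_andChallChall _) <|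
    hq _ _ (isChotomy_andChandChand _) h

def IsBot (E : Cirquent) : Prop := E = bot

def IsTop (E : Cirquent) : Prop := E = top

def IsPand (E : Cirquent) : Prop := ∃ A B, E = pand A B

/-- The cirquents that may not be disjuncts after stage 3. -/
def IsAndLike (E : Cirquent) : Prop :=
  IsPand E ∨ (∃ c A B, E = chand c A B) ∨ ∃ c A, E = chall c A

theorem rootOnly_isBot : RootOnly IsBot := by simp [RootOnly, IsBot]

theorem rootOnly_isTop : RootOnly IsTop := by simp [RootOnly, IsTop]

theorem rootOnly_false : RootOnly fun _ => False := by simp [RootOnly]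

theorem rootOnly_isPand : RootOnly IsPand := by simp [RootOnly, IsPand]

theorem rootOnly_isAndLike : RootOnly IsAndLike := by simp [RootOnly, IsAndLike, IsPand]

theorem Collapsed.not_isBot {E : Cirquent} (h : Collapsed E) : ¬ IsBot E := by
  rcases h with rfl | ⟨c, A, B, rfl⟩ | ⟨c, A, rfl⟩ <;> simp [IsBot]

theorem Collapsed.not_isPand {E : Cirquent} (h : Collapsed E) : ¬ IsPand E := by
  rcases h with rfl | ⟨c, A, B, rfl⟩ | ⟨c, A, rfl⟩ <;> simp [IsPand]

theorem childFree_isBot_modify {r : Cirquent → Option Cirquent}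
    (hr : ∀ A A', r A = some A' → Collapsed A') {E : Cirquent} (h : ChildFree IsBot IsBot E) :
    ChildFree IsBot IsBot (modify r E) :=
  h.modify rootOnly_isBot rootOnly_isBot fun A A' hA _ =>
    ⟨(hr A A' hA).childFree, fun _ => (hr A A' hA).not_isBot, fun _ => (hr A A' hA).not_isBot⟩

theorem IsChotomy.collapsed {r : Cirquent → Option Cirquent} (hr : IsChotomy r)
    (A A' : Cirquent) (h : r A = some A') : Collapsed A' :=
  Or.inr (Or.inl (hr A A' h).2)

theorem stage1_childFree {E : Cirquent} (h : onSurface orBot E = none)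
    (h' : onSurface andBot E = none) : ChildFree IsBot IsBot E := by
  induction E with
  | pand A B ihA ihB =>
    rw [onSurface_pand_eq_none] at h h'
    refine ⟨⟨?_, ?_⟩, ihA h.2.1 h'.2.1, ihB h.2.2 h'.2.2⟩
    · rintro rfl
      simp [andBot] at h'
    · rintro rfl
      have h1 := h'.1
      unfold andBot at h1
      split at h1 <;> simp_all
  | por A B ihA ihB =>
    rw [onSurface_por_eq_none] at h h'
    refine ⟨⟨?_, ?_⟩, ihA h.2.1 h'.2.1, ihB h.2.2 h'.2.2⟩
    · rintro rfl
      simp [orBot] at h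
    · rintro rfl
      have h1 := h.1
      unfold orBot at h1
      split at h1 <;> simp_all
  | _ => trivial

theorem stage2_childFree {E : Cirquent} (h : onSurface orAnd E = none) :
    ChildFree (fun _ => False) IsPand E := by
  induction E with
  | pand A B ihA ihB =>
    rw [onSurface_pand_eq_none] at h
    exact ⟨⟨id, id⟩, ihA h.2.1, ihB h.2.2⟩
  | por A B ihA ihB =>
    rw [onSurface_por_eq_none] at h
    refine ⟨⟨?_, ?_⟩, ihA h.2.1, ihB h.2.2⟩
    · rintro ⟨_, _, rfl⟩
      simp [orAnd] at h
    · rintro ⟨_, _, rfl⟩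
      have h1 := h.1
      unfold orAnd at h1
      split at h1 <;> simp_all
  | _ => trivial

theorem stage3_childFree {E : Cirquent} (h₂ : ChildFree (fun _ => False) IsPand E)
    (h : onSurface orChand E = none) (h' : onSurface orChall E = none) :
    ChildFree (fun _ => False) IsAndLike E := by
  induction E with
  | pand A B ihA ihB =>
    rw [onSurface_pand_eq_none] at h h'
    exact ⟨⟨id, id⟩, ihA h₂.2.1 h.2.1 h'.2.1, ihB h₂.2.2 h.2.2 h'.2.2⟩
  | por A B ihA ihB =>
    rw [onSurface_por_eq_none] at h h'
    refine ⟨⟨?_, ?_⟩, ihA h₂.2.1 h.2.1 h'.2.1, ihB h₂.2.2 h.2.2 h'.2.2⟩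
    · rintro (hp | ⟨_, _, _, rfl⟩ | ⟨_, _, rfl⟩)
      · exact h₂.1.1 hp
      · simp [orChand] at h
      · simp [orChall] at h'
    · rintro (hp | ⟨_, _, _, rfl⟩ | ⟨_, _, rfl⟩)
      · exact h₂.1.2 hp
      · have h1 := h.1
        unfold orChand at h1
        split at h1
        · cases h1
        · cases h1
        · rename_i hno
          exact hno _ _ _ _ rfl
      · have h1 := h'.1
        unfold orChall at h1
        split at h1
        · cases h1
        · cases h1
        · rename_i hno
          exact hno _ _ _ rfl
  | _ => trivial

theorem stage5_childFree {E : Cirquent} (h : onSurface orTop E = none)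
    (h' : onSurface andTop E = none) : ChildFree IsTop IsTop E := by
  induction E with
  | pand A B ihA ihB =>
    rw [onSurface_pand_eq_none] at h h'
    refine ⟨⟨?_, ?_⟩, ihA h.2.1 h'.2.1, ihB h.2.2 h'.2.2⟩
    · rintro rfl
      simp [andTop] at h'
    · rintro rfl
      have h1 := h'.1
      unfold andTop at h1
      split at h1 <;> simp_all
  | por A B ihA ihB =>
    rw [onSurface_por_eq_none] at h h'
    refine ⟨⟨?_, ?_⟩, ihA h.2.1 h'.2.1, ihB h.2.2 h'.2.2⟩
    · rintro rfl
      simp [orTop] at h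
    · rintro rfl
      have h1 := h.1
      unfold orTop at h1
      split at h1 <;> simp_all
  | _ => trivial

/-- No disjunction among the conjuncts of `E` contains an atom together with its negation. -/
def Unopposed (E : Cirquent) : Prop :=
  ∀ B ∈ conjuncts E, ∀ p ts, atom p ts ∈ disjuncts B → natom p ts ∉ disjuncts B

theorem unopposed_pand {A B : Cirquent} : Unopposed (pand A B) ↔ Unopposed A ∧ Unopposed B := by
  simp only [Unopposed, conjuncts, List.mem_append, or_imp, forall_and]

theorem unopposed_of_disjuncts_eq {E : Cirquent} (hc : conjuncts E = [E])
    (hd : disjuncts E = [E]) : Unopposed E := by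
  intro B hB p ts h h'
  rw [hc, List.mem_singleton] at hB
  subst hB
  rw [hd, List.mem_singleton] at h h'
  rw [← h] at h'
  cases h'

theorem stage4_unopposed {E : Cirquent} (h : onSurface orTrivial E = none) : Unopposed E := by
  induction E with
  | pand A B ihA ihB =>
    rw [onSurface_pand_eq_none] at h
    exact unopposed_pand.2 ⟨ihA h.2.1, ihB h.2.2⟩
  | por A B _ _ =>
    rw [onSurface_por_eq_none] at h
    intro C hC p ts h1 h2
    obtain rfl := List.mem_singleton.1 hC
    have h0 := h.1
    simp only [orTrivial, ite_eq_right_iff, reduceCtorEq, imp_false] at h0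
    exact h0 (List.any_eq_true.2 ⟨_, h1, isOpposed_eq_true.2 ⟨p, ts, rfl, h2⟩⟩)
  | _ => exact unopposed_of_disjuncts_eq rfl rfl

/-- Atoms and negated atoms; `⊤` and `⊥` are not counted as literals here. -/
def IsLiteral (E : Cirquent) : Prop := ∃ p ts, E = atom p ts ∨ E = natom p ts

theorem Unopposed.modify {r : Cirquent → Option Cirquent}
    (hr : ∀ A A', r A = some A' → Unopposed A → Unopposed A')
    (hd : ∀ A A' D, r A = some A' → IsLiteral D → D ∈ disjuncts A' → D ∈ disjuncts A)
    {E : Cirquent} (h : Unopposed E) : Unopposed (modify r E) := by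
  have key' : ∀ E E' D, onSurface r E = some E' → IsLiteral D → D ∈ disjuncts E' →
      D ∈ disjuncts E := by
    intro E
    induction E with
    | pand A B _ _ =>
      intro E' D hE' hD h
      rcases onSurface_pand_eq_some hE' with hE' | ⟨A', _, rfl⟩ | ⟨B', _, rfl⟩
      · exact hd _ _ _ hE' hD h
      all_goals
        obtain rfl := List.mem_singleton.1 h
        obtain ⟨p, ts, h | h⟩ := hD <;> cases h
    | por A B ihA ihB =>
      intro E' D hE' hD h
      rcases onSurface_por_eq_some hE' with hE' | ⟨A', hA', rfl⟩ | ⟨B', hB', rfl⟩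
      · exact hd _ _ _ hE' hD h
      · exact List.mem_append.2 ((List.mem_append.1 h).imp_left (ihA _ _ hA' hD))
      · exact List.mem_append.2 ((List.mem_append.1 h).imp_right (ihB _ _ hB' hD))
    | _ => exact fun E' D hE' => hd _ _ D hE'
  have key : ∀ E E', onSurface r E = some E' → Unopposed E → Unopposed E' := by
    intro E
    induction E with
    | pand A B ihA ihB =>
      intro E' hE' h
      rcases onSurface_pand_eq_some hE' with hE' | ⟨A', hA', rfl⟩ | ⟨B', hB', rfl⟩
      · exact hr _ _ hE' h
      · exact unopposed_pand.2 ((unopposed_pand.1 h).imp_left (ihA _ hA'))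
      · exact unopposed_pand.2 ((unopposed_pand.1 h).imp_right (ihB _ hB'))
    | por A B _ _ =>
      intro E' hE' h
      have hsub := fun D => key' _ _ D hE'
      rcases onSurface_por_eq_some hE' with hE' | ⟨A', _, rfl⟩ | ⟨B', _, rfl⟩
      · exact hr _ _ hE' h
      all_goals
        intro C hC p ts h1 h2
        obtain rfl := List.mem_singleton.1 hC
        exact h _ (List.mem_singleton.2 rfl) p ts (hsub _ ⟨p, ts, Or.inl rfl⟩ h1)
          (hsub _ ⟨p, ts, Or.inr rfl⟩ h2)
    | _ => exact fun E' hE' h => hr _ _ hE' h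
  rw [Cirquent.modify]
  rcases hE : onSurface r E with _ | E'
  · exact h
  · exact key E E' hE h

theorem Collapsed.unopposed {E : Cirquent} (h : Collapsed E) : Unopposed E := by
  rcases h with rfl | ⟨c, A, B, rfl⟩ | ⟨c, A, rfl⟩ <;> exact unopposed_of_disjuncts_eq rfl rfl

theorem Collapsed.notMem_disjuncts {E D : Cirquent} (h : Collapsed E) (hD : IsLiteral D) :
    D ∉ disjuncts E := by
  obtain ⟨p, ts, rfl | rfl⟩ := hD <;>
    rcases h with rfl | ⟨c, A, B, rfl⟩ | ⟨c, A, rfl⟩ <;> simp [disjuncts]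

theorem unopposed_modify_of_collapsed {r : Cirquent → Option Cirquent}
    (hr : ∀ A A', r A = some A' → Collapsed A') {E : Cirquent} (h : Unopposed E) :
    Unopposed (modify r E) :=
  h.modify (fun A A' hA _ => (hr A A' hA).unopposed)
    fun A A' _ hA hD h => ((hr A A' hA).notMem_disjuncts hD h).elim

theorem onSurface_andTop_of_not_isPand {E : Cirquent}
    (h : ChildFree (fun _ => False) IsAndLike E) (hE : ¬ IsPand E) :
    onSurface andTop E = none := by
  induction E with
  | pand A B _ _ => exact (hE ⟨A, B, rfl⟩).elim
  | por A B ihA ihB =>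
    exact onSurface_por_eq_none.2 ⟨rfl, ihA h.2.1 fun hA => h.1.1 (Or.inl hA),
      ihB h.2.2 fun hB => h.1.2 (Or.inl hB)⟩
  | _ => rfl

theorem unopposed_modify_andTop {E : Cirquent} (hE : ChildFree (fun _ => False) IsAndLike E)
    (h : Unopposed E) : Unopposed (modify andTop E) := by
  have key : ∀ E E', onSurface andTop E = some E' → ChildFree (fun _ => False) IsAndLike E →
      Unopposed E → Unopposed E' := by
    intro E
    induction E with
    | pand A B ihA ihB =>
      intro E' hE' hc h
      rcases onSurface_pand_eq_some hE' with hE' | ⟨A', hA', rfl⟩ | ⟨B', hB', rfl⟩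
      · rcases andTop_eq_some hE' with h' | h' <;> rw [h', unopposed_pand] at h
        exacts [h.2, h.1]
      · exact unopposed_pand.2 ((unopposed_pand.1 h).imp_left (ihA _ hA' hc.2.1))
      · exact unopposed_pand.2 ((unopposed_pand.1 h).imp_right (ihB _ hB' hc.2.2))
    | _ =>
      intro E' hE' hc
      rw [onSurface_andTop_of_not_isPand hc (by simp [IsPand])] at hE'
      cases hE'
  rw [Cirquent.modify]
  rcases hE' : onSurface andTop E with _ | E'
  · exact h
  · exact key E E' hE' hE h

/-- After stage 6, a conjunction has a conjunct that is not `⊓`- or `∀`-rooted. -/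
theorem exists_conjunct_of_stage6 {E : Cirquent} {a b c : ℕ}
    (ha : onSurface (andChandChand a) E = none) (hb : onSurface (andChallChall b) E = none)
    (hc : onSurface (andChandChall c) E = none) (hE : IsPand E) :
    ∃ C ∈ conjuncts E, notChandChallRooted C = true := by
  induction E with
  | pand A B ihA ihB =>
    rw [onSurface_pand_eq_none] at ha hb hc
    by_cases hA : IsPand A
    · obtain ⟨C, hC, h⟩ := ihA ha.2.1 hb.2.1 hc.2.1 hA
      exact ⟨C, List.mem_append_left _ hC, h⟩
    by_cases hB : IsPand B
    · obtain ⟨C, hC, h⟩ := ihB ha.2.2 hb.2.2 hc.2.2 hB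
      exact ⟨C, List.mem_append_right _ hC, h⟩
    have hconj : ∀ {D : Cirquent}, ¬ IsPand D → conjuncts D = [D] := by
      intro D hD
      cases D with
      | pand A B => exact (hD ⟨A, B, rfl⟩).elim
      | _ => rfl
    by_contra! hcon
    have h1 := hcon A (by simp [conjuncts, hconj hA])
    have h2 := hcon B (by simp [conjuncts, hconj hB])
    unfold notChandChallRooted at h1 h2
    split at h1 <;> split at h2 <;>
      simp_all [andChandChand, andChallChall, andChandChall]
  | _ =>
    obtain ⟨A, B, h⟩ := hE
    cases h

/-- A disjunction (or a single cirquent) whose truth requires a choice by the machine: all disjuncts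
are literals (in the sense of `IsLiteral`) or are rooted in `⊔` or `∃`, and no two of them are
opposite. -/
structure IsFlat (B : Cirquent) : Prop where
  disjunct : ∀ D ∈ disjuncts B, IsLiteral D ∨ (∃ c X Y, D = chor c X Y) ∨ ∃ c X, D = chex c X
  unopposed : ∀ p ts, atom p ts ∈ disjuncts B → natom p ts ∉ disjuncts B

/-- The normal form that Purification achieves: a cluster at the root does not occur below it, and
a conjunction or disjunction puts the cirquent in which DECISION chooses into flat form. -/
structure IsPure (F : Cirquent) : Prop where
  chand : ∀ c A B, F = chand c A B → c ∉ A.chandClusters ∧ c ∉ B.chandClusters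
  chall : ∀ c A, F = chall c A → c ∉ A.challClusters
  por : ∀ A B, F = por A B → IsFlat F
  pand : ∀ A B, F = pand A B → ∃ C ∈ conjuncts F,
    (conjuncts F).find? notChandChallRooted = some C ∧ IsFlat C

theorem ChildFree.of_mem_conjuncts {bA bO : Cirquent → Prop} {E C : Cirquent}
    (h : ChildFree bA bO E) (hC : C ∈ conjuncts E) :
    ChildFree bA bO C ∧ ¬ IsPand C ∧ (IsPand E → ¬ bA C) := by
  induction E with
  | pand A B ihA ihB =>
    have hone : ∀ {D : Cirquent}, C ∈ conjuncts D → ¬ IsPand D → C = D := by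
      intro D hC hD
      cases D with
      | pand A B => exact (hD ⟨A, B, rfl⟩).elim
      | _ => exact List.mem_singleton.1 hC
    rcases List.mem_append.1 hC with hC | hC
    · refine ⟨(ihA h.2.1 hC).1, (ihA h.2.1 hC).2.1, fun _ => ?_⟩
      by_cases hA : IsPand A
      · exact (ihA h.2.1 hC).2.2 hA
      · rw [hone hC hA]
        exact h.1.1
    · refine ⟨(ihB h.2.2 hC).1, (ihB h.2.2 hC).2.1, fun _ => ?_⟩
      by_cases hB : IsPand B
      · exact (ihB h.2.2 hC).2.2 hB
      · rw [hone hC hB]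
        exact h.1.2
  | _ =>
    obtain rfl := List.mem_singleton.1 hC
    exact ⟨h, by simp [IsPand], by simp [IsPand]⟩

theorem ChildFree.of_mem_disjuncts {bA bO : Cirquent → Prop} {E D : Cirquent}
    (h : ChildFree bA bO E) (hE : ¬ bO E) (hD : D ∈ disjuncts E) : ¬ bO D := by
  induction E with
  | por A B ihA ihB =>
    rcases List.mem_append.1 hD with hD | hD
    · exact ihA h.2.1 h.1.1 hD
    · exact ihB h.2.2 h.1.2 hD
  | _ =>
    obtain rfl := List.mem_singleton.1 hD
    exact hE

theorem not_por_of_mem_disjuncts {E A B : Cirquent} : Cirquent.por A B ∉ disjuncts E := by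
  induction E with
  | por C D ihC ihD => simp [disjuncts, ihC, ihD]
  | _ => simp [disjuncts]

theorem isFlat_of_childFree {C : Cirquent} (hb : ChildFree IsBot IsBot C)
    (ht : ChildFree IsTop IsTop C) (ha : ChildFree (fun _ => False) IsAndLike C)
    (hu : ∀ p ts, atom p ts ∈ disjuncts C → natom p ts ∉ disjuncts C) (hb' : ¬ IsBot C)
    (ht' : ¬ IsTop C) (ha' : ¬ IsAndLike C) : IsFlat C := by
  refine ⟨fun D hD => ?_, hu⟩
  have h1 := hb.of_mem_disjuncts hb' hD
  have h2 := ht.of_mem_disjuncts ht' hD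
  have h3 := ha.of_mem_disjuncts ha' hD
  cases D with
  | top => exact (h2 rfl).elim
  | bot => exact (h1 rfl).elim
  | atom p ts => exact Or.inl ⟨p, ts, Or.inl rfl⟩
  | natom p ts => exact Or.inl ⟨p, ts, Or.inr rfl⟩
  | pand A B => exact (h3 (Or.inl ⟨A, B, rfl⟩)).elim
  | por A B => exact (not_por_of_mem_disjuncts hD).elim
  | chand c A B => exact (h3 (Or.inr (Or.inl ⟨c, A, B, rfl⟩))).elim
  | chor c A B => exact Or.inr (Or.inl ⟨c, A, B, rfl⟩)
  | chall c A => exact (h3 (Or.inr (Or.inr ⟨c, A, rfl⟩))).elim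
  | chex c A => exact Or.inr (Or.inr ⟨c, A, rfl⟩)

theorem stage7_invariant {q : Cirquent → Prop} (hq : ∀ c A B, q (chand c A B)) {E : Cirquent}
    (h : q E) : q (stage7 E) := by
  cases E <;> first | exact hq _ _ _ | exact h

theorem stage8_invariant {q : Cirquent → Prop} (hq : ∀ c A, q (chall c A)) {E : Cirquent}
    (h : q E) : q (stage8 E) := by
  cases E <;> first | exact hq _ _ | exact h

/-- Each clause of the normal form is reached by one of the stages and preserved by the later ones. -/
theorem isPure_of_purify {n : ℕ} {E F : Cirquent} (h : purify n E = some F) : IsPure F := by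
  obtain ⟨E₁, l₁, E₂, l₂, E₃, l₃, E₄, l₄, E₅, l₅, E₆, l₆, E₇, l₇, l₈⟩ := purify_eq_some.1 h
  -- no component `⊥`
  have b₁ : ChildFree IsBot IsBot E₁ :=
    stage1_childFree (loop_spec stage1_reduces l₁).1.1 (loop_spec stage1_reduces l₁).1.2
  have b₂ : ChildFree IsBot IsBot E₂ := by
    refine loop_invariant (fun E hE => hE.modify rootOnly_isBot rootOnly_isBot
      fun A A' hA hc => ?_) l₂ b₁
    unfold orAnd at hA
    split at hA <;> simp only [Option.some.injEq, reduceCtorEq] at hA <;> subst hA <;>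
      simp_all [ChildFree, IsBot]
  have b₃ : ChildFree IsBot IsBot E₃ :=
    loop_invariant (fun E hE => childFree_isBot_modify (fun _ _ => orChall_collapsed)
      (childFree_isBot_modify (fun _ _ => orChand_collapsed) hE)) l₃ b₂
  have b₄ : ChildFree IsBot IsBot E₄ :=
    loop_invariant (fun E hE => childFree_isBot_modify
      (fun _ _ hA => Or.inl (orTrivial_eq_top hA)) hE) l₄ b₃
  have b₅ : ChildFree IsBot IsBot E₅ := by
    refine loop_invariant (fun E hE => ChildFree.modify rootOnly_isBot rootOnly_isBot
      (fun A A' hA hc => ?_)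
      (childFree_isBot_modify (fun _ _ hA => Or.inl (orTop_eq_top hA)) hE)) l₅ b₄
    rcases andTop_eq_some hA with rfl | rfl
    · exact ⟨hc.2.2, fun _ => hc.1.2, fun _ => hc.1.2⟩
    · exact ⟨hc.2.1, fun _ => hc.1.1, fun _ => hc.1.1⟩
  have b₆ : ChildFree IsBot IsBot E₆ :=
    loop_invariant (fun E => stage6_invariant fun r E hr => childFree_isBot_modify hr.collapsed)
      l₆ b₅
  -- no disjunct rooted in `∧`, `⊓` or `∀`
  have a₂ : ChildFree (fun _ => False) IsPand E₂ :=
    stage2_childFree (loop_spec stage2_reduces l₂).1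
  have a₃' : ChildFree (fun _ => False) IsPand E₃ := by
    have step : ∀ {r : Cirquent → Option Cirquent} {E : Cirquent},
        (∀ A A', r A = some A' → Collapsed A') → ChildFree (fun _ => False) IsPand E →
        ChildFree (fun _ => False) IsPand (modify r E) := fun hr hE =>
      hE.modify rootOnly_false rootOnly_isPand fun A A' hA _ =>
        ⟨(hr A A' hA).childFree, fun _ => id, fun _ => (hr A A' hA).not_isPand⟩
    exact loop_invariant (fun E hE => step (fun _ _ => orChall_collapsed)
      (step (fun _ _ => orChand_collapsed) hE)) l₃ a₂
  have a₃ : ChildFree (fun _ => False) IsAndLike E₃ :=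
    stage3_childFree a₃' (loop_spec stage3_reduces l₃).1.1 (loop_spec stage3_reduces l₃).1.2
  have atop : ∀ {r : Cirquent → Option Cirquent} {E : Cirquent},
      (∀ A A', r A = some A' → A' = top) → ChildFree (fun _ => False) IsAndLike E →
      ChildFree (fun _ => False) IsAndLike (modify r E) := by
    intro r E hr hE
    refine hE.modify rootOnly_false rootOnly_isAndLike fun A A' hA _ => ?_
    obtain rfl := hr A A' hA
    exact ⟨trivial, fun _ => id, fun _ => by simp [IsAndLike, IsPand]⟩
  have a₄ : ChildFree (fun _ => False) IsAndLike E₄ :=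
    loop_invariant (fun E hE => atop (fun _ _ => orTrivial_eq_top) hE) l₄ a₃
  have aTop : ∀ {E : Cirquent}, ChildFree (fun _ => False) IsAndLike E →
      ChildFree (fun _ => False) IsAndLike (modify andTop E) := by
    intro E hE
    refine hE.modify rootOnly_false rootOnly_isAndLike fun A A' hA hc => ?_
    rcases andTop_eq_some hA with rfl | rfl
    · exact ⟨hc.2.2, fun _ => id, fun h => (h (Or.inl ⟨_, _, rfl⟩)).elim⟩
    · exact ⟨hc.2.1, fun _ => id, fun h => (h (Or.inl ⟨_, _, rfl⟩)).elim⟩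
  have a₅ : ChildFree (fun _ => False) IsAndLike E₅ :=
    loop_invariant (fun E hE => aTop (atop (fun _ _ => orTop_eq_top) hE)) l₅ a₄
  have a₆ : ChildFree (fun _ => False) IsAndLike E₆ :=
    loop_invariant (fun E => stage6_invariant fun r E hr hE =>
      hE.modify rootOnly_false rootOnly_isAndLike fun A A' hA _ =>
        ⟨(hr.collapsed A A' hA).childFree, fun _ => id,
          fun h => (h (Or.inl (hr A A' hA).1)).elim⟩) l₆ a₅
  -- no opposite literals in a disjunction
  have u₄ : Unopposed E₄ := stage4_unopposed (loop_spec stage4_reduces l₄).1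
  have u₅ : Unopposed E₅ := by
    refine (loop_invariant (q := fun E => ChildFree (fun _ => False) IsAndLike E ∧ Unopposed E)
      (fun E hE => ?_) l₅ ⟨a₄, u₄⟩).2
    have hE' := atop (r := orTop) (fun _ _ => orTop_eq_top) hE.1
    exact ⟨aTop hE', unopposed_modify_andTop hE'
      (unopposed_modify_of_collapsed (fun _ _ hA => Or.inl (orTop_eq_top hA)) hE.2)⟩
  have u₆ : Unopposed E₆ :=
    loop_invariant (fun E => stage6_invariant fun r E hr =>
      unopposed_modify_of_collapsed hr.collapsed) l₆ u₅
  -- no component `⊤`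
  have t₅ : ChildFree IsTop IsTop E₅ :=
    stage5_childFree (loop_spec stage5_reduces l₅).1.1 (loop_spec stage5_reduces l₅).1.2
  have t₆ : ChildFree IsTop IsTop E₆ := by
    refine loop_invariant (fun E => stage6_invariant fun r E hr hE =>
      hE.modify rootOnly_isTop rootOnly_isTop fun A A' hA _ => ?_) l₆ t₅
    obtain ⟨c, B, C, rfl⟩ := (hr A A' hA).2
    simp [ChildFree, IsTop]
  obtain ⟨⟨⟨s6a, s6b⟩, s6c⟩, -⟩ := loop_spec stage6_reduces l₆
  let q : Cirquent → Prop := fun F => (∀ A B, F = por A B → IsFlat F) ∧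
    ∀ A B, F = pand A B → ∃ C ∈ conjuncts F,
      (conjuncts F).find? notChandChallRooted = some C ∧ IsFlat C
  have q₆ : q E₆ := by
    refine ⟨?_, ?_⟩
    · rintro A B rfl
      exact isFlat_of_childFree b₆ t₆ a₆ (u₆ _ (List.mem_singleton.2 rfl)) (by simp [IsBot])
        (by simp [IsTop]) (by simp [IsAndLike, IsPand])
    · rintro A B rfl
      obtain ⟨C₀, hC₀, hn₀⟩ := exists_conjunct_of_stage6 s6a s6b s6c ⟨A, B, rfl⟩
      obtain ⟨C, hC⟩ := Option.isSome_iff_exists.1 (List.find?_isSome.2 ⟨C₀, hC₀, hn₀⟩)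
      have hmem := List.mem_of_find?_eq_some hC
      have hn := List.find?_some hC
      refine ⟨C, hmem, hC, isFlat_of_childFree (b₆.of_mem_conjuncts hmem).1
        (t₆.of_mem_conjuncts hmem).1 (a₆.of_mem_conjuncts hmem).1 (u₆ C hmem)
        ((b₆.of_mem_conjuncts hmem).2.2 ⟨A, B, rfl⟩) ((t₆.of_mem_conjuncts hmem).2.2 ⟨A, B, rfl⟩)
        ?_⟩
      rintro (hp | ⟨_, _, _, rfl⟩ | ⟨_, _, rfl⟩)
      · exact (b₆.of_mem_conjuncts hmem).2.1 hp
      · simp [notChandChallRooted] at hn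
      · simp [notChandChallRooted] at hn
  have q₇ : q E₇ := loop_invariant (fun E => stage7_invariant fun c A B => by simp [q]) l₇ q₆
  have q₈ : q F := loop_invariant (fun E => stage8_invariant fun c A => by simp [q]) l₈ q₇
  refine ⟨?_, (loop_spec stage8_reduces l₈).1, q₈.1, q₈.2⟩
  let q' : Cirquent → Prop := fun F => ∀ c A B, F = chand c A B →
    c ∉ A.chandClusters ∧ c ∉ B.chandClusters
  have q'₇ : q' E₇ := (loop_spec stage7_reduces l₇).1
  exact loop_invariant (q := q') (fun E => stage8_invariant fun c A => by simp [q']) l₈ q'₇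

/-! ### The recursive calls -/

theorem mem_choices {F B D : Cirquent} : D ∈ choices F B ↔
    (∃ c X Y b, chor c X Y ∈ disjuncts B ∧ D = chooseOr c b F) ∨
      ∃ c X a, chex c X ∈ disjuncts B ∧ (a ∈ F.consts ∨ a = freshConst F) ∧
        D = chooseEx c a F := by
  simp only [choices, List.mem_flatMap]
  constructor
  · rintro ⟨S, hS, hD⟩
    split at hD
    · simp only [List.mem_cons, List.not_mem_nil, or_false] at hD
      rcases hD with rfl | rfl
      exacts [Or.inl ⟨_, _, _, false, hS, rfl⟩, Or.inl ⟨_, _, _, true, hS, rfl⟩]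
    · simp only [List.mem_map, List.mem_append, List.mem_singleton] at hD
      obtain ⟨a, ha, rfl⟩ := hD
      exact Or.inr ⟨_, _, a, hS, ha, rfl⟩
    · cases hD
  · rintro (⟨c, X, Y, b, hS, rfl⟩ | ⟨c, X, a, hS, ha, rfl⟩)
    · refine ⟨_, hS, ?_⟩
      cases b <;> simp
    · exact ⟨_, hS, List.mem_map.2 ⟨a, by simpa using ha, rfl⟩⟩

theorem rank_lt_of_mem_disjuncts {f : Cirquent → Cirquent} (hle : ∀ E, rank (f E) ≤ rank E)
    (hf : ∀ A B, f (por A B) = por (f A) (f B)) {S B : Cirquent} (hS : S ∈ disjuncts B)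
    (hlt : rank (f S) < rank S) : rank (f B) < rank B := by
  induction B with
  | por A B ihA ihB =>
    rw [hf]
    have hA := hle A
    have hB := hle B
    rcases List.mem_append.1 hS with hS | hS
    · have := ihA hS
      exact tower_strictMono (by omega)
    · have := ihB hS
      exact tower_strictMono (by omega)
  | _ =>
    obtain rfl := List.mem_singleton.1 hS
    exact hlt

theorem rank_lt_of_mem_conjuncts {f : Cirquent → Cirquent} (hle : ∀ E, rank (f E) ≤ rank E)
    (hf : ∀ A B, f (pand A B) = pand (f A) (f B)) {S B : Cirquent} (hS : S ∈ conjuncts B)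
    (hlt : rank (f S) < rank S) : rank (f B) < rank B := by
  induction B with
  | pand A B ihA ihB =>
    rw [hf]
    have hA := hle A
    have hB := hle B
    rcases List.mem_append.1 hS with hS | hS
    · have := ihA hS
      exact Nat.pow_lt_pow_right (by norm_num) (by omega)
    · have := ihB hS
      exact Nat.pow_lt_pow_right (by norm_num) (by omega)
  | _ =>
    obtain rfl := List.mem_singleton.1 hS
    exact hlt

theorem rank_chooseOr_chor_lt (c : ℕ) (b : Bool) (X Y : Cirquent) :
    rank (chooseOr c b (chor c X Y)) < rank (chor c X Y) := by
  have hX := rank_chooseOr_le c b X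
  have hY := rank_chooseOr_le c b Y
  have := rank_pos X
  have := rank_pos Y
  simp only [chooseOr, if_true]
  split_ifs <;> simp only [rank] <;> omega

theorem rank_chooseEx_chex_lt (c a : ℕ) (X : Cirquent) :
    rank (chooseEx c a (chex c X)) < rank (chex c X) := by
  simp only [chooseEx, if_true, rank_inst, rank]
  exact Nat.lt_succ_of_le (rank_chooseEx_le c a X)

theorem rank_lt_of_mem_choices {F B D : Cirquent} (hB : B = F ∨ B ∈ conjuncts F)
    (hD : D ∈ choices F B) : rank D < rank F := by
  rcases mem_choices.1 hD with ⟨c, X, Y, b, hS, rfl⟩ | ⟨c, X, a, hS, -, rfl⟩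
  · have h := rank_lt_of_mem_disjuncts (rank_chooseOr_le c b) (fun _ _ => rfl) hS
      (rank_chooseOr_chor_lt c b X Y)
    rcases hB with rfl | hB
    · exact h
    · exact rank_lt_of_mem_conjuncts (rank_chooseOr_le c b) (fun _ _ => rfl) hB h
  · have h := rank_lt_of_mem_disjuncts (rank_chooseEx_le c a) (fun _ _ => rfl) hS
      (rank_chooseEx_chex_lt c a X)
    rcases hB with rfl | hB
    · exact h
    · exact rank_lt_of_mem_conjuncts (rank_chooseEx_le c a) (fun _ _ => rfl) hB h

/-- Except for `⊓`- and `∀`-rooted cirquents, the calls are choices in `F` itself or in one of its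
conjuncts. -/
theorem calls_cases (F : Cirquent) :
    (∃ c A B, F = chand c A B) ∨ (∃ c A, F = chall c A) ∨
      ∀ D ∈ calls F, ∃ B, (B = F ∨ B ∈ conjuncts F) ∧ D ∈ choices F B := by
  cases F with
  | chand c A B => exact Or.inl ⟨c, A, B, rfl⟩
  | chall c A => exact Or.inr (Or.inl ⟨c, A, rfl⟩)
  | pand A B =>
    refine Or.inr (Or.inr fun D hD => ?_)
    simp only [calls] at hD
    split at hD
    · rename_i C hC
      exact ⟨C, Or.inr (List.mem_of_find?_eq_some hC), hD⟩
    · cases hD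
  | _ => exact Or.inr (Or.inr fun D hD => ⟨_, Or.inl rfl, hD⟩)

theorem rank_lt_of_mem_calls {F D : Cirquent} (hD : D ∈ calls F) : rank D < rank F := by
  rcases calls_cases F with ⟨c, A, B, rfl⟩ | ⟨c, A, rfl⟩ | h
  · simp only [calls, List.mem_cons, List.not_mem_nil, or_false] at hD
    have := rank_pos A
    have := rank_pos B
    rcases hD with rfl | rfl <;> simp only [rank] <;> omega
  · simp only [calls, List.mem_cons, List.not_mem_nil, or_false] at hD
    subst hD
    rw [rank_inst]
    exact Nat.lt_succ_self _
  · obtain ⟨B, hB, hD⟩ := h D hD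
    exact rank_lt_of_mem_choices hB hD

theorem closed_of_mem_calls {F D : Cirquent} (hF : Closed F) (hD : D ∈ calls F) : Closed D := by
  rcases calls_cases F with ⟨c, A, B, rfl⟩ | ⟨c, A, rfl⟩ | h
  · simp only [calls, List.mem_cons, List.not_mem_nil, or_false] at hD
    rcases hD with rfl | rfl
    exacts [hF.1, hF.2]
  · simp only [calls, List.mem_cons, List.not_mem_nil, or_false] at hD
    subst hD
    exact closedAt_inst trivial hF
  · obtain ⟨B, -, hD⟩ := h D hD
    rcases mem_choices.1 hD with ⟨c, X, Y, b, -, rfl⟩ | ⟨c, X, a, -, -, rfl⟩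
    exacts [closedAt_chooseOr c b hF, closedAt_chooseEx c a hF]

theorem provable_of_mem_choices {F B D : Cirquent} (hD : D ∈ choices F B) (h : Provable D) :
    Provable F := by
  rcases mem_choices.1 hD with ⟨c, X, Y, b, -, rfl⟩ | ⟨c, X, a, -, -, rfl⟩
  · cases b
    · exact .left_chor_choosing c F h
    · exact .right_chor_choosing c F h
  · exact .chexists_choosing c a F h

/-! ### Validity of the recursive calls -/

/-- Restriction of a strategy to the plays that begin with a certain choice by the environment. -/
theorem Wins.resolve {E A : Cirquent} {k : ℕ ⊕ ℕ} {v : ℕ} {ρ ρ' : ℕ → ℕ}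
    (hE : ∀ I e m, e k = some v → Holds I e m E ρ → Holds I e m A ρ')
    (hA : ∀ I e m, Holds I (Function.update e k (some v)) m A ρ' → Holds I e m A ρ')
    {e m : Moves} (hk : e k = none) (h : Wins E ρ e m) : Wins A ρ' e m := by
  refine ⟨fun e m => Wins E ρ (Function.update e k (some v)) m, h.env hk v, ?_⟩
  intro e m hw
  obtain ⟨m', g1, g2, g3, g4⟩ := hw.step
  refine ⟨m', g1, fun I => hA I e m' (hE I _ m' (by simp) (g2 I)), fun j w hj => ?_⟩
  by_cases hjk : j = k
  · subst hjk
    rwa [Function.update_idem]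
  · beta_reduce
    rw [Function.update_comm hjk]
    exact g4 j w (by rwa [Function.update_of_ne hjk])

theorem holds_update_chand {I : ℕ → List ℕ → Prop} {e m : Moves} {A : Cirquent} {ρ : ℕ → ℕ}
    {c : ℕ} (hc : c ∉ A.chandClusters) (v : ℕ) :
    Holds I (Function.update e (Sum.inl c) (some v)) m A ρ ↔ Holds I e m A ρ := by
  refine holds_congr_env A ρ (fun d hd => ?_) fun d _ => ?_
  · rw [Function.update_of_ne]
    exact fun h => hc (Sum.inl.inj h ▸ hd)
  · exact Function.update_of_ne Sum.inr_ne_inl _ _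

theorem holds_update_chall {I : ℕ → List ℕ → Prop} {e m : Moves} {A : Cirquent} {ρ : ℕ → ℕ}
    {c : ℕ} (hc : c ∉ A.challClusters) (v : ℕ) :
    Holds I (Function.update e (Sum.inr c) (some v)) m A ρ ↔ Holds I e m A ρ := by
  refine holds_congr_env A ρ (fun d _ => ?_) fun d hd => ?_
  · exact Function.update_of_ne Sum.inl_ne_inr _ _
  · rw [Function.update_of_ne]
    exact fun h => hc (Sum.inr.inj h ▸ hd)

theorem Valid.left_of_chand {c : ℕ} {A B : Cirquent} (hA : c ∉ A.chandClusters)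
    (h : Valid (Cirquent.chand c A B)) : Valid A := fun ρ =>
  (h ρ).resolve (k := Sum.inl c) (v := 0)
    (fun _ _ _ he (hh : Holds _ _ _ (Cirquent.chand c A B) ρ) => hh.1 he)
    (fun _ _ _ => (holds_update_chand hA 0).1) rfl

theorem Valid.right_of_chand {c : ℕ} {A B : Cirquent} (hB : c ∉ B.chandClusters)
    (h : Valid (Cirquent.chand c A B)) : Valid B := fun ρ =>
  (h ρ).resolve (k := Sum.inl c) (v := 1)
    (fun _ _ _ he (hh : Holds _ _ _ (Cirquent.chand c A B) ρ) => hh.2 0 he)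
    (fun _ _ _ => (holds_update_chand hB 1).1) rfl

theorem Valid.inst_of_chall {c : ℕ} {A : Cirquent} (hA : c ∉ A.challClusters)
    (h : Valid (Cirquent.chall c A)) (a : ℕ) : Valid (A.inst (Term.const a)) := fun ρ =>
  Wins.mono (fun _ _ _ => (holds_inst A _ ρ).2) <|
    (h ρ).resolve (A := A) (ρ' := push a ρ) (k := Sum.inr c) (v := a)
      (fun _ _ _ he (hh : Holds _ _ _ (Cirquent.chall c A) ρ) => hh a he)
      (fun _ _ _ => (holds_update_chall hA a).1) rfl

theorem holds_congr_val {I : ℕ → List ℕ → Prop} {e m : Moves} {E : Cirquent} {k : ℕ}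
    (hE : ClosedAt k E) {ρ ρ' : ℕ → ℕ} (h : ∀ i < k, ρ i = ρ' i) :
    Holds I e m E ρ ↔ Holds I e m E ρ' := by
  have hts : ∀ (ts : List Term) (k : ℕ) (ρ ρ' : ℕ → ℕ), (∀ t ∈ ts, t.ClosedAt k) →
      (∀ i < k, ρ i = ρ' i) → ts.map (Term.value ρ) = ts.map (Term.value ρ') := by
    intro ts k ρ ρ' hts h
    refine List.map_congr_left fun t ht => ?_
    cases t with
    | var i => exact h i (hts _ ht)
    | const a => rfl
  have hp : ∀ (k a : ℕ) (ρ ρ' : ℕ → ℕ), (∀ i < k, ρ i = ρ' i) →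
      ∀ i < k + 1, push a ρ i = push a ρ' i := by
    intro k a ρ ρ' h i hi
    cases i with
    | zero => rfl
    | succ i => exact h i (Nat.lt_of_succ_lt_succ hi)
  induction E generalizing k ρ ρ' with
  | top | bot => rfl
  | atom p ts | natom p ts => simp only [Holds, hts ts k ρ ρ' hE h]
  | pand A B ihA ihB | por A B ihA ihB | chand c A B ihA ihB | chor c A B ihA ihB =>
    simp only [Holds, ihA hE.1 h, ihB hE.2 h]
  | chall c A ih =>
    exact forall_congr' fun a => imp_congr_right fun _ => ih hE (hp k a ρ ρ' h)
  | chex c A ih =>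
    exact exists_congr fun a => and_congr_right fun _ => ih hE (hp k a ρ ρ' h)

theorem Closed.valid_of_wins {E : Cirquent} (hE : Closed E) {ρ : ℕ → ℕ} {m : Moves}
    (h : Wins E ρ noMoves m) : Valid E := fun _ =>
  (h.of_extends (m := noMoves) fun _ _ hv => (Option.some_ne_none _ hv.symm).elim).mono
    fun _ _ _ => (holds_congr_val hE fun i hi => (Nat.not_lt_zero i hi).elim).1

theorem closed_of_mem_disjuncts {E D : Cirquent} (hE : Closed E) (hD : D ∈ disjuncts E) :
    Closed D := by
  induction E with
  | por A B ihA ihB =>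
    exact (List.mem_append.1 hD).elim (ihA hE.1) (ihB hE.2)
  | _ =>
    obtain rfl := List.mem_singleton.1 hD
    exact hE

theorem closed_of_mem_conjuncts {E C : Cirquent} (hE : Closed E) (hC : C ∈ conjuncts E) :
    Closed C := by
  induction E with
  | pand A B ihA ihB =>
    exact (List.mem_append.1 hC).elim (ihA hE.1) (ihB hE.2)
  | _ =>
    obtain rfl := List.mem_singleton.1 hC
    exact hE

theorem holds_of_mem_conjuncts {I : ℕ → List ℕ → Prop} {e m : Moves} {ρ : ℕ → ℕ} {E C : Cirquent}
    (hC : C ∈ conjuncts E) (h : Holds I e m E ρ) : Holds I e m C ρ := by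
  induction E with
  | pand A B ihA ihB =>
    exact (List.mem_append.1 hC).elim (fun hC => ihA hC h.1) fun hC => ihB hC h.2
  | _ =>
    obtain rfl := List.mem_singleton.1 hC
    exact h

theorem exists_holds_of_mem_disjuncts {I : ℕ → List ℕ → Prop} {e m : Moves} {ρ : ℕ → ℕ}
    {E : Cirquent} (h : Holds I e m E ρ) : ∃ D ∈ disjuncts E, Holds I e m D ρ := by
  induction E with
  | por A B ihA ihB =>
    rcases h with h | h
    · obtain ⟨D, hD, h⟩ := ihA h
      exact ⟨D, List.mem_append_left _ hD, h⟩
    · obtain ⟨D, hD, h⟩ := ihB h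
      exact ⟨D, List.mem_append_right _ hD, h⟩
  | _ => exact ⟨_, List.mem_singleton.2 rfl, h⟩

/-- If the machine is to win a flat cirquent, it has to choose in one of the disjuncts: as the
literals are unopposed, there is an interpretation that makes all of them false. -/
theorem IsFlat.exists_choice {C : Cirquent} (hC : IsFlat C) (hcl : Closed C) {e m : Moves}
    {ρ : ℕ → ℕ} (h : ∀ I, Holds I e m C ρ) :
    (∃ c X Y v, chor c X Y ∈ disjuncts C ∧ m (Sum.inl c) = some v) ∨
      ∃ c X v, chex c X ∈ disjuncts C ∧ m (Sum.inr c) = some v := by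
  have hts : ∀ {ts : List Term}, (∀ t ∈ ts, t.ClosedAt 0) →
      (ts.map (Term.value ρ)).map Term.const = ts := by
    intro ts hts
    rw [List.map_map]
    refine (List.map_congr_left fun t ht => ?_).trans (List.map_id ts)
    cases t with
    | var i => exact (Nat.not_lt_zero i (hts _ ht)).elim
    | const a => rfl
  obtain ⟨D, hD, hh⟩ := exists_holds_of_mem_disjuncts
    (h fun p l => natom p (l.map Term.const) ∈ disjuncts C)
  have hDcl := closed_of_mem_disjuncts hcl hD
  rcases hC.disjunct D hD with ⟨p, ts, rfl | rfl⟩ | ⟨c, X, Y, rfl⟩ | ⟨c, X, rfl⟩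
  · simp only [Holds, hts hDcl] at hh
    exact (hC.unopposed p ts hD hh).elim
  · simp only [Holds, hts hDcl] at hh
    exact (hh hD).elim
  · rcases hh with ⟨hm, -⟩ | ⟨v, hm, -⟩
    exacts [Or.inl ⟨c, X, Y, 0, hD, hm⟩, Or.inl ⟨c, X, Y, v + 1, hD, hm⟩]
  · obtain ⟨v, hm, -⟩ := hh
    exact Or.inr ⟨c, X, v, hD, hm⟩

/-- The choices that a winning machine makes at the beginning include one of `choices F C`, up to an
exchange of unused constants. -/
theorem exists_valid_choice {F C : Cirquent} (hF : Closed F) (hv : Valid F)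
    (hFC : ∀ I e m ρ, Holds I e m F ρ → Holds I e m C ρ) (hC : IsFlat C) (hcl : Closed C) :
    ∃ D ∈ choices F C, Valid D := by
  obtain ⟨m, -, hh, hw, -⟩ := (hv fun _ => 0).step
  rcases hC.exists_choice hcl fun I => hFC I _ _ _ (hh I) with
    ⟨c, X, Y, v, hD, hm⟩ | ⟨c, X, v, hD, hm⟩
  · exact ⟨chooseOr c (decide (v ≠ 0)) F, mem_choices.2 (Or.inl ⟨c, X, Y, _, hD, rfl⟩),
      Closed.valid_of_wins (closedAt_chooseOr _ _ hF)
        (hw.choose (fun I e m => holds_chooseOr F _) hm)⟩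
  · by_cases hvF : v ∈ F.consts
    · exact ⟨chooseEx c v F, mem_choices.2 (Or.inr ⟨c, X, v, hD, Or.inl hvF, rfl⟩),
        Closed.valid_of_wins (closedAt_chooseEx _ _ hF)
          (hw.choose (fun I e m => holds_chooseEx F _) hm)⟩
    · -- a constant that does not occur in `F` can be exchanged for the designated fresh one
      refine ⟨chooseEx c (freshConst F) F,
        mem_choices.2 (Or.inr ⟨c, X, _, hD, Or.inr rfl, rfl⟩), ?_⟩
      have hren := hw.rename (h := Equiv.swap v (freshConst F)) (Equiv.surjective _) fun a ha =>
        Equiv.swap_apply_of_ne_of_ne (fun h => hvF (h ▸ ha))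
          fun h => freshOf_notMem _ (h ▸ ha)
      rw [Moves.rename_noMoves] at hren
      exact Closed.valid_of_wins (closedAt_chooseEx _ _ hF)
        (hren.choose (fun I e m => holds_chooseEx F _) (by simp [Moves.rename, hm]))

theorem isFlat_of_disjuncts_eq {F : Cirquent} (hd : disjuncts F = [F])
    (hF : IsLiteral F ∨ (∃ c X Y, F = chor c X Y) ∨ ∃ c X, F = chex c X) : IsFlat F := by
  refine ⟨fun D hD => ?_, fun p ts h h' => ?_⟩
  · rw [hd, List.mem_singleton] at hD
    rwa [hD]
  · rw [hd, List.mem_singleton] at h h'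
    rw [← h] at h'
    cases h'

/-! ### Correctness and termination of DECISION -/

theorem combine_eq_any_or (F : Cirquent) : F = top ∨ (∃ c A B, F = chand c A B) ∨
    (∃ c A, F = chall c A) ∨
    ((F ≠ top ∧ (∀ c A B, F ≠ chand c A B) ∧ ∀ c A, F ≠ chall c A) ∧
      (∀ l, combine F l = l.any id) ∧ ∀ D ∈ calls F, ∃ B, D ∈ choices F B) := by
  cases F with
  | top => exact Or.inl rfl
  | chand c A B => exact Or.inr (Or.inl ⟨c, A, B, rfl⟩)
  | chall c A => exact Or.inr (Or.inr (Or.inl ⟨c, A, rfl⟩))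
  | pand A B =>
    refine Or.inr (Or.inr (Or.inr ⟨by simp, fun l => rfl, fun D hD => ?_⟩))
    simp only [calls] at hD
    split at hD
    · exact ⟨_, hD⟩
    · cases hD
  | _ => exact Or.inr (Or.inr (Or.inr ⟨by simp, fun l => rfl, fun D hD => ⟨_, hD⟩⟩))

theorem exists_valid_call {F : Cirquent} (hF : Closed F) (hp : IsPure F) (hv : Valid F)
    (ht : F ≠ top) (hand : ∀ c A B, F ≠ chand c A B) (hall : ∀ c A, F ≠ chall c A) :
    ∃ D ∈ calls F, Valid D := by
  have hself : IsFlat F → calls F = choices F F → ∃ D ∈ calls F, Valid D := by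
    intro hfl hcalls
    rw [hcalls]
    exact exists_valid_choice hF hv (fun _ _ _ _ => id) hfl hF
  cases F with
  | top => exact (ht rfl).elim
  | bot =>
    obtain ⟨m, -, hh, -⟩ := (hv fun _ => 0).step
    exact (hh fun _ _ => True).elim
  | atom p ts =>
    exact hself (isFlat_of_disjuncts_eq rfl (Or.inl ⟨p, ts, Or.inl rfl⟩)) rfl
  | natom p ts =>
    exact hself (isFlat_of_disjuncts_eq rfl (Or.inl ⟨p, ts, Or.inr rfl⟩)) rfl
  | pand A B =>
    obtain ⟨C, hC, hfind, hfl⟩ := hp.pand A B rfl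
    have hcalls : calls (pand A B) = choices (pand A B) C := by
      simp only [calls, hfind]
    rw [hcalls]
    exact exists_valid_choice hF hv (fun _ _ _ _ => holds_of_mem_conjuncts hC) hfl
      (closed_of_mem_conjuncts hF hC)
  | por A B => exact hself (hp.por A B rfl) rfl
  | chand c A B => exact (hand c A B rfl).elim
  | chor c A B =>
    exact hself (isFlat_of_disjuncts_eq rfl (Or.inr (Or.inl ⟨c, A, B, rfl⟩))) rfl
  | chall c A => exact (hall c A rfl).elim
  | chex c A =>
    exact hself (isFlat_of_disjuncts_eq rfl (Or.inr (Or.inr ⟨c, A, rfl⟩))) rfl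

theorem forall₂_of_mapM_eq_some {α β : Type*} {f : α → Option β} {l : List α} {k : List β}
    (h : l.mapM f = some k) : List.Forall₂ (fun a b => f a = some b) l k := by
  induction l generalizing k with
  | nil =>
    obtain rfl : k = [] := by simpa using h.symm
    exact .nil
  | cons a l ih =>
    simp only [List.mapM_cons, Option.pure_def, Option.bind_eq_bind, Option.bind_eq_some_iff,
      Option.some.injEq] at h
    obtain ⟨b, hb, k, hk, rfl⟩ := h
    exact .cons hb (ih hk)

theorem exists_left_of_forall₂ {α β : Type*} {R : α → β → Prop} {l : List α} {k : List β}
    (h : List.Forall₂ R l k) {b : β} (hb : b ∈ k) : ∃ a ∈ l, R a b := by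
  induction h with
  | nil => cases hb
  | cons hab _ ih =>
    rcases List.mem_cons.1 hb with rfl | hb
    · exact ⟨_, List.mem_cons_self, hab⟩
    · obtain ⟨a, ha, hab⟩ := ih hb
      exact ⟨a, List.mem_cons_of_mem _ ha, hab⟩

theorem exists_right_of_forall₂ {α β : Type*} {R : α → β → Prop} {l : List α} {k : List β}
    (h : List.Forall₂ R l k) {a : α} (ha : a ∈ l) : ∃ b ∈ k, R a b := by
  obtain ⟨b, hb, hab⟩ := exists_left_of_forall₂ h.flip ha
  exact ⟨b, hb, hab⟩

theorem exists_mapM_eq_some {α β : Type*} {f : α → Option β} {l : List α}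
    (h : ∀ a ∈ l, ∃ b, f a = some b) : ∃ k, l.mapM f = some k := by
  induction l with
  | nil => exact ⟨[], rfl⟩
  | cons a l ih =>
    obtain ⟨b, hb⟩ := h a List.mem_cons_self
    obtain ⟨k, hk⟩ := ih fun a ha => h a (List.mem_cons_of_mem _ ha)
    exact ⟨b :: k, by simp [List.mapM_cons, hb, hk]⟩

theorem run_succ_eq_some {n : ℕ} {E : Cirquent} {b : Bool} : run (n + 1) E = some b ↔
    ∃ F, purify n E = some F ∧ ∃ l, (calls F).mapM (run n) = some l ∧ combine F l = b := by
  simp [run, Option.bind_eq_some_iff]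

theorem rank_le_of_purify {n : ℕ} {E F : Cirquent} (h : purify n E = some F) :
    rank F ≤ rank E := by
  rcases purify_reduces h with rfl | hr
  exacts [le_rfl, hr.rank_lt.le]

/-- Acceptance implies provability, and validity implies acceptance; as provability implies
validity, the three coincide. -/
theorem run_spec {n : ℕ} {E : Cirquent} {b : Bool} (hE : Closed E) (h : run n E = some b) :
    (b = true → Provable E) ∧ (Valid E → b = true) := by
  induction n generalizing E b with
  | zero => cases h
  | succ n ih =>
    obtain ⟨F, hF, l, hl, rfl⟩ := run_succ_eq_some.1 h
    have hpure := isPure_of_purify hF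
    obtain ⟨hback, hforth, hcl⟩ : (Provable F → Provable E) ∧ (Valid E → Valid F) ∧ Closed F := by
      rcases purify_reduces hF with rfl | hr
      · exact ⟨id, id, hE⟩
      · exact ⟨hr.provable, hr.valid, hr.closed hE⟩
    have hl := forall₂_of_mapM_eq_some hl
    suffices hs : (combine F l = true → Provable F) ∧ (Valid F → combine F l = true) from
      ⟨fun hb => hback (hs.1 hb), fun hv => hs.2 (hforth hv)⟩
    have ihc : ∀ {D b}, D ∈ calls F → run n D = some b →
        (b = true → Provable D) ∧ (Valid D → b = true) :=
      fun hD => ih (closed_of_mem_calls hcl hD)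
    rcases combine_eq_any_or F with rfl | ⟨c, A, B, rfl⟩ | ⟨c, A, rfl⟩ | ⟨hne, hcomb, hch⟩
    · refine ⟨fun _ => .ax, fun _ => ?_⟩
      obtain rfl : l = [] := List.forall₂_nil_left_iff.1 hl
      rfl
    · obtain ⟨b₁, l₁, hA, hl₁, rfl⟩ := List.forall₂_cons_left_iff.1 hl
      obtain ⟨b₂, l₂, hB, hl₂, rfl⟩ := List.forall₂_cons_left_iff.1 hl₁
      obtain rfl : l₂ = [] := List.forall₂_nil_left_iff.1 hl₂
      have iA := ihc (by simp [calls]) hA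
      have iB := ihc (by simp [calls]) hB
      obtain ⟨fA, fB⟩ := hpure.chand c A B rfl
      simp only [combine, List.all_cons, List.all_nil, Bool.and_true, id, Bool.and_eq_true]
      exact ⟨fun hb => .chand_splitting c A B fA fB (iA.1 hb.1) (iB.1 hb.2),
        fun hv => ⟨iA.2 (hv.left_of_chand fA), iB.2 (hv.right_of_chand fB)⟩⟩
    · obtain ⟨b₁, l₁, hA, hl₁, rfl⟩ := List.forall₂_cons_left_iff.1 hl
      obtain rfl : l₁ = [] := List.forall₂_nil_left_iff.1 hl₁
      have iA := ihc (by simp [calls]) hA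
      have fA := hpure.chall c A rfl
      simp only [combine, List.all_cons, List.all_nil, Bool.and_true, id]
      exact ⟨fun hb => .chall_splitting c _ A fA (freshOf_notMem A.consts) (iA.1 hb),
        fun hv => iA.2 (hv.inst_of_chall fA _)⟩
    · rw [hcomb]
      constructor
      · intro hb
        obtain ⟨b, hbl, rfl : b = true⟩ := List.any_eq_true.1 hb
        obtain ⟨D, hD, hrun⟩ := exists_left_of_forall₂ hl hbl
        obtain ⟨B, hB⟩ := hch D hD
        exact provable_of_mem_choices hB ((ihc hD hrun).1 rfl)
      · intro hv
        obtain ⟨D, hD, hDv⟩ := exists_valid_call hcl hpure hv hne.1 hne.2.1 hne.2.2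
        obtain ⟨b, hb, hrun⟩ := exists_right_of_forall₂ hl hD
        obtain rfl := (ihc hD hrun).2 hDv
        exact List.any_eq_true.2 ⟨true, hb, rfl⟩

/-- The rank bounds both the depth of the recursion and the number of rounds of each loop. -/
theorem exists_run_eq_some {n : ℕ} {E : Cirquent} (h : rank E + 1 < n) : ∃ b, run n E = some b := by
  induction n generalizing E with
  | zero => exact (Nat.not_lt_zero _ h).elim
  | succ n ih =>
    obtain ⟨F, hF⟩ := exists_purify_eq_some (Nat.lt_of_succ_lt_succ h)
    obtain ⟨l, hl⟩ := exists_mapM_eq_some (f := run n) (l := calls F) fun D hD => ih <| by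
      have := rank_lt_of_mem_calls hD
      have := rank_le_of_purify hF
      omega
    exact ⟨_, run_succ_eq_some.2 ⟨F, hF, l, hl, rfl⟩⟩

end Cirquent

/-! ### Closure properties of primitive recursive functions

They are stated for composite functions, the form in which `fun_prop` can apply them. -/

attribute [fun_prop] Primrec
attribute [fun_prop] Primrec.id Primrec.const Primrec.comp Primrec.pair

namespace Primrec

variable {α β γ σ : Type*} [Primcodable α] [Primcodable β] [Primcodable γ] [Primcodable σ]

@[fun_prop] theorem fst_comp {f : α → β × γ} (hf : Primrec f) : Primrec fun a => (f a).1 :=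
  Primrec.fst.comp hf

@[fun_prop] theorem snd_comp {f : α → β × γ} (hf : Primrec f) : Primrec fun a => (f a).2 :=
  Primrec.snd.comp hf

@[fun_prop] theorem add_comp {f g : α → ℕ} (hf : Primrec f) (hg : Primrec g) :
    Primrec fun a => f a + g a := Primrec.nat_add.comp hf hg

@[fun_prop] theorem sub_comp {f g : α → ℕ} (hf : Primrec f) (hg : Primrec g) :
    Primrec fun a => f a - g a := Primrec.nat_sub.comp hf hg

@[fun_prop] theorem mul_comp {f g : α → ℕ} (hf : Primrec f) (hg : Primrec g) :
    Primrec fun a => f a * g a := Primrec.nat_mul.comp hf hg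

@[fun_prop] theorem div_comp {f g : α → ℕ} (hf : Primrec f) (hg : Primrec g) :
    Primrec fun a => f a / g a := Primrec.nat_div.comp hf hg

@[fun_prop] theorem mod_comp {f g : α → ℕ} (hf : Primrec f) (hg : Primrec g) :
    Primrec fun a => f a % g a := Primrec.nat_mod.comp hf hg

@[fun_prop] theorem max_comp {f g : α → ℕ} (hf : Primrec f) (hg : Primrec g) :
    Primrec fun a => max (f a) (g a) := Primrec.nat_max.comp hf hg

@[fun_prop] theorem natPair_comp {f g : α → ℕ} (hf : Primrec f) (hg : Primrec g) :
    Primrec fun a => Nat.pair (f a) (g a) := Primrec₂.natPair.comp hf hg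

@[fun_prop] theorem unpair_comp {f : α → ℕ} (hf : Primrec f) :
    Primrec fun a => (f a).unpair := Primrec.unpair.comp hf

@[fun_prop] theorem encode_comp {f : α → β} (hf : Primrec f) :
    Primrec fun a => Encodable.encode (f a) := Primrec.encode.comp hf

@[fun_prop] theorem ite_lt {f g : α → ℕ} {x y : α → σ} (hf : Primrec f) (hg : Primrec g)
    (hx : Primrec x) (hy : Primrec y) : Primrec fun a => if f a < g a then x a else y a :=
  Primrec.ite (Primrec.nat_lt.comp hf hg) hx hy

@[fun_prop] theorem ite_eq [DecidableEq β] {f g : α → β} {x y : α → σ} (hf : Primrec f)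
    (hg : Primrec g) (hx : Primrec x) (hy : Primrec y) :
    Primrec fun a => if f a = g a then x a else y a :=
  Primrec.ite (Primrec.eq.comp hf hg) hx hy

@[fun_prop] theorem some_comp {f : α → β} (hf : Primrec f) : Primrec fun a => some (f a) :=
  Primrec.option_some.comp hf

@[fun_prop] theorem orElse_comp {f g : α → Option β} (hf : Primrec f) (hg : Primrec g) :
    Primrec fun a => (f a <|> g a) := Primrec.option_orElse.comp hf hg

@[fun_prop] theorem option_map_comp {f : α → Option β} {g : α → β → γ} (hf : Primrec f)
    (hg : Primrec fun p : α × β => g p.1 p.2) : Primrec fun a => (f a).map (g a) :=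
  Primrec.option_map hf hg

@[fun_prop] theorem option_bind_comp {f : α → Option β} {g : α → β → Option γ} (hf : Primrec f)
    (hg : Primrec fun p : α × β => g p.1 p.2) : Primrec fun a => (f a).bind (g a) :=
  Primrec.option_bind hf hg

@[fun_prop] theorem option_getD_comp {f : α → Option β} {g : α → β} (hf : Primrec f)
    (hg : Primrec g) : Primrec fun a => (f a).getD (g a) :=
  Primrec.option_getD.comp hf hg

@[fun_prop] theorem cons_comp {f : α → β} {g : α → List β} (hf : Primrec f) (hg : Primrec g) :
    Primrec fun a => f a :: g a := Primrec.list_cons.comp hf hg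

@[fun_prop] theorem append_comp {f g : α → List β} (hf : Primrec f) (hg : Primrec g) :
    Primrec fun a => f a ++ g a := Primrec.list_append.comp hf hg

@[fun_prop] theorem list_map_comp {f : α → List β} {g : α → β → γ} (hf : Primrec f)
    (hg : Primrec fun p : α × β => g p.1 p.2) : Primrec fun a => (f a).map (g a) :=
  Primrec.list_map hf hg

@[fun_prop] theorem flatMap_comp {f : α → List β} {g : α → β → List γ} (hf : Primrec f)
    (hg : Primrec fun p : α × β => g p.1 p.2) : Primrec fun a => (f a).flatMap (g a) :=
  Primrec.list_flatMap hf hg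

@[fun_prop] theorem foldr_comp {f : α → List β} {g : α → σ} {h : α → β → σ → σ} (hf : Primrec f)
    (hg : Primrec g) (hh : Primrec fun p : α × β × σ => h p.1 p.2.1 p.2.2) :
    Primrec fun a => (f a).foldr (h a) (g a) :=
  Primrec.list_foldr (h := fun a p => h a p.1 p.2) hf hg hh

@[fun_prop] theorem getElem?_comp {f : α → List β} {g : α → ℕ} (hf : Primrec f)
    (hg : Primrec g) : Primrec fun a => (f a)[g a]? := Primrec.list_getElem?.comp hf hg

@[fun_prop] theorem and_comp {f g : α → Bool} (hf : Primrec f) (hg : Primrec g) :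
    Primrec fun a => f a && g a := Primrec.and.comp hf hg

@[fun_prop] theorem or_comp {f g : α → Bool} (hf : Primrec f) (hg : Primrec g) :
    Primrec fun a => f a || g a := Primrec.or.comp hf hg

@[fun_prop] theorem decide_lt {f g : α → ℕ} (hf : Primrec f) (hg : Primrec g) :
    Primrec fun a => decide (f a < g a) := Primrec.nat_lt.decide.comp hf hg

@[fun_prop] theorem decide_eq [DecidableEq β] {f g : α → β} (hf : Primrec f) (hg : Primrec g) :
    Primrec fun a => decide (f a = g a) := Primrec.eq.decide.comp hf hg

@[fun_prop] theorem list_any_comp {f : α → List β} {g : α → β → Bool} (hf : Primrec f)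
    (hg : Primrec fun p : α × β => g p.1 p.2) : Primrec fun a => (f a).any (g a) := by
  have : Primrec fun a => (f a).foldr (fun b r => g a b || r) false := by fun_prop
  refine this.of_eq fun a => ?_
  induction f a with
  | nil => rfl
  | cons b l ih => rw [List.foldr_cons, ih, List.any_cons]

@[fun_prop] theorem list_all_comp {f : α → List β} {g : α → β → Bool} (hf : Primrec f)
    (hg : Primrec fun p : α × β => g p.1 p.2) : Primrec fun a => (f a).all (g a) := by
  have : Primrec fun a => (f a).foldr (fun b r => g a b && r) true := by fun_prop
  refine this.of_eq fun a => ?_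
  induction f a with
  | nil => rfl
  | cons b l ih => rw [List.foldr_cons, ih, List.all_cons]

@[fun_prop] theorem decide_mem [DecidableEq β] {f : α → β} {g : α → List β} (hf : Primrec f)
    (hg : Primrec g) : Primrec fun a => decide (f a ∈ g a) := by
  have : Primrec fun a => (g a).any fun b => decide (b = f a) := by fun_prop
  refine this.of_eq fun a => ?_
  rw [Bool.eq_iff_iff, List.any_eq_true]
  simp

@[fun_prop] theorem find?_comp {f : α → List β} {g : α → β → Bool} (hf : Primrec f)
    (hg : Primrec fun p : α × β => g p.1 p.2) : Primrec fun a => (f a).find? (g a) := by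
  have : Primrec fun a => (f a).foldr (fun b r => if g a b = true then some b else r) none := by
    fun_prop
  refine this.of_eq fun a => ?_
  induction f a with
  | nil => rfl
  | cons b l ih =>
    rw [List.foldr_cons, ih, List.find?_cons]
    cases g a b <;> rfl

end Primrec

/-! ### Terms -/

namespace Term

variable {α σ : Type} [Primcodable α] [Primcodable σ]

theorem primrec_equivSum : Primrec equivSum := Primrec.encode_iff.1 Primrec.encode

theorem primrec_equivSum_symm : Primrec equivSum.symm :=
  Primrec.encode_iff.1 (Primrec.encode.of_eq fun s => by cases s <;> rfl)

@[fun_prop] theorem primrec_var {f : α → ℕ} (hf : Primrec f) : Primrec fun a => var (f a) :=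
  primrec_equivSum_symm.comp (Primrec.sumInl.comp hf)

@[fun_prop] theorem primrec_const {f : α → ℕ} (hf : Primrec f) : Primrec fun a => const (f a) :=
  primrec_equivSum_symm.comp (Primrec.sumInr.comp hf)

theorem primrec_cases {f : α → Term → σ} {g h : α → ℕ → σ}
    (hg : Primrec fun p : α × ℕ => g p.1 p.2) (hh : Primrec fun p : α × ℕ => h p.1 p.2)
    (hv : ∀ a i, f a (var i) = g a i) (hc : ∀ a c, f a (const c) = h a c) :
    Primrec fun p : α × Term => f p.1 p.2 := by
  refine (Primrec.sumCasesOn (primrec_equivSum.comp Primrec.snd)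
    (g := fun (p : α × Term) i => g p.1 i) (h := fun (p : α × Term) i => h p.1 i)
    (Primrec₂.mk (by fun_prop)) (Primrec₂.mk (by fun_prop))).of_eq ?_
  rintro ⟨a, _ | _⟩
  exacts [(hv _ _).symm, (hc _ _).symm]

theorem primrec_lift' : Primrec fun p : ℕ × Term => p.2.lift p.1 :=
  primrec_cases (f := lift) (g := fun k i => if i < k then var i else var (i + 1))
    (h := fun _ c => const c) (by fun_prop) (by fun_prop) (fun _ _ => rfl) fun _ _ => rfl

@[fun_prop] theorem primrec_lift {f : α → ℕ} {g : α → Term} (hf : Primrec f) (hg : Primrec g) :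
    Primrec fun a => (g a).lift (f a) := primrec_lift'.comp (hf.pair hg)

theorem primrec_subst' : Primrec fun p : (ℕ × Term) × Term => subst p.1.1 p.1.2 p.2 :=
  primrec_cases (f := fun q : ℕ × Term => subst q.1 q.2)
    (g := fun q i => if i < q.1 then var i else if i = q.1 then q.2 else var (i - 1))
    (h := fun _ c => const c) (by fun_prop) (by fun_prop) (fun _ _ => rfl) fun _ _ => rfl

@[fun_prop] theorem primrec_subst {f : α → ℕ} {g h : α → Term} (hf : Primrec f) (hg : Primrec g)
    (hh : Primrec h) : Primrec fun a => subst (f a) (g a) (h a) :=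
  primrec_subst'.comp ((hf.pair hg).pair hh)

@[fun_prop] theorem primrec_consts : Primrec consts :=
  (primrec_cases (α := Unit) (f := fun _ => consts) (g := fun _ _ => []) (h := fun _ c => [c])
    (by fun_prop) (by fun_prop) (fun _ _ => rfl) fun _ _ => rfl).comp
      ((Primrec.const ()).pair Primrec.id)

/-- The Boolean form of `Term.ClosedAt`. -/
def isClosedAt (k : ℕ) : Term → Bool
  | var i => decide (i < k)
  | const _ => true

theorem isClosedAt_eq_true {k : ℕ} {t : Term} : isClosedAt k t = true ↔ t.ClosedAt k := by
  cases t <;> simp [isClosedAt, ClosedAt]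

theorem primrec_isClosedAt' : Primrec fun p : ℕ × Term => isClosedAt p.1 p.2 :=
  primrec_cases (f := isClosedAt) (g := fun k i => decide (i < k))
    (h := fun _ _ => true) (by fun_prop) (by fun_prop) (fun _ _ => rfl) fun _ _ => rfl

@[fun_prop] theorem primrec_isClosedAt {f : α → ℕ} {g : α → Term} (hf : Primrec f)
    (hg : Primrec g) : Primrec fun a => isClosedAt (f a) (g a) :=
  primrec_isClosedAt'.comp (hf.pair hg)

end Term

/-! ### Case distinction and recursion on cirquents -/

namespace Cirquent

section Cases

variable {α σ : Type} [Primcodable α] [Primcodable σ]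

theorem primrec_ofNat : Primrec ofNat :=
  Primrec.encode_iff.1 (Primrec.id.of_eq fun n => (toNat_ofNat n).symm)

theorem primrec_toNat : Primrec toNat := Primrec.encode

@[fun_prop] theorem primrec_ofNat_comp {f : α → ℕ} (hf : Primrec f) :
    Primrec fun a => ofNat (f a) := primrec_ofNat.comp hf

@[fun_prop] theorem primrec_toNat_comp {f : α → Cirquent} (hf : Primrec f) :
    Primrec fun a => toNat (f a) := primrec_toNat.comp hf

@[fun_prop] theorem primrec_atom {f : α → ℕ} {g : α → List Term} (hf : Primrec f)
    (hg : Primrec g) : Primrec fun a => atom (f a) (g a) := by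
  refine Primrec.encode_iff.1 ?_
  change Primrec fun a => 8 * Nat.pair (f a) (Encodable.encode (g a)) + 2
  fun_prop

@[fun_prop] theorem primrec_natom {f : α → ℕ} {g : α → List Term} (hf : Primrec f)
    (hg : Primrec g) : Primrec fun a => natom (f a) (g a) := by
  refine Primrec.encode_iff.1 ?_
  change Primrec fun a => 8 * Nat.pair (f a) (Encodable.encode (g a)) + 3
  fun_prop

@[fun_prop] theorem primrec_pand {f g : α → Cirquent} (hf : Primrec f) (hg : Primrec g) :
    Primrec fun a => pand (f a) (g a) := by
  refine Primrec.encode_iff.1 ?_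
  change Primrec fun a => 8 * Nat.pair (toNat (f a)) (toNat (g a)) + 4
  fun_prop

@[fun_prop] theorem primrec_por {f g : α → Cirquent} (hf : Primrec f) (hg : Primrec g) :
    Primrec fun a => por (f a) (g a) := by
  refine Primrec.encode_iff.1 ?_
  change Primrec fun a => 8 * Nat.pair (toNat (f a)) (toNat (g a)) + 5
  fun_prop

@[fun_prop] theorem primrec_chand {c : α → ℕ} {f g : α → Cirquent} (hc : Primrec c)
    (hf : Primrec f) (hg : Primrec g) : Primrec fun a => chand (c a) (f a) (g a) := by
  refine Primrec.encode_iff.1 ?_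
  change Primrec fun a => 8 * Nat.pair (c a) (Nat.pair (toNat (f a)) (toNat (g a))) + 6
  fun_prop

@[fun_prop] theorem primrec_chor {c : α → ℕ} {f g : α → Cirquent} (hc : Primrec c)
    (hf : Primrec f) (hg : Primrec g) : Primrec fun a => chor (c a) (f a) (g a) := by
  refine Primrec.encode_iff.1 ?_
  change Primrec fun a => 8 * Nat.pair (c a) (Nat.pair (toNat (f a)) (toNat (g a))) + 7
  fun_prop

@[fun_prop] theorem primrec_chall {c : α → ℕ} {f : α → Cirquent} (hc : Primrec c)
    (hf : Primrec f) : Primrec fun a => chall (c a) (f a) := by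
  refine Primrec.encode_iff.1 ?_
  change Primrec fun a => 8 * Nat.pair (c a) (toNat (f a)) + 8
  fun_prop

@[fun_prop] theorem primrec_chex {c : α → ℕ} {f : α → Cirquent} (hc : Primrec c)
    (hf : Primrec f) : Primrec fun a => chex (c a) (f a) := by
  refine Primrec.encode_iff.1 ?_
  change Primrec fun a => 8 * Nat.pair (c a) (toNat (f a)) + 9
  fun_prop

/-- Case distinction on the outermost operator of a cirquent. -/
theorem primrec_cases {f : α → Cirquent → σ} {gt gb : α → σ} {ga gn : α → ℕ → List Term → σ}
    {gand gor : α → Cirquent → Cirquent → σ} {gchand gchor : α → ℕ → Cirquent → Cirquent → σ}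
    {gall gex : α → ℕ → Cirquent → σ}
    (htop : ∀ a, f a top = gt a) (hbot : ∀ a, f a bot = gb a)
    (hatom : ∀ a p ts, f a (atom p ts) = ga a p ts)
    (hnatom : ∀ a p ts, f a (natom p ts) = gn a p ts)
    (hand : ∀ a A B, f a (pand A B) = gand a A B)
    (hor : ∀ a A B, f a (por A B) = gor a A B)
    (hchand : ∀ a c A B, f a (chand c A B) = gchand a c A B)
    (hchor : ∀ a c A B, f a (chor c A B) = gchor a c A B)
    (hall : ∀ a c A, f a (chall c A) = gall a c A)
    (hex : ∀ a c A, f a (chex c A) = gex a c A)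
    (pt : Primrec gt) (pb : Primrec gb)
    (pa : Primrec fun p : α × ℕ × List Term => ga p.1 p.2.1 p.2.2)
    (pn : Primrec fun p : α × ℕ × List Term => gn p.1 p.2.1 p.2.2)
    (pand' : Primrec fun p : α × Cirquent × Cirquent => gand p.1 p.2.1 p.2.2)
    (por' : Primrec fun p : α × Cirquent × Cirquent => gor p.1 p.2.1 p.2.2)
    (pchand : Primrec fun p : α × ℕ × Cirquent × Cirquent => gchand p.1 p.2.1 p.2.2.1 p.2.2.2)
    (pchor : Primrec fun p : α × ℕ × Cirquent × Cirquent => gchor p.1 p.2.1 p.2.2.1 p.2.2.2)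
    (pall : Primrec fun p : α × ℕ × Cirquent => gall p.1 p.2.1 p.2.2)
    (pex : Primrec fun p : α × ℕ × Cirquent => gex p.1 p.2.1 p.2.2) :
    Primrec fun p : α × Cirquent => f p.1 p.2 := by
  have hlist : Primrec fun n => Denumerable.ofNat (List Term) n := Primrec.ofNat (List Term)
  -- the case distinction on the code `n` of the cirquent, whose components are coded by `d`
  let F : α × ℕ × ℕ → σ := fun q =>
    let a := q.1
    let n := q.2.1
    let d := q.2.2
    if n = 0 then gt a else if n = 1 then gb a
    else if (n - 2) % 8 = 0 then ga a d.unpair.1 (Denumerable.ofNat (List Term) d.unpair.2)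
    else if (n - 2) % 8 = 1 then gn a d.unpair.1 (Denumerable.ofNat (List Term) d.unpair.2)
    else if (n - 2) % 8 = 2 then gand a (ofNat d.unpair.1) (ofNat d.unpair.2)
    else if (n - 2) % 8 = 3 then gor a (ofNat d.unpair.1) (ofNat d.unpair.2)
    else if (n - 2) % 8 = 4 then
      gchand a d.unpair.1 (ofNat d.unpair.2.unpair.1) (ofNat d.unpair.2.unpair.2)
    else if (n - 2) % 8 = 5 then
      gchor a d.unpair.1 (ofNat d.unpair.2.unpair.1) (ofNat d.unpair.2.unpair.2)
    else if (n - 2) % 8 = 6 then gall a d.unpair.1 (ofNat d.unpair.2)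
    else gex a d.unpair.1 (ofNat d.unpair.2)
  have hF : Primrec F := by
    have c1 := pa.comp (f := fun p : α × ℕ × List Term => ga p.1 p.2.1 p.2.2)
      (g := fun q : α × ℕ × ℕ => (q.1, q.2.2.unpair.1,
        Denumerable.ofNat (List Term) q.2.2.unpair.2)) (by fun_prop)
    have c2 := pn.comp (f := fun p : α × ℕ × List Term => gn p.1 p.2.1 p.2.2)
      (g := fun q : α × ℕ × ℕ => (q.1, q.2.2.unpair.1,
        Denumerable.ofNat (List Term) q.2.2.unpair.2)) (by fun_prop)
    have c3 := pand'.comp (f := fun p : α × Cirquent × Cirquent => gand p.1 p.2.1 p.2.2)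
      (g := fun q : α × ℕ × ℕ => (q.1, ofNat q.2.2.unpair.1, ofNat q.2.2.unpair.2)) (by fun_prop)
    have c4 := por'.comp (f := fun p : α × Cirquent × Cirquent => gor p.1 p.2.1 p.2.2)
      (g := fun q : α × ℕ × ℕ => (q.1, ofNat q.2.2.unpair.1, ofNat q.2.2.unpair.2)) (by fun_prop)
    have c5 := pchand.comp
      (f := fun p : α × ℕ × Cirquent × Cirquent => gchand p.1 p.2.1 p.2.2.1 p.2.2.2)
      (g := fun q : α × ℕ × ℕ => (q.1, q.2.2.unpair.1, ofNat q.2.2.unpair.2.unpair.1,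
        ofNat q.2.2.unpair.2.unpair.2)) (by fun_prop)
    have c6 := pchor.comp
      (f := fun p : α × ℕ × Cirquent × Cirquent => gchor p.1 p.2.1 p.2.2.1 p.2.2.2)
      (g := fun q : α × ℕ × ℕ => (q.1, q.2.2.unpair.1, ofNat q.2.2.unpair.2.unpair.1,
        ofNat q.2.2.unpair.2.unpair.2)) (by fun_prop)
    have c7 := pall.comp (f := fun p : α × ℕ × Cirquent => gall p.1 p.2.1 p.2.2)
      (g := fun q : α × ℕ × ℕ => (q.1, q.2.2.unpair.1, ofNat q.2.2.unpair.2)) (by fun_prop)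
    have c8 := pex.comp (f := fun p : α × ℕ × Cirquent => gex p.1 p.2.1 p.2.2)
      (g := fun q : α × ℕ × ℕ => (q.1, q.2.2.unpair.1, ofNat q.2.2.unpair.2)) (by fun_prop)
    have ct : Primrec fun q : α × ℕ × ℕ => gt q.1 := pt.comp Primrec.fst
    have cb : Primrec fun q : α × ℕ × ℕ => gb q.1 := pb.comp Primrec.fst
    have hif : ∀ (k : ℕ) {x y : α × ℕ × ℕ → σ}, Primrec x → Primrec y →
        Primrec fun q => if (q.2.1 - 2) % 8 = k then x q else y q :=
      fun k x y hx hy => Primrec.ite_eq (by fun_prop) (by fun_prop) hx hy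
    exact Primrec.ite_eq (by fun_prop) (by fun_prop) ct <|
      Primrec.ite_eq (by fun_prop) (by fun_prop) cb <| hif 0 c1 <| hif 1 c2 <| hif 2 c3 <|
      hif 3 c4 <| hif 4 c5 <| hif 5 c6 <| hif 6 c7 c8
  have hFn : Primrec fun p : α × Cirquent => F (p.1, toNat p.2, (toNat p.2 - 2) / 8) :=
    hF.comp (by fun_prop)
  have hmod : ∀ d k, k < 8 → (8 * d + k) % 8 = k := fun d k hk => by omega
  have hdiv : ∀ d k, k < 8 → (8 * d + k) / 8 = d := fun d k hk => by omega
  refine hFn.of_eq ?_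
  rintro ⟨a, E⟩
  cases E with
  | top => simp [F, toNat, htop]
  | bot => simp [F, toNat, hbot]
  | atom p ts => simp [F, toNat, hatom]
  | natom p ts => simp [F, toNat, hnatom, hmod _ 1, hdiv _ 1]
  | pand A B => simp [F, toNat, hand, hmod _ 2, hdiv _ 2, ofNat_toNat]
  | por A B => simp [F, toNat, hor, hmod _ 3, hdiv _ 3, ofNat_toNat]
  | chand c A B => simp [F, toNat, hchand, hmod _ 4, hdiv _ 4, ofNat_toNat]
  | chor c A B => simp [F, toNat, hchor, hmod _ 5, hdiv _ 5, ofNat_toNat]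
  | chall c A => simp [F, toNat, hall, hmod _ 6, hdiv _ 6, ofNat_toNat]
  | chex c A => simp [F, toNat, hex, hmod _ 7, hdiv _ 7, ofNat_toNat]

end Cases
section Recursion

variable {α σ : Type} [Primcodable α] [Primcodable σ]

/-- Structural recursion on cirquents, with a parameter that `up` changes inside a quantifier. -/
theorem primrec_rec {f : α → Cirquent → σ} {up : α → α} (pup : Primrec up) {gt gb : α → σ}
    {ga gn : α → ℕ → List Term → σ} {gand gor : α → Cirquent → Cirquent → σ → σ → σ}
    {gchand gchor : α → ℕ → Cirquent → Cirquent → σ → σ → σ}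
    {gall gex : α → ℕ → Cirquent → σ → σ}
    (htop : ∀ a, f a top = gt a := by intros; rfl)
    (hbot : ∀ a, f a bot = gb a := by intros; rfl)
    (hatom : ∀ a p ts, f a (atom p ts) = ga a p ts := by intros; rfl)
    (hnatom : ∀ a p ts, f a (natom p ts) = gn a p ts := by intros; rfl)
    (hand : ∀ a A B, f a (pand A B) = gand a A B (f a A) (f a B) := by intros; rfl)
    (hor : ∀ a A B, f a (por A B) = gor a A B (f a A) (f a B) := by intros; rfl)
    (hchand : ∀ a c A B, f a (chand c A B) = gchand a c A B (f a A) (f a B) := by intros; rfl)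
    (hchor : ∀ a c A B, f a (chor c A B) = gchor a c A B (f a A) (f a B) := by intros; rfl)
    (hall : ∀ a c A, f a (chall c A) = gall a c A (f (up a) A) := by intros; rfl)
    (hex : ∀ a c A, f a (chex c A) = gex a c A (f (up a) A) := by intros; rfl)
    (pt : Primrec gt := by fun_prop) (pb : Primrec gb := by fun_prop)
    (pa : Primrec fun p : α × ℕ × List Term => ga p.1 p.2.1 p.2.2 := by fun_prop)
    (pn : Primrec fun p : α × ℕ × List Term => gn p.1 p.2.1 p.2.2 := by fun_prop)
    (pand' : Primrec fun p : α × (Cirquent × Cirquent) × σ × σ =>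
      gand p.1 p.2.1.1 p.2.1.2 p.2.2.1 p.2.2.2 := by fun_prop)
    (por' : Primrec fun p : α × (Cirquent × Cirquent) × σ × σ =>
      gor p.1 p.2.1.1 p.2.1.2 p.2.2.1 p.2.2.2 := by fun_prop)
    (pchand : Primrec fun p : α × (ℕ × Cirquent × Cirquent) × σ × σ =>
      gchand p.1 p.2.1.1 p.2.1.2.1 p.2.1.2.2 p.2.2.1 p.2.2.2 := by fun_prop)
    (pchor : Primrec fun p : α × (ℕ × Cirquent × Cirquent) × σ × σ =>
      gchor p.1 p.2.1.1 p.2.1.2.1 p.2.1.2.2 p.2.2.1 p.2.2.2 := by fun_prop)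
    (pall : Primrec fun p : α × (ℕ × Cirquent) × σ => gall p.1 p.2.1.1 p.2.1.2 p.2.2 := by
      fun_prop)
    (pex : Primrec fun p : α × (ℕ × Cirquent) × σ => gex p.1 p.2.1.1 p.2.1.2 p.2.2 := by
      fun_prop) :
    Primrec fun p : α × Cirquent => f p.1 p.2 := by
  -- the immediate subcirquents, with the parameters that they get
  let l : α → Cirquent → List (α × Cirquent) := fun a E =>
    match E with
    | pand A B | por A B | chand _ A B | chor _ A B => [(a, A), (a, B)]
    | chall _ A | chex _ A => [(up a, A)]
    | _ => []
  -- the value at a cirquent, from the list of the values at its immediate subcirquents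
  let g : α × List σ → Cirquent → Option σ := fun q E =>
    match E with
    | top => some (gt q.1)
    | bot => some (gb q.1)
    | atom p ts => some (ga q.1 p ts)
    | natom p ts => some (gn q.1 p ts)
    | pand A B => q.2[0]?.bind fun s => q.2[1]?.map fun t => gand q.1 A B s t
    | por A B => q.2[0]?.bind fun s => q.2[1]?.map fun t => gor q.1 A B s t
    | chand c A B => q.2[0]?.bind fun s => q.2[1]?.map fun t => gchand q.1 c A B s t
    | chor c A B => q.2[0]?.bind fun s => q.2[1]?.map fun t => gchor q.1 c A B s t
    | chall c A => q.2[0]?.map fun s => gall q.1 c A s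
    | chex c A => q.2[0]?.map fun s => gex q.1 c A s
  have hl : Primrec fun p : α × Cirquent => l p.1 p.2 := by
    refine primrec_cases (f := l) (gt := fun _ => []) (gb := fun _ => [])
      (ga := fun _ _ _ => []) (gn := fun _ _ _ => [])
      (gand := fun a A B => [(a, A), (a, B)]) (gor := fun a A B => [(a, A), (a, B)])
      (gchand := fun a _ A B => [(a, A), (a, B)]) (gchor := fun a _ A B => [(a, A), (a, B)])
      (gall := fun a _ A => [(up a, A)]) (gex := fun a _ A => [(up a, A)])
      ?_ ?_ ?_ ?_ ?_ ?_ ?_ ?_ ?_ ?_ ?_ ?_ ?_ ?_ ?_ ?_ ?_ ?_ ?_ ?_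
    all_goals first | (intros; rfl) | fun_prop
  have hg : Primrec fun p : (α × List σ) × Cirquent => g p.1 p.2 := by
    refine primrec_cases (f := g)
      (gt := fun q => some (gt q.1)) (gb := fun q => some (gb q.1))
      (ga := fun q p ts => some (ga q.1 p ts)) (gn := fun q p ts => some (gn q.1 p ts))
      (gand := fun q A B => q.2[0]?.bind fun s => q.2[1]?.map fun t => gand q.1 A B s t)
      (gor := fun q A B => q.2[0]?.bind fun s => q.2[1]?.map fun t => gor q.1 A B s t)
      (gchand := fun q c A B => q.2[0]?.bind fun s => q.2[1]?.map fun t => gchand q.1 c A B s t)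
      (gchor := fun q c A B => q.2[0]?.bind fun s => q.2[1]?.map fun t => gchor q.1 c A B s t)
      (gall := fun q c A => q.2[0]?.map fun s => gall q.1 c A s)
      (gex := fun q c A => q.2[0]?.map fun s => gex q.1 c A s)
      (fun _ => rfl) (fun _ => rfl) (fun _ _ _ => rfl) (fun _ _ _ => rfl) (fun _ _ _ => rfl)
      (fun _ _ _ => rfl) (fun _ _ _ _ => rfl) (fun _ _ _ _ => rfl) (fun _ _ _ => rfl)
      (fun _ _ _ => rfl) (by fun_prop) (by fun_prop) ?_ ?_ ?_ ?_ ?_ ?_ ?_ ?_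
    · exact Primrec.some_comp (pa.comp (f := fun p : α × ℕ × List Term => ga p.1 p.2.1 p.2.2)
        (g := fun p : (α × List σ) × ℕ × List Term => (p.1.1, p.2)) (by fun_prop))
    · exact Primrec.some_comp (pn.comp (f := fun p : α × ℕ × List Term => gn p.1 p.2.1 p.2.2)
        (g := fun p : (α × List σ) × ℕ × List Term => (p.1.1, p.2)) (by fun_prop))
    · exact Primrec.option_bind_comp (by fun_prop) (Primrec.option_map_comp (by fun_prop)
        (pand'.comp (g := fun p : (((α × List σ) × Cirquent × Cirquent) × σ) × σ =>
          (p.1.1.1.1, p.1.1.2, p.1.2, p.2)) (by fun_prop)))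
    · exact Primrec.option_bind_comp (by fun_prop) (Primrec.option_map_comp (by fun_prop)
        (por'.comp (g := fun p : (((α × List σ) × Cirquent × Cirquent) × σ) × σ =>
          (p.1.1.1.1, p.1.1.2, p.1.2, p.2)) (by fun_prop)))
    · exact Primrec.option_bind_comp (by fun_prop) (Primrec.option_map_comp (by fun_prop)
        (pchand.comp (g := fun p : (((α × List σ) × ℕ × Cirquent × Cirquent) × σ) × σ =>
          (p.1.1.1.1, p.1.1.2, p.1.2, p.2)) (by fun_prop)))
    · exact Primrec.option_bind_comp (by fun_prop) (Primrec.option_map_comp (by fun_prop)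
        (pchor.comp (g := fun p : (((α × List σ) × ℕ × Cirquent × Cirquent) × σ) × σ =>
          (p.1.1.1.1, p.1.1.2, p.1.2, p.2)) (by fun_prop)))
    · exact Primrec.option_map_comp (by fun_prop)
        (pall.comp (g := fun p : ((α × List σ) × ℕ × Cirquent) × σ =>
          (p.1.1.1, p.1.2, p.2)) (by fun_prop))
    · exact Primrec.option_map_comp (by fun_prop)
        (pex.comp (g := fun p : ((α × List σ) × ℕ × Cirquent) × σ =>
          (p.1.1.1, p.1.2, p.2)) (by fun_prop))
  refine Primrec.nat_omega_rec' (fun p : α × Cirquent => f p.1 p.2)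
    (m := fun p => toNat p.2) (l := fun p => l p.1 p.2)
    (g := fun p s => g (p.1, s) p.2) (by fun_prop) hl
    (Primrec₂.mk (hg.comp (g := fun q : (α × Cirquent) × List σ => ((q.1.1, q.2), q.1.2))
      (by fun_prop))) ?_ ?_
  · rintro ⟨a, E⟩ ⟨a', D⟩ h
    have hp := Nat.left_le_pair
    have hp' := Nat.right_le_pair
    cases E with
    | top | bot | atom | natom => simp [l] at h
    | pand A B | por A B =>
      have h1 := hp (toNat A) (toNat B)
      have h2 := hp' (toNat A) (toNat B)
      simp only [l, List.mem_cons, Prod.mk.injEq, List.not_mem_nil, or_false] at h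
      obtain ⟨-, rfl⟩ | ⟨-, rfl⟩ := h <;> simp only [toNat] <;> omega
    | chand c A B | chor c A B =>
      have h1 := hp (toNat A) (toNat B)
      have h2 := hp' (toNat A) (toNat B)
      have h3 := hp' c (Nat.pair (toNat A) (toNat B))
      simp only [l, List.mem_cons, Prod.mk.injEq, List.not_mem_nil, or_false] at h
      obtain ⟨-, rfl⟩ | ⟨-, rfl⟩ := h <;> simp only [toNat] <;> omega
    | chall c A | chex c A =>
      have h3 := hp' c (toNat A)
      simp only [l, List.mem_cons, Prod.mk.injEq, List.not_mem_nil, or_false] at h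
      obtain ⟨-, rfl⟩ := h
      simp only [toNat]
      omega
  · rintro ⟨a, E⟩
    cases E <;> simp [l, g, htop, hbot, hatom, hnatom, hand, hor, hchand, hchor, hall, hex]

end Recursion
end Cirquent

/-! ### The operations on cirquents are primitive recursive -/

namespace Cirquent

section Operations

variable {α : Type} [Primcodable α]

@[fun_prop] theorem primrec_lift {f : α → ℕ} {g : α → Cirquent} (hf : Primrec f)
    (hg : Primrec g) : Primrec fun a => lift (f a) (g a) :=
  (primrec_rec (f := lift) (up := fun k => k + 1) (by fun_prop)
    (gt := fun _ => top) (gb := fun _ => bot)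
    (ga := fun k p ts => atom p (ts.map (Term.lift k)))
    (gn := fun k p ts => natom p (ts.map (Term.lift k)))
    (gand := fun _ _ _ A B => pand A B) (gor := fun _ _ _ A B => por A B)
    (gchand := fun _ c _ _ A B => chand c A B) (gchor := fun _ c _ _ A B => chor c A B)
    (gall := fun _ c _ A => chall c A) (gex := fun _ c _ A => chex c A)).comp (hf.pair hg)

@[fun_prop] theorem primrec_weaken {g : α → Cirquent} (hg : Primrec g) :
    Primrec fun a => weaken (g a) := primrec_lift (Primrec.const 0) hg

@[fun_prop] theorem primrec_subst {f : α → ℕ} {t : α → Term} {g : α → Cirquent} (hf : Primrec f)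
    (ht : Primrec t) (hg : Primrec g) : Primrec fun a => subst (f a) (t a) (g a) :=
  (primrec_rec (f := fun q : ℕ × Term => subst q.1 q.2) (up := fun q => (q.1 + 1, q.2.lift 0))
    (by fun_prop)
    (gt := fun _ => top) (gb := fun _ => bot)
    (ga := fun q p ts => atom p (ts.map (Term.subst q.1 q.2)))
    (gn := fun q p ts => natom p (ts.map (Term.subst q.1 q.2)))
    (gand := fun _ _ _ A B => pand A B) (gor := fun _ _ _ A B => por A B)
    (gchand := fun _ c _ _ A B => chand c A B) (gchor := fun _ c _ _ A B => chor c A B)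
    (gall := fun _ c _ A => chall c A) (gex := fun _ c _ A => chex c A)).comp
      ((hf.pair ht).pair hg)

@[fun_prop] theorem primrec_inst {g : α → Cirquent} {t : α → Term} (hg : Primrec g)
    (ht : Primrec t) : Primrec fun a => inst (g a) (t a) :=
  primrec_subst (Primrec.const 0) ht hg

/-- The Boolean form of `Cirquent.ClosedAt`. -/
def isClosedAt : ℕ → Cirquent → Bool
  | _, top => true
  | _, bot => true
  | k, atom _ ts => ts.all (Term.isClosedAt k)
  | k, natom _ ts => ts.all (Term.isClosedAt k)
  | k, pand A B => isClosedAt k A && isClosedAt k B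
  | k, por A B => isClosedAt k A && isClosedAt k B
  | k, chand _ A B => isClosedAt k A && isClosedAt k B
  | k, chor _ A B => isClosedAt k A && isClosedAt k B
  | k, chall _ A => isClosedAt (k + 1) A
  | k, chex _ A => isClosedAt (k + 1) A

theorem isClosedAt_eq_true {k : ℕ} {E : Cirquent} : isClosedAt k E = true ↔ ClosedAt k E := by
  induction E generalizing k <;>
    simp_all [isClosedAt, ClosedAt, List.all_eq_true, Term.isClosedAt_eq_true]

@[fun_prop] theorem primrec_isClosedAt {f : α → ℕ} {g : α → Cirquent} (hf : Primrec f)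
    (hg : Primrec g) : Primrec fun a => isClosedAt (f a) (g a) :=
  (primrec_rec (f := isClosedAt) (up := fun k => k + 1) (by fun_prop)
    (gt := fun _ => true) (gb := fun _ => true)
    (ga := fun k _ ts => ts.all (Term.isClosedAt k))
    (gn := fun k _ ts => ts.all (Term.isClosedAt k))
    (gand := fun _ _ _ a b => a && b) (gor := fun _ _ _ a b => a && b)
    (gchand := fun _ _ _ _ a b => a && b) (gchor := fun _ _ _ _ a b => a && b)
    (gall := fun _ _ _ a => a) (gex := fun _ _ _ a => a)).comp (hf.pair hg)

@[fun_prop] theorem primrec_consts {g : α → Cirquent} (hg : Primrec g) :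
    Primrec fun a => consts (g a) :=
  (primrec_rec (f := fun _ : Unit => consts) (up := id) Primrec.id
    (gt := fun _ => []) (gb := fun _ => [])
    (ga := fun _ _ ts => ts.flatMap Term.consts) (gn := fun _ _ ts => ts.flatMap Term.consts)
    (gand := fun _ _ _ a b => a ++ b) (gor := fun _ _ _ a b => a ++ b)
    (gchand := fun _ _ _ _ a b => a ++ b) (gchor := fun _ _ _ _ a b => a ++ b)
    (gall := fun _ _ _ a => a) (gex := fun _ _ _ a => a)).comp ((Primrec.const ()).pair hg)

@[fun_prop] theorem primrec_chandClusters {g : α → Cirquent} (hg : Primrec g) :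
    Primrec fun a => chandClusters (g a) :=
  (primrec_rec (f := fun _ : Unit => chandClusters) (up := id) Primrec.id
    (gt := fun _ => []) (gb := fun _ => []) (ga := fun _ _ _ => []) (gn := fun _ _ _ => [])
    (gand := fun _ _ _ a b => a ++ b) (gor := fun _ _ _ a b => a ++ b)
    (gchand := fun _ c _ _ a b => c :: (a ++ b)) (gchor := fun _ _ _ _ a b => a ++ b)
    (gall := fun _ _ _ a => a) (gex := fun _ _ _ a => a)).comp ((Primrec.const ()).pair hg)

@[fun_prop] theorem primrec_freshOf {g : α → List ℕ} (hg : Primrec g) :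
    Primrec fun a => freshOf (g a) := by
  unfold freshOf
  fun_prop

@[fun_prop] theorem primrec_freshCluster {g : α → Cirquent} (hg : Primrec g) :
    Primrec fun a => freshCluster (g a) := by
  unfold freshCluster
  fun_prop

@[fun_prop] theorem primrec_freshConst {g : α → Cirquent} (hg : Primrec g) :
    Primrec fun a => freshConst (g a) := by
  unfold freshConst
  fun_prop

@[fun_prop] theorem primrec_chooseOr {c : α → ℕ} {r : α → Bool} {g : α → Cirquent}
    (hc : Primrec c) (hr : Primrec r) (hg : Primrec g) :
    Primrec fun a => chooseOr (c a) (r a) (g a) :=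
  (primrec_rec (f := fun q : ℕ × Bool => chooseOr q.1 q.2) (up := id) Primrec.id
    (gt := fun _ => top) (gb := fun _ => bot)
    (ga := fun _ p ts => atom p ts) (gn := fun _ p ts => natom p ts)
    (gand := fun _ _ _ A B => pand A B) (gor := fun _ _ _ A B => por A B)
    (gchand := fun _ c _ _ A B => chand c A B)
    (gchor := fun q d _ _ A B => if d = q.1 then (if q.2 = true then B else A) else chor d A B)
    (gall := fun _ c _ A => chall c A) (gex := fun _ c _ A => chex c A)).comp
      ((hc.pair hr).pair hg)

@[fun_prop] theorem primrec_chooseEx {c k : α → ℕ} {g : α → Cirquent}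
    (hc : Primrec c) (hk : Primrec k) (hg : Primrec g) :
    Primrec fun a => chooseEx (c a) (k a) (g a) :=
  (primrec_rec (f := fun q : ℕ × ℕ => chooseEx q.1 q.2) (up := id) Primrec.id
    (gt := fun _ => top) (gb := fun _ => bot)
    (ga := fun _ p ts => atom p ts) (gn := fun _ p ts => natom p ts)
    (gand := fun _ _ _ A B => pand A B) (gor := fun _ _ _ A B => por A B)
    (gchand := fun _ c _ _ A B => chand c A B) (gchor := fun _ c _ _ A B => chor c A B)
    (gall := fun _ c _ A => chall c A)
    (gex := fun q d _ A => if d = q.1 then A.inst (Term.const q.2) else chex d A)).comp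
      ((hc.pair hk).pair hg)

@[fun_prop] theorem primrec_onSurface {r : α → Cirquent → Option Cirquent} {g : α → Cirquent}
    (hr : Primrec fun p : α × Cirquent => r p.1 p.2) (hg : Primrec g) :
    Primrec fun a => onSurface (r a) (g a) := by
  have hr' : ∀ {β : Type} [Primcodable β] {u : β → α} {v : β → Cirquent}, Primrec u → Primrec v →
      Primrec fun b => r (u b) (v b) := fun hu hv => hr.comp (hu.pair hv)
  refine (primrec_rec (f := fun a => onSurface (r a)) (up := id) Primrec.id
    (gt := fun a => r a top) (gb := fun a => r a bot)
    (ga := fun a p ts => r a (atom p ts)) (gn := fun a p ts => r a (natom p ts))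
    (gand := fun a A B A' B' => r a (pand A B) <|> A'.map (fun A' => pand A' B) <|>
      B'.map (fun B' => pand A B'))
    (gor := fun a A B A' B' => r a (por A B) <|> A'.map (fun A' => por A' B) <|>
      B'.map (fun B' => por A B'))
    (gchand := fun a c A B _ _ => r a (chand c A B))
    (gchor := fun a c A B _ _ => r a (chor c A B))
    (gall := fun a c A _ => r a (chall c A)) (gex := fun a c A _ => r a (chex c A))
    (pt := ?pt) (pb := ?pb) (pa := ?pa) (pn := ?pn) (pand' := ?pand') (por' := ?por') (pchand := ?pchand)
    (pchor := ?pchor) (pall := ?pall) (pex := ?pex)).comp (Primrec.id.pair hg)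
  case pand' | por' =>
    exact Primrec.orElse_comp (hr' (by fun_prop) (by fun_prop)) (by fun_prop)
  all_goals exact hr' (by fun_prop) (by fun_prop)

@[fun_prop] theorem primrec_anywhere {r : α → ℕ → Cirquent → Option Cirquent} {f : α → ℕ}
    {g : α → Cirquent} (hr : Primrec fun p : α × ℕ × Cirquent => r p.1 p.2.1 p.2.2)
    (hf : Primrec f) (hg : Primrec g) : Primrec fun a => anywhere (r a) (f a) (g a) := by
  have hr' : ∀ {β : Type} [Primcodable β] {u : β → α} {d : β → ℕ} {v : β → Cirquent}, Primrec u →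
      Primrec d → Primrec v → Primrec fun b => r (u b) (d b) (v b) :=
    fun hu hd hv => hr.comp (hu.pair (hd.pair hv))
  refine (primrec_rec (f := fun q : α × ℕ => anywhere (r q.1) q.2)
    (up := fun q => (q.1, q.2 + 1)) (by fun_prop)
    (gt := fun q => r q.1 q.2 top) (gb := fun q => r q.1 q.2 bot)
    (ga := fun q p ts => r q.1 q.2 (atom p ts)) (gn := fun q p ts => r q.1 q.2 (natom p ts))
    (gand := fun q A B A' B' => r q.1 q.2 (pand A B) <|> A'.map (fun A' => pand A' B) <|>
      B'.map (fun B' => pand A B'))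
    (gor := fun q A B A' B' => r q.1 q.2 (por A B) <|> A'.map (fun A' => por A' B) <|>
      B'.map (fun B' => por A B'))
    (gchand := fun q c A B A' B' => r q.1 q.2 (chand c A B) <|>
      A'.map (fun A' => chand c A' B) <|> B'.map (fun B' => chand c A B'))
    (gchor := fun q c A B A' B' => r q.1 q.2 (chor c A B) <|>
      A'.map (fun A' => chor c A' B) <|> B'.map (fun B' => chor c A B'))
    (gall := fun q c A A' => r q.1 q.2 (chall c A) <|> A'.map (fun A' => chall c A'))
    (gex := fun q c A A' => r q.1 q.2 (chex c A) <|> A'.map (fun A' => chex c A'))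
    (pt := ?pt) (pb := ?pb) (pa := ?pa) (pn := ?pn) (pand' := ?pand') (por' := ?por') (pchand := ?pchand)
    (pchor := ?pchor) (pall := ?pall) (pex := ?pex)).comp ((Primrec.id.pair hf).pair hg)
  case pand' | por' | pchand | pchor | pall | pex =>
    exact Primrec.orElse_comp (hr' (by fun_prop) (by fun_prop) (by fun_prop)) (by fun_prop)
  all_goals exact hr' (by fun_prop) (by fun_prop) (by fun_prop)

@[fun_prop] theorem primrec_modify {r : α → Cirquent → Option Cirquent} {g : α → Cirquent}
    (hr : Primrec fun p : α × Cirquent => r p.1 p.2) (hg : Primrec g) :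
    Primrec fun a => modify (r a) (g a) :=
  Primrec.option_getD_comp (primrec_onSurface hr hg) hg

@[fun_prop] theorem primrec_disjuncts {g : α → Cirquent} (hg : Primrec g) :
    Primrec fun a => disjuncts (g a) :=
  (primrec_rec (f := fun _ : Unit => disjuncts) (up := id) Primrec.id
    (gt := fun _ => [top]) (gb := fun _ => [bot])
    (ga := fun _ p ts => [atom p ts]) (gn := fun _ p ts => [natom p ts])
    (gand := fun _ A B _ _ => [pand A B]) (gor := fun _ _ _ a b => a ++ b)
    (gchand := fun _ c A B _ _ => [chand c A B]) (gchor := fun _ c A B _ _ => [chor c A B])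
    (gall := fun _ c A _ => [chall c A]) (gex := fun _ c A _ => [chex c A])).comp
      ((Primrec.const ()).pair hg)

@[fun_prop] theorem primrec_conjuncts {g : α → Cirquent} (hg : Primrec g) :
    Primrec fun a => conjuncts (g a) :=
  (primrec_rec (f := fun _ : Unit => conjuncts) (up := id) Primrec.id
    (gt := fun _ => [top]) (gb := fun _ => [bot])
    (ga := fun _ p ts => [atom p ts]) (gn := fun _ p ts => [natom p ts])
    (gand := fun _ _ _ a b => a ++ b) (gor := fun _ A B _ _ => [por A B])
    (gchand := fun _ c A B _ _ => [chand c A B]) (gchor := fun _ c A B _ _ => [chor c A B])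
    (gall := fun _ c A _ => [chall c A]) (gex := fun _ c A _ => [chex c A])).comp
      ((Primrec.const ()).pair hg)

end Operations

section Destructors

variable {α : Type} [Primcodable α]

/-- The conjuncts of a conjunction. -/
def asPand : Cirquent → Option (Cirquent × Cirquent)
  | pand A B => some (A, B)
  | _ => none

/-- The disjuncts of a disjunction. -/
def asPor : Cirquent → Option (Cirquent × Cirquent)
  | por A B => some (A, B)
  | _ => none

/-- The cluster and the components of a choice conjunction. -/
def asChand : Cirquent → Option (ℕ × Cirquent × Cirquent)
  | chand c A B => some (c, A, B)
  | _ => none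

/-- The cluster of a choice disjunction. -/
def chorCluster : Cirquent → Option ℕ
  | chor c _ _ => some c
  | _ => none

/-- The cluster and the body of a choice universal quantification. -/
def asChall : Cirquent → Option (ℕ × Cirquent)
  | chall c A => some (c, A)
  | _ => none

/-- The cluster of a choice existential quantification. -/
def chexCluster : Cirquent → Option ℕ
  | chex c _ => some c
  | _ => none

@[fun_prop] theorem primrec_asPand {g : α → Cirquent} (hg : Primrec g) :
    Primrec fun a => asPand (g a) :=
  (primrec_rec (f := fun _ : Unit => asPand) (up := id) Primrec.id
    (gt := fun _ => none) (gb := fun _ => none) (ga := fun _ _ _ => none)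
    (gn := fun _ _ _ => none) (gand := fun _ A B _ _ => some (A, B)) (gor := fun _ _ _ _ _ => none)
    (gchand := fun _ _ _ _ _ _ => none) (gchor := fun _ _ _ _ _ _ => none)
    (gall := fun _ _ _ _ => none) (gex := fun _ _ _ _ => none)).comp ((Primrec.const ()).pair hg)

@[fun_prop] theorem primrec_asPor {g : α → Cirquent} (hg : Primrec g) :
    Primrec fun a => asPor (g a) :=
  (primrec_rec (f := fun _ : Unit => asPor) (up := id) Primrec.id
    (gt := fun _ => none) (gb := fun _ => none) (ga := fun _ _ _ => none)
    (gn := fun _ _ _ => none) (gand := fun _ _ _ _ _ => none) (gor := fun _ A B _ _ => some (A, B))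
    (gchand := fun _ _ _ _ _ _ => none) (gchor := fun _ _ _ _ _ _ => none)
    (gall := fun _ _ _ _ => none) (gex := fun _ _ _ _ => none)).comp ((Primrec.const ()).pair hg)

@[fun_prop] theorem primrec_asChand {g : α → Cirquent} (hg : Primrec g) :
    Primrec fun a => asChand (g a) :=
  (primrec_rec (f := fun _ : Unit => asChand) (up := id) Primrec.id
    (gt := fun _ => none) (gb := fun _ => none) (ga := fun _ _ _ => none)
    (gn := fun _ _ _ => none) (gand := fun _ _ _ _ _ => none) (gor := fun _ _ _ _ _ => none)
    (gchand := fun _ c A B _ _ => some (c, A, B)) (gchor := fun _ _ _ _ _ _ => none)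
    (gall := fun _ _ _ _ => none) (gex := fun _ _ _ _ => none)).comp ((Primrec.const ()).pair hg)

@[fun_prop] theorem primrec_chorCluster {g : α → Cirquent} (hg : Primrec g) :
    Primrec fun a => chorCluster (g a) :=
  (primrec_rec (f := fun _ : Unit => chorCluster) (up := id) Primrec.id
    (gt := fun _ => none) (gb := fun _ => none) (ga := fun _ _ _ => none)
    (gn := fun _ _ _ => none) (gand := fun _ _ _ _ _ => none) (gor := fun _ _ _ _ _ => none)
    (gchand := fun _ _ _ _ _ _ => none) (gchor := fun _ c _ _ _ _ => some c)
    (gall := fun _ _ _ _ => none) (gex := fun _ _ _ _ => none)).comp ((Primrec.const ()).pair hg)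

@[fun_prop] theorem primrec_asChall {g : α → Cirquent} (hg : Primrec g) :
    Primrec fun a => asChall (g a) :=
  (primrec_rec (f := fun _ : Unit => asChall) (up := id) Primrec.id
    (gt := fun _ => none) (gb := fun _ => none) (ga := fun _ _ _ => none)
    (gn := fun _ _ _ => none) (gand := fun _ _ _ _ _ => none) (gor := fun _ _ _ _ _ => none)
    (gchand := fun _ _ _ _ _ _ => none) (gchor := fun _ _ _ _ _ _ => none)
    (gall := fun _ c A _ => some (c, A)) (gex := fun _ _ _ _ => none)).comp
      ((Primrec.const ()).pair hg)

@[fun_prop] theorem primrec_chexCluster {g : α → Cirquent} (hg : Primrec g) :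
    Primrec fun a => chexCluster (g a) :=
  (primrec_rec (f := fun _ : Unit => chexCluster) (up := id) Primrec.id
    (gt := fun _ => none) (gb := fun _ => none) (ga := fun _ _ _ => none)
    (gn := fun _ _ _ => none) (gand := fun _ _ _ _ _ => none) (gor := fun _ _ _ _ _ => none)
    (gchand := fun _ _ _ _ _ _ => none) (gchor := fun _ _ _ _ _ _ => none)
    (gall := fun _ _ _ _ => none) (gex := fun _ c _ _ => some c)).comp
      ((Primrec.const ()).pair hg)

end Destructors
end Cirquent

/-! ### The algorithm is primitive recursive, given a bound on its run -/

namespace Cirquent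

section Stages

variable {α : Type} [Primcodable α]

@[fun_prop] theorem primrec_orBot {g : α → Cirquent} (hg : Primrec g) :
    Primrec fun a => orBot (g a) := by
  have h : Primrec fun a => (asPor (g a)).bind fun p =>
      if p.1 = bot then some p.2 else if p.2 = bot then some p.1 else none := by fun_prop
  refine h.of_eq fun a => ?_
  cases g a with
  | por A B => cases A <;> cases B <;> simp [orBot, asPor]
  | _ => rfl

@[fun_prop] theorem primrec_andBot {g : α → Cirquent} (hg : Primrec g) :
    Primrec fun a => andBot (g a) := by
  have h : Primrec fun a => (asPand (g a)).bind fun p =>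
      if p.1 = bot then some bot else if p.2 = bot then some bot else none := by fun_prop
  refine h.of_eq fun a => ?_
  cases g a with
  | pand A B => cases A <;> cases B <;> simp [andBot, asPand]
  | _ => rfl

@[fun_prop] theorem primrec_orTop {g : α → Cirquent} (hg : Primrec g) :
    Primrec fun a => orTop (g a) := by
  have h : Primrec fun a => (asPor (g a)).bind fun p =>
      if p.1 = top then some top else if p.2 = top then some top else none := by fun_prop
  refine h.of_eq fun a => ?_
  cases g a with
  | por A B => cases A <;> cases B <;> simp [orTop, asPor]
  | _ => rfl

@[fun_prop] theorem primrec_andTop {g : α → Cirquent} (hg : Primrec g) :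
    Primrec fun a => andTop (g a) := by
  have h : Primrec fun a => (asPand (g a)).bind fun p =>
      if p.1 = top then some p.2 else if p.2 = top then some p.1 else none := by fun_prop
  refine h.of_eq fun a => ?_
  cases g a with
  | pand A B => cases A <;> cases B <;> simp [andTop, asPand]
  | _ => rfl

@[fun_prop] theorem primrec_orAnd {g : α → Cirquent} (hg : Primrec g) :
    Primrec fun a => orAnd (g a) := by
  have h : Primrec fun a => (asPor (g a)).bind fun p =>
      ((asPand p.1).map fun q => pand (por q.1 p.2) (por q.2 p.2)) <|>
        (asPand p.2).map fun q => pand (por q.1 p.1) (por q.2 p.1) := by fun_prop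
  refine h.of_eq fun a => ?_
  cases g a with
  | por A B => cases A <;> cases B <;> rfl
  | _ => rfl

@[fun_prop] theorem primrec_orChand {g : α → Cirquent} (hg : Primrec g) :
    Primrec fun a => orChand (g a) := by
  have h : Primrec fun a => (asPor (g a)).bind fun p =>
      ((asChand p.1).map fun q => chand q.1 (por q.2.1 p.2) (por q.2.2 p.2)) <|>
        (asChand p.2).map fun q => chand q.1 (por q.2.1 p.1) (por q.2.2 p.1) := by fun_prop
  refine h.of_eq fun a => ?_
  cases g a with
  | por A B => cases A <;> cases B <;> rfl
  | _ => rfl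

@[fun_prop] theorem primrec_orChall {g : α → Cirquent} (hg : Primrec g) :
    Primrec fun a => orChall (g a) := by
  have h : Primrec fun a => (asPor (g a)).bind fun p =>
      ((asChall p.1).map fun q => chall q.1 (por q.2 p.2.weaken)) <|>
        (asChall p.2).map fun q => chall q.1 (por q.2 p.1.weaken) := by fun_prop
  refine h.of_eq fun a => ?_
  cases g a with
  | por A B => cases A <;> cases B <;> rfl
  | _ => rfl

@[fun_prop] theorem primrec_isOpposed {l : α → List Cirquent} {g : α → Cirquent}
    (hl : Primrec l) (hg : Primrec g) : Primrec fun a => isOpposed (l a) (g a) := by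
  have h : Primrec fun q : List Cirquent × Cirquent => isOpposed q.1 q.2 :=
    primrec_rec (f := isOpposed) (up := id) Primrec.id
      (gt := fun _ => false) (gb := fun _ => false)
      (ga := fun l p ts => decide (natom p ts ∈ l)) (gn := fun _ _ _ => false)
      (gand := fun _ _ _ _ _ => false) (gor := fun _ _ _ _ _ => false)
      (gchand := fun _ _ _ _ _ _ => false) (gchor := fun _ _ _ _ _ _ => false)
      (gall := fun _ _ _ _ => false) (gex := fun _ _ _ _ => false)
  exact h.comp (hl.pair hg)

@[fun_prop] theorem primrec_orTrivial {g : α → Cirquent} (hg : Primrec g) :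
    Primrec fun a => orTrivial (g a) := by
  have h : Primrec fun a => (asPor (g a)).bind fun p =>
      if (disjuncts (por p.1 p.2)).any (isOpposed (disjuncts (por p.1 p.2))) = true
      then some top else none := by fun_prop
  refine h.of_eq fun a => ?_
  cases g a <;> rfl

@[fun_prop] theorem primrec_andChandChand {c : α → ℕ} {g : α → Cirquent} (hc : Primrec c)
    (hg : Primrec g) : Primrec fun a => andChandChand (c a) (g a) := by
  have h : Primrec fun a => (asPand (g a)).bind fun p => (asChand p.1).bind fun q =>
      (asChand p.2).map fun r => chand (c a)
        (chand q.1 (pand q.2.1 p.2) (pand q.2.2 p.2))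
        (chand r.1 (pand p.1 r.2.1) (pand p.1 r.2.2)) := by fun_prop
  refine h.of_eq fun a => ?_
  cases g a with
  | pand A B => cases A <;> cases B <;> rfl
  | _ => rfl

@[fun_prop] theorem primrec_andChallChall {c : α → ℕ} {g : α → Cirquent} (hc : Primrec c)
    (hg : Primrec g) : Primrec fun a => andChallChall (c a) (g a) := by
  have h : Primrec fun a => (asPand (g a)).bind fun p => (asChall p.1).bind fun q =>
      (asChall p.2).map fun r => chand (c a)
        (chall q.1 (pand q.2 p.2.weaken)) (chall r.1 (pand p.1.weaken r.2)) := by fun_prop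
  refine h.of_eq fun a => ?_
  cases g a with
  | pand A B => cases A <;> cases B <;> rfl
  | _ => rfl

@[fun_prop] theorem primrec_andChandChall {c : α → ℕ} {g : α → Cirquent} (hc : Primrec c)
    (hg : Primrec g) : Primrec fun a => andChandChall (c a) (g a) := by
  have h : Primrec fun a => (asPand (g a)).bind fun p =>
      ((asChand p.1).bind fun q => (asChall p.2).map fun r => chand (c a)
        (chand q.1 (pand q.2.1 p.2) (pand q.2.2 p.2)) (chall r.1 (pand p.1.weaken r.2))) <|>
      (asChand p.2).bind fun q => (asChall p.1).map fun r => chand (c a)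
        (chand q.1 (pand q.2.1 p.1) (pand q.2.2 p.1)) (chall r.1 (pand p.2.weaken r.2)) := by
    fun_prop
  refine h.of_eq fun a => ?_
  cases g a with
  | pand A B => cases A <;> cases B <;> rfl
  | _ => rfl

@[fun_prop] theorem primrec_pickLeft {c d : α → ℕ} {g : α → Cirquent} (hc : Primrec c)
    (hg : Primrec g) : Primrec fun a => pickLeft (c a) (d a) (g a) := by
  have h : Primrec fun a => (asChand (g a)).bind fun q =>
      if q.1 = c a then some q.2.1 else none := by fun_prop
  refine h.of_eq fun a => ?_
  cases g a <;> rfl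

@[fun_prop] theorem primrec_pickRight {c d : α → ℕ} {g : α → Cirquent} (hc : Primrec c)
    (hg : Primrec g) : Primrec fun a => pickRight (c a) (d a) (g a) := by
  have h : Primrec fun a => (asChand (g a)).bind fun q =>
      if q.1 = c a then some q.2.2 else none := by fun_prop
  refine h.of_eq fun a => ?_
  cases g a <;> rfl

@[fun_prop] theorem primrec_identify {c d : α → ℕ} {g : α → Cirquent} (hc : Primrec c)
    (hd : Primrec d) (hg : Primrec g) : Primrec fun a => identify (c a) (d a) (g a) := by
  have h : Primrec fun a => (asChall (g a)).bind fun q =>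
      if q.1 = c a then some (q.2.inst (Term.var (d a))) else none := by fun_prop
  refine h.of_eq fun a => ?_
  cases g a <;> rfl

theorem primrec_stage1 : Primrec stage1 := by unfold stage1; fun_prop
theorem primrec_stage2 : Primrec stage2 := by unfold stage2; fun_prop
theorem primrec_stage3 : Primrec stage3 := by unfold stage3; fun_prop
theorem primrec_stage4 : Primrec stage4 := by unfold stage4; fun_prop
theorem primrec_stage5 : Primrec stage5 := by unfold stage5; fun_prop

theorem primrec_stage6 : Primrec stage6 := by
  unfold stage6 stage6a stage6b stage6c
  fun_prop

theorem primrec_stage7 : Primrec stage7 := by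
  have h : Primrec fun E => ((asChand E).map fun q => chand q.1
      ((anywhere (pickLeft q.1) 0 q.2.1).getD q.2.1)
      ((anywhere (pickRight q.1) 0 q.2.2).getD q.2.2)).getD E := by fun_prop
  refine h.of_eq fun E => ?_
  cases E <;> rfl

theorem primrec_stage8 : Primrec stage8 := by
  have h : Primrec fun E => ((asChall E).map fun q => chall q.1
      ((anywhere (identify q.1) 0 q.2).getD q.2)).getD E := by fun_prop
  refine h.of_eq fun E => ?_
  cases E <;> rfl

theorem primrec_loop {stage : Cirquent → Cirquent} (hs : Primrec stage) {n : α → ℕ}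
    {g : α → Cirquent} (hn : Primrec n) (hg : Primrec g) :
    Primrec fun a => loop stage (n a) (g a) := by
  refine Primrec.comp (f := fun p : ℕ × Cirquent => loop stage p.1 p.2)
    (Primrec.nat_omega_rec' _ (m := Prod.fst)
      (l := fun p => if p.1 = 0 then [] else if stage p.2 = p.2 then [] else
        [(p.1 - 1, stage p.2)])
      (g := fun p s => if p.1 = 0 then some none else if stage p.2 = p.2 then some (some p.2) else
        s[0]?) (by fun_prop) (by fun_prop) (Primrec₂.mk (by fun_prop)) ?_ ?_) (hn.pair hg)
  · rintro ⟨n, E⟩ b h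
    dsimp only at h ⊢
    split_ifs at h with h1 h2
    · simp at h
    · simp at h
    · rw [List.mem_singleton] at h
      subst h
      dsimp only
      omega
  · rintro ⟨_ | n, E⟩
    · rfl
    · by_cases h : stage E = E <;> simp [h, loop]

@[fun_prop] theorem primrec_purify {n : α → ℕ} {g : α → Cirquent} (hn : Primrec n)
    (hg : Primrec g) : Primrec fun a => purify (n a) (g a) := by
  have step : ∀ {stage : Cirquent → Cirquent}, Primrec stage → ∀ {f : α → Option Cirquent},
      Primrec f → Primrec fun a => (f a).bind (loop stage (n a)) := fun hs f hf =>
    Primrec.option_bind_comp hf (primrec_loop hs (by fun_prop) Primrec.snd)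
  have h := step primrec_stage8 <| step primrec_stage7 <| step primrec_stage6 <|
    step primrec_stage5 <| step primrec_stage4 <| step primrec_stage3 <|
    step primrec_stage2 <| primrec_loop primrec_stage1 hn hg
  refine h.of_eq fun a => ?_
  simp only [Option.bind_assoc]
  rfl

end Stages

section Calls

variable {α : Type} [Primcodable α]

@[fun_prop] theorem primrec_choices {f g : α → Cirquent} (hf : Primrec f) (hg : Primrec g) :
    Primrec fun a => choices (f a) (g a) := by
  have h : Primrec fun a => (disjuncts (g a)).flatMap fun A =>
      ((chorCluster A).map fun c => [chooseOr c false (f a), chooseOr c true (f a)]).getD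
        (((chexCluster A).map fun c =>
          (consts (f a) ++ [freshConst (f a)]).map fun k => chooseEx c k (f a)).getD []) := by
    fun_prop
  refine h.of_eq fun a => ?_
  unfold choices
  congr 1
  funext A
  cases A <;> rfl

@[fun_prop] theorem primrec_notChandChallRooted {g : α → Cirquent} (hg : Primrec g) :
    Primrec fun a => notChandChallRooted (g a) :=
  (primrec_rec (f := fun _ : Unit => notChandChallRooted) (up := id) Primrec.id
    (gt := fun _ => true) (gb := fun _ => true) (ga := fun _ _ _ => true)
    (gn := fun _ _ _ => true) (gand := fun _ _ _ _ _ => true) (gor := fun _ _ _ _ _ => true)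
    (gchand := fun _ _ _ _ _ _ => false) (gchor := fun _ _ _ _ _ _ => true)
    (gall := fun _ _ _ _ => false) (gex := fun _ _ _ _ => true)).comp ((Primrec.const ()).pair hg)

@[fun_prop] theorem primrec_calls {g : α → Cirquent} (hg : Primrec g) :
    Primrec fun a => calls (g a) :=
  (primrec_rec (f := fun _ : Unit => calls) (up := id) Primrec.id
    (gt := fun _ => choices top top) (gb := fun _ => choices bot bot)
    (ga := fun _ p ts => choices (atom p ts) (atom p ts))
    (gn := fun _ p ts => choices (natom p ts) (natom p ts))
    (gand := fun _ A B _ _ => (((conjuncts (pand A B)).find? notChandChallRooted).map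
      fun C => choices (pand A B) C).getD [])
    (gor := fun _ A B _ _ => choices (por A B) (por A B))
    (gchand := fun _ _ A B _ _ => [A, B])
    (gchor := fun _ c A B _ _ => choices (chor c A B) (chor c A B))
    (gall := fun _ c A _ => [A.inst (Term.const (freshConst (chall c A)))])
    (gex := fun _ c A _ => choices (chex c A) (chex c A))
    (hand := fun _ A B => by
      dsimp only [calls]
      cases (conjuncts (pand A B)).find? notChandChallRooted <;> rfl)).comp
    ((Primrec.const ()).pair hg)

@[fun_prop] theorem primrec_combine {f : α → Cirquent} {l : α → List Bool} (hf : Primrec f)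
    (hl : Primrec l) : Primrec fun a => combine (f a) (l a) :=
  (primrec_rec (f := fun (l : List Bool) E => combine E l) (up := id) Primrec.id
    (gt := fun l => l.all fun b => b) (gb := fun l => l.any fun b => b)
    (ga := fun l _ _ => l.any fun b => b) (gn := fun l _ _ => l.any fun b => b)
    (gand := fun l _ _ _ _ => l.any fun b => b) (gor := fun l _ _ _ _ => l.any fun b => b)
    (gchand := fun l _ _ _ _ _ => l.all fun b => b)
    (gchor := fun l _ _ _ _ _ => l.any fun b => b)
    (gall := fun l _ _ _ => l.all fun b => b) (gex := fun l _ _ _ => l.any fun b => b)).comp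
      (hl.pair hf)

theorem mapM_eq_foldr {β γ : Type*} (f : β → Option γ) (l : List β) :
    l.mapM f = (l.map f).foldr (fun x r => x.bind fun b => r.map fun s => b :: s) (some []) := by
  induction l with
  | nil => rfl
  | cons b l ih =>
    rw [List.mapM_cons, ih, List.map_cons, List.foldr_cons]
    cases f b with
    | none => rfl
    | some c => exact Option.map_eq_bind.symm

theorem primrec_run : Primrec fun p : ℕ × Cirquent => run p.1 p.2 := by
  refine Primrec.nat_omega_rec' _ (m := Prod.fst)
    (l := fun p => if p.1 = 0 then [] else
      ((purify (p.1 - 1) p.2).map fun F => (calls F).map fun D => (p.1 - 1, D)).getD [])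
    (g := fun p s => some (if p.1 = 0 then none else
      (purify (p.1 - 1) p.2).bind fun F =>
        (s.foldr (fun x r => x.bind fun b => r.map fun s => b :: s) (some [])).map fun l =>
          combine F l))
    (by fun_prop) (by fun_prop) (Primrec₂.mk (by fun_prop)) ?_ ?_
  · rintro ⟨_ | n, E⟩ ⟨k, D⟩ h
    · simp at h
    · cases hF : purify n E with
      | none => simp [hF] at h
      | some F =>
        simp only [Nat.add_eq_zero_iff, one_ne_zero, and_false, if_false, Nat.add_sub_cancel, hF,
          Option.map_some, Option.getD_some, List.mem_map, Prod.mk.injEq] at h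
        obtain ⟨_, _, rfl, _⟩ := h
        exact Nat.lt_succ_self _
  · rintro ⟨_ | n, E⟩
    · rfl
    · cases hF : purify n E with
      | none => simp [hF, run]
      | some F =>
        simp only [Nat.add_eq_zero_iff, one_ne_zero, and_false, if_false, Nat.add_sub_cancel, hF,
          Option.map_some, Option.getD_some, Option.bind_some, run, Option.bind_eq_bind,
          mapM_eq_foldr, List.map_map]
        exact congrArg some Option.map_eq_bind

theorem partrec_decision : Partrec decision :=
  Partrec.rfindOpt (f := fun E n => run n E)
    (Computable₂.mk (primrec_run.to_comp.comp (Computable.snd.pair Computable.fst)))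

end Calls

theorem mem_decision {E : Cirquent} (hE : E.Closed) :
    ∃ b, b ∈ E.decision ∧ (b = true ↔ E.Provable) := by
  obtain ⟨b, hb⟩ := exists_run_eq_some (E := E) (n := rank E + 2) (by omega)
  have hdom : E.decision.Dom := Nat.rfindOpt_dom.2 ⟨_, b, hb⟩
  obtain ⟨n, hn⟩ := Nat.rfindOpt_spec (Part.get_mem hdom)
  exact ⟨_, Part.get_mem hdom, (run_spec hE hn).1, fun h => (run_spec hE hn).2 h.valid⟩

theorem computablePred_closed_and_provable :
    ComputablePred fun E : Cirquent => E.Closed ∧ E.Provable := by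
  classical
  have hp : Partrec fun E : Cirquent =>
      cond (isClosedAt 0 E) (decision E) (Part.some false) :=
    Partrec.cond (primrec_isClosedAt (Primrec.const 0) Primrec.id).to_comp partrec_decision
      (Computable.const false)
  refine ⟨inferInstance, Partrec.of_eq_tot hp fun E => ?_⟩
  cases h : isClosedAt 0 E with
  | false =>
    have hE : ¬ E.Closed := fun hE => by simp [isClosedAt_eq_true.2 hE] at h
    simp [hE]
  | true =>
    have hE : E.Closed := isClosedAt_eq_true.1 h
    obtain ⟨b, hb, hiff⟩ := mem_decision hE
    simpa [hE, ← hiff] using hb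

end Cirquent

theorem theorem8p1 :
    -- DECISION is an algorithm
    Partrec Cirquent.decision ∧
    -- on closed cirquents it halts, and it accepts the provable ones and rejects the others
    (∀ E : Cirquent, E.Closed →
      (E.Provable → true ∈ E.decision) ∧ (¬ E.Provable → false ∈ E.decision)) ∧
    -- every recursive call is made on a cirquent of smaller rank
    (∀ (E F : Cirquent) (n : ℕ), E.Closed → Cirquent.purify n E = some F →
      ∀ D ∈ F.calls, D.rank < E.rank) ∧
    -- CL17 is decidable
    ComputablePred (fun E : Cirquent => E.Closed ∧ E.Provable) := by
  refine ⟨Cirquent.partrec_decision, fun E hE => ?_, fun E F n _ hF D hD => ?_,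
    Cirquent.computablePred_closed_and_provable⟩
  · obtain ⟨b, hb, hiff⟩ := Cirquent.mem_decision hE
    cases b with
    | true => exact ⟨fun _ => hb, fun h => absurd (hiff.1 rfl) h⟩
    | false => exact ⟨fun h => absurd (hiff.2 h) Bool.false_ne_true, fun _ => hb⟩
  · exact (Cirquent.rank_lt_of_mem_calls hD).trans_le (Cirquent.rank_le_of_purify hF)
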